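/- Let $L$ be an even, non-degenerate, integral lattice with bilinear form $(\cdot,\cdot)$, of signature $(b^+,b^-)$, $\mathrm{sgn}(L)=b^+-b^-$, $\dim(L)=b^++b^-$, dual lattice $L'\subset L\otimes\mathbb{Q}$ and discriminant group $A=L'/L$. For an integer $r\ge 1$ let $L(r)$ be the lattice $L$ with the form $(\cdot,\cdot)_r=r(\cdot,\cdot)$, and let $A(r)=L(r)'/L(r)=\tfrac1r L'/L\subset (L\otimes\mathbb{Q})/L$ be its discriminant group, with $q_r(x+L)=\tfrac12(x,x)_r$ (modulo $\mathbb{Z}$) and $q=q_1$. For $kl=r$ and $\mu\in A(r)$ put $\Delta_r(\mu,k)=1$ if $\mu\in A(l)\subseteq A(r)$ and $\Delta_r(\mu,k)=0$ otherwise. Write $\boldsymbol{e}(x)=e^{2\pi i x}$, and let $(e_\lambda)_{\lambda\in A}$ be the standard basis of $\mathbb{C}[A]$. Let $\mathrm{Mp}_2(\mathbb{Z})$ be the group of pairs $(M,\phi)$ with $M=\begin{pmatrix}a&b\\c&d\end{pmatrix}\in \mathrm{SL}_2(\mathbb{Z})$ and $\phi$ holomorphic on the upper half-plane $\mathbb{H}$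 with $\phi(\tau)^2=c\tau+d$, and product $(M_1,\phi_1(\tau))(M_2,\phi_2(\tau))=(M_1M_2,\phi_1(M_2\tau)\phi_2(\tau))$. The Weil representation $\rho_L$ of $\mathrm{Mp}_2(\mathbb{Z})$ on $\mathbb{C}[A]$ is given on the generators $T=\left(\begin{pmatrix}1&1\\0&1\end{pmatrix},1\right)$ and $S=\left(\begin{pmatrix}0&-1\\1&0\end{pmatrix},\sqrt\tau\right)$ by $$\rho_L(T)e_\lambda=\boldsymbol{e}(q(\lambda))\,e_\lambda,\qquad \rho_L(S)e_\lambda=\frac{\boldsymbol{e}(-\mathrm{sgn}(L)/8)}{\sqrt{|A|}}\sum_{\mu\in A}\boldsymbol{e}(-(\lambda,\mu))\,e_\mu .$$ For $v,\bar v\in\tfrac12\mathbb{Z}$, a real analytic function $\psi:\mathbb{H}\to\mathbb{C}[A]$ is called vector-valued modular of type $\rho_L$ and weight $(v,\bar v)$ if $\psi(M\tau)=\phi(\tau)^{2v}\,\overline{\phi(\tau)}^{\,2\bar v}\,\rho_L(M,\phi)\,\psi(\tau)$ for all $(M,\phi)\in \mathrm{Mp}_2(\mathbb{Z})$ and $\tau\in\mathbb{H}$.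 With $(w,\bar w)=(v+\tfrac12 b^+,\bar v+\tfrac12 b^-)$, define, for $\psi=\sum_{\lambda\in A}\psi_\lambda e_\lambda$, $$\mathcal{T}_r[\psi](\tau)=r^{w+\bar w-1}\sum_{\mu\in A(r)}\Bigg(\sum_{\substack{k,l>0\\kl=r}}\frac1{l^{w+\bar w}}\sum_{s=0}^{l-1}\Delta_r(\mu,k)\,\boldsymbol{e}\Big(-\frac sk q_r(\mu)\Big)\psi_{l\mu}\Big(\frac{k\tau+s}{l}\Big)\Bigg)e_\mu ,$$ for $\psi=\sum_{\nu\in A(n^2)}\psi_\nu e_\nu$, $$\mathcal{P}_{n^2}[\psi](\tau)=\frac1{n^{\dim(L)}}\sum_{\lambda\in A}\Bigg(\sum_{\substack{\gamma\in A(n^2)\\n\gamma=\lambda}}\Delta_{n^2}(\gamma,n)\,\psi_\gamma(\tau)\Bigg)e_\lambda ,$$ and $\mathcal{H}_{n^2}=\mathcal{P}_{n^2}\circ\mathcal{T}_{n^2}$. (When $\Delta_r(\mu,k)=1$, the number $\boldsymbol{e}(-\frac sk q_r(\mu))$ does not depend on the representative of $\mu$ and $l\mu\in A$; all other terms are $0$.)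 **Proposition.** Let $n\ge1$ be an integer, and let $\psi=\sum_{\lambda\in A}\psi_\lambda e_\lambda$ be vector-valued modular of type $\rho_L$ and weight $(v,\bar v)$. Then $\mathcal{H}_{n^2}[\psi]$ is also vector-valued modular of type $\rho_L$ and weight $(v,\bar v)$, and $$\mathcal{H}_{n^2}[\psi](\tau)=n^{2(v+\bar v-1)}\sum_{\lambda\in A}\Bigg(\sum_{\substack{\gamma\in A(n^2)\\n\gamma=\lambda}}\ \sum_{\substack{k,l>0\\kl=n^2}}\frac1{l^{v+\bar v+\frac12\dim(L)}}\sum_{s=0}^{l-1}\Delta_{n^2}(\gamma,n)\,\Delta_{n^2}(\gamma,k)\,\boldsymbol{e}\Big(-\frac sk q_{n^2}(\gamma)\Big)\,\psi_{l\gamma}\Big(\frac{k\tau+s}{l}\Big)\Bigg)e_\lambda .$$ -/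

import Mathlib

open scoped MatrixGroups ComplexConjugate Manifold
open UpperHalfPlane

/-! ### The metaplectic group -/

/-- The metaplectic group `Mp₂(ℤ)`: pairs `(M, φ)` with `M = (a b; c d) ∈ SL₂(ℤ)` and `φ` a
holomorphic function on the upper half-plane with `φ(τ)² = c τ + d`. -/
@[ext]
structure Mp2Z where
  /-- the underlying matrix `M` -/
  mat : SL(2, ℤ)
  /-- the chosen square root of `c τ + d` -/
  phi : ℍ → ℂ
  holo : DifferentiableOn ℂ (fun z : ℂ => phi (ofComplex z)) {z : ℂ | 0 < z.im}
  sq : ∀ τ : ℍ, phi τ ^ 2 = ((mat 1 0 : ℤ) : ℂ) * (τ : ℂ) + ((mat 1 1 : ℤ) : ℂ)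

namespace Mp2Z

theorem denom_eq (M : SL(2, ℤ)) (τ : ℍ) :
    ((M 1 0 : ℤ) : ℂ) * (τ : ℂ) + ((M 1 1 : ℤ) : ℂ) = denom M τ := by
  simp [denom]

theorem denom_mul (M N : SL(2, ℤ)) (τ : ℍ) :
    (((M * N) 1 0 : ℤ) : ℂ) * (τ : ℂ) + (((M * N) 1 1 : ℤ) : ℂ) =
      (((M 1 0 : ℤ) : ℂ) * ((N • τ : ℍ) : ℂ) + ((M 1 1 : ℤ) : ℂ)) *
        (((N 1 0 : ℤ) : ℂ) * (τ : ℂ) + ((N 1 1 : ℤ) : ℂ)) := by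
  rw [denom_eq, denom_eq, denom_eq]
  have := denom_cocycle_σ (M : GL (Fin 2) ℝ) (N : GL (Fin 2) ℝ) τ
  simp [σ] at this
  simpa using this

theorem phi_ne_zero (g : Mp2Z) (τ : ℍ) : g.phi τ ≠ 0 := by
  intro h
  have h2 := g.sq τ
  rw [denom_eq, h] at h2
  exact denom_ne_zero (g.mat : GL (Fin 2) ℝ) τ (by simpa using h2.symm)

theorem holo_smul (φ : ℍ → ℂ)
    (h : DifferentiableOn ℂ (fun z : ℂ => φ (ofComplex z)) {z : ℂ | 0 < z.im}) (M : SL(2, ℤ)) :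
    DifferentiableOn ℂ (fun z : ℂ => φ (M • ofComplex z)) {z : ℂ | 0 < z.im} := by
  have h1 : MDiff φ := mdifferentiable_iff.2 h
  have h2 : MDiff (fun τ : ℍ => M • τ) :=
    mdifferentiable_smul (g := (M : GL (Fin 2) ℝ)) (by simp)
  exact mdifferentiable_iff.1 (h1.comp h2)

/-- `(M₁, φ₁(τ)) · (M₂, φ₂(τ)) = (M₁ M₂, φ₁(M₂ τ) φ₂(τ))`. -/
noncomputable instance : Mul Mp2Z where
  mul g h :=
    { mat := g.mat * h.mat
      phi := fun τ => g.phi (h.mat • τ) * h.phi τ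
      holo := (holo_smul g.phi g.holo h.mat).mul h.holo
      sq := fun τ => by
        rw [mul_pow, g.sq, h.sq, denom_mul] }

instance : One Mp2Z where
  one :=
    { mat := 1
      phi := fun _ => 1
      holo := by fun_prop
      sq := fun τ => by simp }

noncomputable instance : Inv Mp2Z where
  inv g :=
    { mat := g.mat⁻¹
      phi := fun τ => (g.phi (g.mat⁻¹ • τ))⁻¹
      holo := (holo_smul g.phi g.holo g.mat⁻¹).inv fun z _ => phi_ne_zero g _
      sq := fun τ => by
        rw [inv_pow, g.sq, inv_eq_iff_eq_inv]
        refine eq_inv_of_mul_eq_one_left ?_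
        rw [← denom_mul, mul_inv_cancel]
        simp }

@[simp] theorem mul_mat (g h : Mp2Z) : (g * h).mat = g.mat * h.mat := rfl
@[simp] theorem mul_phi (g h : Mp2Z) (τ : ℍ) :
    (g * h).phi τ = g.phi (h.mat • τ) * h.phi τ := rfl
@[simp] theorem one_mat : (1 : Mp2Z).mat = 1 := rfl
@[simp] theorem one_phi (τ : ℍ) : (1 : Mp2Z).phi τ = 1 := rfl
@[simp] theorem inv_mat (g : Mp2Z) : g⁻¹.mat = g.mat⁻¹ := rfl
@[simp] theorem inv_phi (g : Mp2Z) (τ : ℍ) : g⁻¹.phi τ = (g.phi (g.mat⁻¹ • τ))⁻¹ := rfl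

noncomputable instance : Group Mp2Z where
  mul_assoc a b c := by
    ext1
    · simp [mul_assoc]
    · funext τ; simp [mul_assoc, mul_smul]
  one_mul a := by
    ext1
    · simp
    · funext τ; simp
  mul_one a := by
    ext1
    · simp
    · funext τ; simp
  inv_mul_cancel a := by
    ext1
    · simp
    · funext τ; simp [phi_ne_zero]

/-- The generator `T = ((1 1; 0 1), 1)`. -/
def T : Mp2Z where
  mat := ModularGroup.T
  phi := fun _ => 1
  holo := by fun_prop
  sq := fun τ => by simp [ModularGroup.T]

/-- The generator `S = ((0 -1; 1 0), √τ)`, with the principal branch of the square root. -/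
noncomputable def S : Mp2Z where
  mat := ModularGroup.S
  phi := fun τ => (τ : ℂ) ^ (1 / 2 : ℂ)
  holo := by
    have : DifferentiableOn ℂ (fun z : ℂ => z ^ (1 / 2 : ℂ)) {z : ℂ | 0 < z.im} := by
      intro z hz
      have hz' : z ∈ Complex.slitPlane := Or.inr (ne_of_gt hz)
      exact (DifferentiableAt.cpow_const (c := (1 / 2 : ℂ)) differentiableAt_id hz').differentiableWithinAt
    refine this.congr fun z hz => ?_
    simp [ofComplex_apply_of_im_pos hz]
  sq := fun τ => by
    rw [← Complex.cpow_nat_mul]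
    simp [ModularGroup.S]

theorem pow_mat (g : Mp2Z) (m : ℕ) : (g ^ m).mat = g.mat ^ m := by
  induction m with
  | zero => rfl
  | succ m ih => rw [pow_succ, pow_succ, mul_mat, ih]

theorem S_pow_four_mat : (S ^ 4).mat = 1 := by
  rw [pow_mat]
  decide +kernel

theorem S_pow_four_phi (τ : ℍ) : (S ^ 4).phi τ = -1 := by
  have h2 : (S ^ 2).mat = -1 := by
    rw [pow_mat]
    decide +kernel
  have h := (S ^ 2).sq τ
  rw [show (4 : ℕ) = 2 + 2 from rfl, pow_add, mul_phi, h2]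
  rw [h2] at h
  rw [ModularGroup.SL_neg_smul, one_smul, ← pow_two, h]
  simp

theorem eq_one_or_of_mat_eq_one (g : Mp2Z) (hg : g.mat = 1) : g = 1 ∨ g = S ^ 4 := by
  have hs : ∀ τ : ℍ, g.phi τ ^ 2 = 1 := fun τ => by
    have := g.sq τ
    rw [hg] at this
    simpa using this
  have hpc : IsPreconnected {z : ℂ | 0 < z.im} := (convex_halfSpace_im_gt 0).isPreconnected
  rcases hpc.eq_or_eq_neg_of_sq_eq g.holo.continuousOn (continuousOn_const (c := (1 : ℂ)))
    (fun z _ => by simp [hs]) (fun _ => one_ne_zero) with h | h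
  · left
    ext1
    · exact hg
    · funext τ
      simpa using h τ.im_pos
  · right
    ext1
    · rw [hg, S_pow_four_mat]
    · funext τ
      rw [S_pow_four_phi]
      simpa using h τ.im_pos

/-- `S` and `T` generate `Mp₂(ℤ)`, even as a monoid. -/
theorem mclosure_eq_top : Submonoid.closure {T, S} = ⊤ := by
  set N : Submonoid Mp2Z := Submonoid.closure {T, S} with hN
  have hT : T ∈ N := Submonoid.subset_closure (by simp)
  have hS : S ∈ N := Submonoid.subset_closure (by simp)
  have hker : ∀ g : Mp2Z, g.mat = 1 → g ∈ N := fun g hg => by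
    rcases eq_one_or_of_mat_eq_one g hg with rfl | rfl
    · exact N.one_mem
    · exact N.pow_mem hS 4
  have hSi : S⁻¹ ∈ N := by
    have h1 : S⁻¹ = S ^ 3 * (S ^ 4)⁻¹ := by group
    rw [h1]
    exact N.mul_mem (N.pow_mem hS 3) (hker _ (by rw [inv_mat, S_pow_four_mat, inv_one]))
  have hTi : T⁻¹ ∈ N := by
    set h : Mp2Z := S ^ 3 * T * S * T * S
    have hh : h ∈ N :=
      N.mul_mem (N.mul_mem (N.mul_mem (N.mul_mem (N.pow_mem hS 3) hT) hS) hT) hS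
    have h1 : T⁻¹ = h * (T * h)⁻¹ := by group
    have h2 : (T * h).mat = 1 := by
      simp only [h, mul_mat, pow_mat]
      decide +kernel
    rw [h1]
    exact N.mul_mem hh (hker _ (by rw [inv_mat, h2, inv_one]))
  let f : Mp2Z →* SL(2, ℤ) := { toFun := mat, map_one' := rfl, map_mul' := fun _ _ => rfl }
  have hsub : ∀ g ∈ Subgroup.closure {S, T}, g ∈ N := by
    intro g hg
    induction hg using Subgroup.closure_induction'' with
    | mem g hg => rcases hg with rfl | rfl <;> assumption
    | inv_mem g hg => rcases hg with rfl | rfl <;> assumption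
    | one => exact N.one_mem
    | mul g h _ _ h1 h2 => exact N.mul_mem h1 h2
  have hmap : (Subgroup.closure {S, T}).map f = ⊤ := by
    rw [MonoidHom.map_closure, Set.image_pair]
    exact SpecialLinearGroup.SL2Z_generators
  refine eq_top_iff.2 fun g _ => ?_
  obtain ⟨h, hh, hgh⟩ : f g ∈ (Subgroup.closure {S, T}).map f := hmap ▸ Subgroup.mem_top _
  have h1 : g = h * (h⁻¹ * g) := by group
  rw [h1]
  refine N.mul_mem (hsub h hh) (hker _ ?_)
  change h.mat⁻¹ * g.mat = 1
  rw [show h.mat = g.mat from hgh, inv_mul_cancel]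

end Mp2Z

/-! ### Even lattices and discriminant groups -/

/-- An even non-degenerate integral lattice: a full-rank lattice `L` in a finite-dimensional
rational vector space `V = L ⊗ ℚ`, with a non-degenerate symmetric bilinear form `B` on `V` that is
integral on `L` and even on the diagonal of `L`. -/
class IsEvenLattice {V : Type*} [AddCommGroup V] [Module ℚ V]
    (B : LinearMap.BilinForm ℚ V) (L : Submodule ℤ V) : Prop where
  lattice : L.IsLattice ℚ
  symm : B.IsSymm
  nondegenerate : B.Nondegenerate
  integral : ∀ x ∈ L, ∀ y ∈ L, ∃ m : ℤ, B x y = m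
  even : ∀ x ∈ L, ∃ m : ℤ, B x x = 2 * m

/-- The form `(·,·)_r = r (·,·)` of the rescaled lattice `L(r)` (which has the same underlying
group `L`). -/
def rescale {V : Type*} [AddCommGroup V] [Module ℚ V]
    (r : ℕ) (B : LinearMap.BilinForm ℚ V) : LinearMap.BilinForm ℚ V :=
  (r : ℚ) • B

instance {V : Type*} [AddCommGroup V] [Module ℚ V] (r : ℕ) [NeZero r]
    (B : LinearMap.BilinForm ℚ V) (L : Submodule ℤ V) [h : IsEvenLattice B L] :
    IsEvenLattice (rescale r B) L where
  lattice := h.lattice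
  symm := ⟨fun x y => by simpa [rescale] using Or.inl (h.symm.eq x y)⟩
  nondegenerate := by
    have hr : (r : ℚ) ≠ 0 := NeZero.ne _
    refine ⟨fun x hx => h.nondegenerate.1 x fun y => ?_,
      fun y hy => h.nondegenerate.2 y fun x => ?_⟩
    · simpa [rescale, hr] using hx y
    · simpa [rescale, hr] using hy x
  integral x hx y hy := by
    obtain ⟨m, hm⟩ := h.integral x hx y hy
    exact ⟨r * m, by simp [rescale, hm]⟩
  even x hx := by
    obtain ⟨m, hm⟩ := h.even x hx
    exact ⟨r * m, by simp [rescale, hm]; ring⟩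

/-- The discriminant group `A = L'/L` as a subgroup of `V/L = (L ⊗ ℚ)/L`, where
`L' = {x ∈ L ⊗ ℚ | (x, y) ∈ ℤ for all y ∈ L}` is the dual lattice. The discriminant group `A(r)` of
`L(r)` is `disc (rescale r B) L`; all the groups `A(r)` lie in the same `V/L`, so that inclusions
such as `A ⊆ A(r)` are inclusions of subgroups of `V/L`. -/
def disc {V : Type*} [AddCommGroup V] [Module ℚ V]
    (B : LinearMap.BilinForm ℚ V) (L : Submodule ℤ V) : Submodule ℤ (V ⧸ L) :=
  (B.dualSubmodule L).map L.mkQ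

/-- The discriminant group of an even lattice is finite. -/
instance {V : Type*} [AddCommGroup V] [Module ℚ V]
    (B : LinearMap.BilinForm ℚ V) (L : Submodule ℤ V) [h : IsEvenLattice B L] :
    Finite (disc B L) := by
  have := h.lattice
  have : Module.Finite ℤ L := Submodule.IsLattice.finite ℚ L
  have : Module.Free ℤ L := Submodule.IsLattice.free ℚ L
  have hinj := B.dualSubmoduleToDual_injective h.nondegenerate L h.lattice.span_eq_top
  have : Module.Finite ℤ (B.dualSubmodule L) := Module.Finite.of_injective _ hinj
  have : Module.Finite ℤ (disc B L) :=
    Module.Finite.iff_fg.2 ((Module.Finite.iff_fg.1 this).map _)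
  refine Module.finite_of_fg_torsion _ ?_
  rintro ⟨γ, hγ⟩
  obtain ⟨x, rfl⟩ := L.mkQ_surjective γ
  have key : ∀ x : V, ∃ N : ℤ, N ≠ 0 ∧ N • x ∈ L := by
    intro x
    have hx : x ∈ Submodule.span ℚ (L : Set V) := by rw [h.lattice.span_eq_top]; trivial
    induction hx using Submodule.span_induction with
    | mem y hy => exact ⟨1, one_ne_zero, by simpa using hy⟩
    | zero => exact ⟨1, one_ne_zero, by simp⟩
    | add y z _ _ hy hz =>
      obtain ⟨N, hN, h1⟩ := hy
      obtain ⟨M, hM, h2⟩ := hz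
      refine ⟨N * M, mul_ne_zero hN hM, ?_⟩
      rw [smul_add]
      refine L.add_mem ?_ ?_
      · rw [mul_comm, mul_smul]; exact L.smul_mem _ h1
      · rw [mul_smul]; exact L.smul_mem _ h2
    | smul a y _ hy =>
      obtain ⟨N, hN, h1⟩ := hy
      refine ⟨a.den * N, mul_ne_zero (by simp) hN, ?_⟩
      have : ((a.den : ℤ) * N) • a • y = a.num • N • y := by
        rw [← Int.cast_smul_eq_zsmul ℚ, ← Int.cast_smul_eq_zsmul ℚ a.num,
          ← Int.cast_smul_eq_zsmul ℚ N, smul_smul, smul_smul]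
        congr 1
        push_cast
        rw [mul_right_comm, Rat.den_mul_eq_num]
      rw [this]
      exact L.smul_mem _ h1
  obtain ⟨N, hN, hx⟩ := key x
  refine ⟨⟨N, mem_nonZeroDivisors_of_ne_zero hN⟩, Subtype.ext ?_⟩
  exact (Submodule.Quotient.mk_eq_zero L).2 hx

noncomputable instance {V : Type*} [AddCommGroup V] [Module ℚ V]
    (B : LinearMap.BilinForm ℚ V) (L : Submodule ℤ V) [IsEvenLattice B L] :
    Fintype (disc B L) :=
  Fintype.ofFinite _

/-- `(γ, δ)`, computed on representatives of `γ, δ ∈ V/L`. For `γ, δ ∈ A = L'/L` its class modulo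
`ℤ` does not depend on the representatives. -/
noncomputable def bilinRep {V : Type*} [AddCommGroup V] [Module ℚ V]
    (B : LinearMap.BilinForm ℚ V) (L : Submodule ℤ V) (γ δ : V ⧸ L) : ℚ :=
  B (Quotient.out γ) (Quotient.out δ)

/-- `q(γ) = (γ, γ) / 2`, computed on a representative of `γ ∈ V/L`. For `γ ∈ A = L'/L` its class
modulo `ℤ` does not depend on the representative. -/
noncomputable def quadRep {V : Type*} [AddCommGroup V] [Module ℚ V]
    (B : LinearMap.BilinForm ℚ V) (L : Submodule ℤ V) (γ : V ⧸ L) : ℚ :=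
  B (Quotient.out γ) (Quotient.out γ) / 2

theorem mem_dual_of_mk {V : Type*} [AddCommGroup V] [Module ℚ V]
    (B : LinearMap.BilinForm ℚ V) (L : Submodule ℤ V) [h : IsEvenLattice B L] (x : V)
    (hx : L.mkQ x ∈ disc B L) (y : V) (hy : y ∈ L) : ∃ m : ℤ, B x y = m := by
  obtain ⟨z, hz, hzx⟩ := hx
  have hzx' : z - x ∈ L := (Submodule.Quotient.eq L).1 hzx
  obtain ⟨a, ha⟩ := Submodule.mem_one.1 (hz y hy)
  obtain ⟨b, hb⟩ := h.integral _ hzx' y hy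
  refine ⟨a - b, ?_⟩
  simp only [map_sub, LinearMap.sub_apply] at hb
  have ha' : (a : ℚ) = B z y := by simpa using ha
  push_cast
  linarith

theorem out_sub_mem {V : Type*} [AddCommGroup V] (L : Submodule ℤ V) (x : V) :
    Quotient.out (L.mkQ x) - x ∈ L := by
  refine (Submodule.Quotient.eq L).1 ?_
  exact Quotient.out_eq (L.mkQ x)

theorem bilinRep_mk {V : Type*} [AddCommGroup V] [Module ℚ V]
    (B : LinearMap.BilinForm ℚ V) (L : Submodule ℤ V) [h : IsEvenLattice B L] (x y : V)
    (hx : L.mkQ x ∈ disc B L) (hy : L.mkQ y ∈ disc B L) :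
    ∃ m : ℤ, bilinRep B L (L.mkQ x) (L.mkQ y) = B x y + m := by
  obtain ⟨a, ha⟩ := mem_dual_of_mk B L x hx _ (out_sub_mem L y)
  obtain ⟨b, hb⟩ := mem_dual_of_mk B L y hy _ (out_sub_mem L x)
  obtain ⟨c, hc⟩ := h.integral _ (out_sub_mem L x) _ (out_sub_mem L y)
  refine ⟨a + b + c, ?_⟩
  have hs : B y (Quotient.out (L.mkQ x)) = B (Quotient.out (L.mkQ x)) y := h.symm.eq _ _
  have hs' : B y x = B x y := h.symm.eq _ _
  simp only [map_sub, LinearMap.sub_apply] at ha hb hc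
  unfold bilinRep
  push_cast
  linarith

theorem quadRep_mk {V : Type*} [AddCommGroup V] [Module ℚ V]
    (B : LinearMap.BilinForm ℚ V) (L : Submodule ℤ V) [h : IsEvenLattice B L] (x : V)
    (hx : L.mkQ x ∈ disc B L) :
    ∃ m : ℤ, quadRep B L (L.mkQ x) = B x x / 2 + m := by
  obtain ⟨a, ha⟩ := mem_dual_of_mk B L x hx _ (out_sub_mem L x)
  obtain ⟨c, hc⟩ := h.even _ (out_sub_mem L x)
  refine ⟨a + c, ?_⟩
  have hs : B x (Quotient.out (L.mkQ x)) = B (Quotient.out (L.mkQ x)) x := h.symm.eq _ _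
  simp only [map_sub, LinearMap.sub_apply] at ha hc
  unfold quadRep
  push_cast
  linarith

/-- `e(x) = exp(2πix)`. -/
noncomputable def expTwoPiI (x : ℚ) : ℂ :=
  Complex.exp (2 * Real.pi * Complex.I * (x : ℂ))

theorem expTwoPiI_add_int (x : ℚ) (m : ℤ) : expTwoPiI (x + m) = expTwoPiI x := by
  unfold expTwoPiI
  rw [← Complex.exp_periodic.int_mul m (2 * Real.pi * Complex.I * (x : ℂ))]
  congr 1
  push_cast
  ring

/-! ### The Weil representation

Vectors `∑ ψ_γ e_γ` of `ℂ[A]` are functions `γ ↦ ψ_γ` on the finite group `A = disc B L`, and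
endomorphisms of `ℂ[A]` are matrices in the basis `(e_γ)`. -/

/-- `b⁺`. -/
noncomputable def bPlus {V : Type*} [AddCommGroup V] [Module ℚ V]
    (B : LinearMap.BilinForm ℚ V) : ℕ :=
  sigPos (LinearMap.BilinMap.toQuadraticMap B)

/-- `b⁻`. -/
noncomputable def bMinus {V : Type*} [AddCommGroup V] [Module ℚ V]
    (B : LinearMap.BilinForm ℚ V) : ℕ :=
  sigNeg (LinearMap.BilinMap.toQuadraticMap B)

open scoped Classical in
/-- The matrix of `ρ_L(T)`: `ρ_L(T) e_γ = e(q(γ)) e_γ`. -/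
noncomputable def weilT {V : Type*} [AddCommGroup V] [Module ℚ V]
    (B : LinearMap.BilinForm ℚ V) (L : Submodule ℤ V) : Matrix (disc B L) (disc B L) ℂ :=
  Matrix.diagonal fun γ => expTwoPiI (quadRep B L γ)

/-- The matrix of `ρ_L(S)`: `ρ_L(S) e_γ = e(-sgn(L)/8) / √|A| ∑_μ e(-(γ, μ)) e_μ`. -/
noncomputable def weilS {V : Type*} [AddCommGroup V] [Module ℚ V]
    (B : LinearMap.BilinForm ℚ V) (L : Submodule ℤ V) : Matrix (disc B L) (disc B L) ℂ :=
  Matrix.of fun μ γ =>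
    expTwoPiI (-((bPlus B : ℚ) - (bMinus B : ℚ)) / 8) / (Real.sqrt (Nat.card (disc B L)) : ℂ) *
      expTwoPiI (-bilinRep B L γ μ)

open scoped Classical in
/-- The Weil representation `ρ_L` of `Mp₂(ℤ)` on `ℂ[A]`, as its graph
`{(g, ρ_L(g))} ⊆ Mp₂(ℤ) × End(ℂ[A])`: since `S` and `T` generate `Mp₂(ℤ)`, also as a monoid,
this is the submonoid generated by `(T, ρ_L(T))` and `(S, ρ_L(S))`; see `exists_mem_weilGraph`
and `mem_weilGraph_iff`. -/
noncomputable def weilGraph {V : Type*} [AddCommGroup V] [Module ℚ V]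
    (B : LinearMap.BilinForm ℚ V) (L : Submodule ℤ V) [IsEvenLattice B L] :
    Submonoid (Mp2Z × Matrix (disc B L) (disc B L) ℂ) :=
  Submonoid.closure {(Mp2Z.T, weilT B L), (Mp2Z.S, weilS B L)}

open scoped Classical in
/-- Every `g ∈ Mp₂(ℤ)` occurs in the graph. -/
theorem exists_mem_weilGraph {V : Type*} [AddCommGroup V] [Module ℚ V]
    (B : LinearMap.BilinForm ℚ V) (L : Submodule ℤ V) [IsEvenLattice B L] (g : Mp2Z) :
    ∃ R, (g, R) ∈ weilGraph B L := by
  have h : (weilGraph B L).map (MonoidHom.fst _ _) = ⊤ := by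
    rw [weilGraph, MonoidHom.map_mclosure, Set.image_pair]
    exact Mp2Z.mclosure_eq_top
  obtain ⟨⟨g', R⟩, hR, rfl⟩ := (h ▸ Submonoid.mem_top g :
    g ∈ (weilGraph B L).map (MonoidHom.fst _ _))
  exact ⟨R, hR⟩

open scoped Classical in
/-- For the homomorphism `ρ` with the prescribed values at `T` and `S`, the graph is
`{(g, ρ(g))}`. -/
theorem mem_weilGraph_iff {V : Type*} [AddCommGroup V] [Module ℚ V]
    (B : LinearMap.BilinForm ℚ V) (L : Submodule ℤ V) [IsEvenLattice B L]
    (ρ : Mp2Z →* Matrix (disc B L) (disc B L) ℂ)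
    (hT : ρ Mp2Z.T = weilT B L) (hS : ρ Mp2Z.S = weilS B L)
    (g : Mp2Z) (R : Matrix (disc B L) (disc B L) ℂ) :
    (g, R) ∈ weilGraph B L ↔ R = ρ g := by
  have key : ∀ p ∈ weilGraph B L, p.2 = ρ p.1 := by
    intro p hp
    induction hp using Submonoid.closure_induction with
    | mem p hp => rcases hp with rfl | rfl <;> simp [hT, hS]
    | one => simp
    | mul p q _ _ h1 h2 => simp [h1, h2]
  refine ⟨fun h => key _ h, ?_⟩
  rintro rfl
  obtain ⟨R, hR⟩ := exists_mem_weilGraph B L g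
  have := key _ hR
  simp only at this
  rwa [← this]

/-! ### Vector-valued modular forms -/

/-- `ψ : ℍ → ℂ[A]` is real analytic and vector-valued modular of type `ρ_L` and weight
`(κ / 2, κ' / 2)`:
`ψ(Mτ) = φ(τ)^κ · conj(φ(τ))^κ' · ρ_L(M, φ) ψ(τ)` for all `(M, φ) ∈ Mp₂(ℤ)`. -/
structure IsVVModular {V : Type*} [AddCommGroup V] [Module ℚ V]
    (B : LinearMap.BilinForm ℚ V) (L : Submodule ℤ V) [IsEvenLattice B L]
    (κ κ' : ℤ) (ψ : ℍ → (disc B L → ℂ)) : Prop where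
  analytic : ∀ γ, AnalyticOnNhd ℝ (fun z : ℂ => ψ (ofComplex z) γ) {z : ℂ | 0 < z.im}
  transform : ∀ (g : Mp2Z) (R : Matrix (disc B L) (disc B L) ℂ), (g, R) ∈ weilGraph B L →
    ∀ τ : ℍ, ψ (g.mat • τ) = (g.phi τ ^ κ * conj (g.phi τ) ^ κ') • R.mulVec (ψ τ)

/-! ### Hecke operators -/

open scoped Classical in
/-- `Δ_r(μ, k)` for `k ∣ r`: it is `1` if `μ ∈ A(l)`, where `k l = r`, and `0` otherwise. -/
noncomputable def delta {V : Type*} [AddCommGroup V] [Module ℚ V]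
    (B : LinearMap.BilinForm ℚ V) (L : Submodule ℤ V) (r : ℕ) (μ : V ⧸ L) (k : ℕ) : ℂ :=
  if μ ∈ disc (rescale (r / k) B) L then 1 else 0

/-- If `k l = r` and `μ ∈ A(l)`, then `e(-(s/k) q_r(μ))` does not depend on the representative by
which `q_r(μ)` is computed. -/
theorem phase_mk {V : Type*} [AddCommGroup V] [Module ℚ V]
    (B : LinearMap.BilinForm ℚ V) (L : Submodule ℤ V) [IsEvenLattice B L] (r k l s : ℕ)
    (hr : r ≠ 0) (hkl : k * l = r) (x : V) (hx : L.mkQ x ∈ disc (rescale l B) L) :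
    expTwoPiI (-((s : ℚ) / k) * quadRep (rescale r B) L (L.mkQ x)) =
      expTwoPiI (-((s : ℚ) / k) * (rescale r B x x / 2)) := by
  subst hkl
  have hk : k ≠ 0 := left_ne_zero_of_mul hr
  have hl : NeZero l := ⟨right_ne_zero_of_mul hr⟩
  obtain ⟨m, hm⟩ := quadRep_mk (rescale l B) L x hx
  have h1 : quadRep (rescale (k * l) B) L (L.mkQ x) = k * quadRep (rescale l B) L (L.mkQ x) := by
    simp [quadRep, rescale]; ring
  have h2 : -((s : ℚ) / k) * quadRep (rescale (k * l) B) L (L.mkQ x) =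
      -((s : ℚ) / k) * (rescale (k * l) B x x / 2) + ((-(s * m) : ℤ) : ℚ) := by
    rw [h1, hm]
    simp only [rescale, LinearMap.smul_apply, smul_eq_mul]
    push_cast
    field_simp
    ring
  rw [h2]
  exact expTwoPiI_add_int _ _

open scoped Classical in
/-- The component `ψ_γ` of a vector of `ℂ[A]`, for `γ ∈ V/L`; it is `0` if `γ ∉ A`. -/
noncomputable def component {V : Type*} [AddCommGroup V] [Module ℚ V]
    {B : LinearMap.BilinForm ℚ V} {L : Submodule ℤ V} (ψ : disc B L → ℂ) (γ : V ⧸ L) : ℂ :=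
  if h : γ ∈ disc B L then ψ ⟨γ, h⟩ else 0

/-- The point `(k τ + s) / l` of the upper half-plane, for `k, l > 0`. -/
noncomputable def heckePoint (k l s : ℕ) (τ : ℍ) : ℍ :=
  ofComplex (((k : ℂ) * (τ : ℂ) + (s : ℂ)) / (l : ℂ))

/-- The operator `𝒯_r` from `ℂ[A]`-valued to `ℂ[A(r)]`-valued functions: with
`(w, w') = (v + b⁺/2, v' + b⁻/2)`, the component of `𝒯_r[ψ](τ)` at `μ ∈ A(r)` is
`r^(w+w'-1) ∑_{kl=r} l^(-w-w') ∑_{0≤s<l} Δ_r(μ,k) e(-(s/k) q_r(μ)) ψ_{lμ}((kτ+s)/l)`. -/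
noncomputable def heckeT {V : Type*} [AddCommGroup V] [Module ℚ V]
    (B : LinearMap.BilinForm ℚ V) (L : Submodule ℤ V) (v v' : ℝ) (r : ℕ)
    (ψ : ℍ → (disc B L → ℂ)) : ℍ → (disc (rescale r B) L → ℂ) := fun τ μ =>
  let w : ℝ := v + (bPlus B : ℝ) / 2
  let w' : ℝ := v' + (bMinus B : ℝ) / 2
  (((r : ℝ) ^ (w + w' - 1) : ℝ) : ℂ) *
    ∑ p ∈ r.divisorsAntidiagonal,
      ((1 / (p.2 : ℝ) ^ (w + w') : ℝ) : ℂ) *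
        ∑ s ∈ Finset.range p.2,
          delta B L r μ p.1 *
            expTwoPiI (-((s : ℚ) / (p.1 : ℚ)) * quadRep (rescale r B) L μ) *
              component (ψ (heckePoint p.1 p.2 s τ)) (p.2 • (μ : V ⧸ L))

open scoped Classical in
/-- The projection operator `𝒫_{n²}` from `ℂ[A(n²)]`-valued to `ℂ[A]`-valued functions:
the component of `𝒫_{n²}[ψ](τ)` at `lam ∈ A` is
`n^(-dim L) ∑_{γ ∈ A(n²), nγ = lam} Δ_{n²}(γ,n) ψ_γ(τ)`. -/
noncomputable def heckeP {V : Type*} [AddCommGroup V] [Module ℚ V]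
    (B : LinearMap.BilinForm ℚ V) (L : Submodule ℤ V) [IsEvenLattice B L] (n : ℕ) [NeZero n]
    (ψ : ℍ → (disc (rescale (n ^ 2) B) L → ℂ)) : ℍ → (disc B L → ℂ) := fun τ lam =>
  1 / (n : ℂ) ^ Module.finrank ℚ V *
    ∑ γ ∈ Finset.univ.filter
        (fun γ : disc (rescale (n ^ 2) B) L => n • (γ : V ⧸ L) = (lam : V ⧸ L)),
      delta B L (n ^ 2) γ n * ψ τ γ

/-- The Hecke operator `ℋ_{n²} = 𝒫_{n²} ∘ 𝒯_{n²}` (on functions of weight `(v, v')`). -/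
noncomputable def heckeH {V : Type*} [AddCommGroup V] [Module ℚ V]
    (B : LinearMap.BilinForm ℚ V) (L : Submodule ℤ V) [IsEvenLattice B L] (v v' : ℝ)
    (n : ℕ) [NeZero n] (ψ : ℍ → (disc B L → ℂ)) : ℍ → (disc B L → ℂ) :=
  heckeP B L n (heckeT B L v v' (n ^ 2) ψ)

/-! ### The additive character `e(x)` -/

/-! Regard ψ as a function on V that is L-invariant and zero off L' (`extension`). The classes γ
with nγ = x + L are those of (x + t)/n with t in L/nL. For them Δ(γ, n) = 1, and the factor n^(-dim)
turns the sum over γ into a mean. Up to a power of n, the component of ℋ at x is therefore the sum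
over kl = n² and s mod l of l^(-W) times the mean over t of e(-(s/k) q(x+t))
ψ_{(l/n)(x+t)}((kz+s)/l), with W = v + v' + dim/2. This is `heckeTerm`, and the reduction is
`heckeH_apply`. The factor Δ(γ, k) disappears because it is 0 only where the component of ψ is 0
anyway.

It suffices to treat T and S (`isVVModular_of_generators`). Under z ↦ z + 1 the index s becomes s +
k at the cost of e(q(x)), and the terms have period l in s.

For S, put d = gcd(s, l), l = dc, s = da, and choose m with am ≡ -1 mod c. The point (k(-1/z) +
da)/(dc) is the image of w = (dz + km)/(ck) under an integral matrix with first column (a, c) and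
last row (c, -m). The modularity of ψ under this matrix carries the term (k, dc, da) at -1/z to the
term (d, ck, km) at z, with exactly the kernel of ρ_L(S) (`IsVVModular.heckeTerm_neg_inv`). The map
(k, dc, da) ↦ (d, ck, km) is an involution of the index set, so the whole sum transforms correctly.

This requires the action of every matrix with c > 0 in closed form (`weilKernel`,
`IsVVModular.extension_moebius`). The formula is proved by the Euclidean algorithm on the last row.
Composing a kernel with S amounts to completing a square (`dualMean_mul_weilKernel`), which leaves a
Gauss sum over L'/cc₁L. Its value is Milgram's formula for a rescaled lattice (`discGaussSum_eq`,
`dualMean_quad_div`). Milgram's formula is reduced to an orthogonal sublattice and then to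
one-variable Gauss sums, which are evaluated by Poisson summation and the theta transformation. That
ρ_L is a well-defined homomorphism is never needed.

Since e(q/c) does not descend to L'/L, sums over quotients are taken over representatives in V
(`IsTransversal`) of functions with a stated period (`PeriodicOn`).

The explicit formula follows from the definitions by comparing exponents, with b⁺ + b⁻ = dim L. -/

theorem expTwoPiI_add (x y : ℚ) : expTwoPiI (x + y) = expTwoPiI x * expTwoPiI y := by
  unfold expTwoPiI
  rw [← Complex.exp_add]
  congr 1
  push_cast
  ring

@[simp] theorem expTwoPiI_zero : expTwoPiI 0 = 1 := by simp [expTwoPiI]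

theorem expTwoPiI_int (m : ℤ) : expTwoPiI m = 1 := by
  simpa using expTwoPiI_add_int 0 m

theorem expTwoPiI_congr {x y : ℚ} (m : ℤ) (h : x = y + m) : expTwoPiI x = expTwoPiI y := by
  rw [h, expTwoPiI_add_int]

theorem expTwoPiI_eq_one_iff (x : ℚ) : expTwoPiI x = 1 ↔ ∃ m : ℤ, x = m := by
  constructor
  · intro h
    obtain ⟨m, hm⟩ := Complex.exp_eq_one_iff.1 h
    refine ⟨m, ?_⟩
    have h2 : (2 * Real.pi * Complex.I : ℂ) ≠ 0 := Complex.two_pi_I_ne_zero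
    have h3 : (x : ℂ) = m := mul_left_cancel₀ h2 (by rw [hm]; ring)
    exact_mod_cast h3
  · rintro ⟨m, rfl⟩
    exact expTwoPiI_int m

@[simp] theorem norm_expTwoPiI (x : ℚ) : ‖expTwoPiI x‖ = 1 := by
  unfold expTwoPiI
  rw [show (2 * Real.pi * Complex.I * (x : ℂ)) = ((2 * Real.pi * x : ℝ) : ℂ) * Complex.I by
    push_cast; ring, Complex.norm_exp_ofReal_mul_I]

theorem expTwoPiI_ne_zero (x : ℚ) : expTwoPiI x ≠ 0 := Complex.exp_ne_zero _

theorem expTwoPiI_neg (x : ℚ) : expTwoPiI (-x) = (expTwoPiI x)⁻¹ := by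
  refine eq_inv_of_mul_eq_one_left ?_
  rw [← expTwoPiI_add, neg_add_cancel, expTwoPiI_zero]

theorem conj_expTwoPiI (x : ℚ) : conj (expTwoPiI x) = expTwoPiI (-x) := by
  rw [expTwoPiI_neg, Complex.inv_eq_conj (norm_expTwoPiI x)]

/-! ### Transversals -/

/-- The family `g` represents each class of `H` modulo `N` exactly once. -/
structure IsTransversal {V ι : Type*} [AddCommGroup V] (H N : Submodule ℤ V) (g : ι → V) :
    Prop where
  mem : ∀ i, g i ∈ H
  existsUnique : ∀ h ∈ H, ∃! i, h - g i ∈ N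

/-- `f` is invariant on `H` under translations by `N`. -/
def PeriodicOn {V : Type*} [AddCommGroup V] (H N : Submodule ℤ V) (f : V → ℂ) : Prop :=
  ∀ x ∈ H, ∀ y ∈ N, f (x + y) = f x

section

variable {V ι κ : Type*} [AddCommGroup V] {H K N : Submodule ℤ V} {g : ι → V} {g' : κ → V}

theorem PeriodicOn.eq_of_sub_mem {f : V → ℂ} (hf : PeriodicOn H N f) {x y : V} (hx : x ∈ H)
    (h : y - x ∈ N) : f y = f x := by
  rw [← hf x hx _ h, add_sub_cancel]

theorem PeriodicOn.mono {f : V → ℂ} (hf : PeriodicOn H N f) {H' N' : Submodule ℤ V}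
    (hH : H' ≤ H) (hN : N' ≤ N) : PeriodicOn H' N' f :=
  fun x hx y hy => hf x (hH hx) y (hN hy)

namespace IsTransversal

theorem exists_equiv (hg : IsTransversal H N g) (hg' : IsTransversal H N g') :
    ∃ σ : ι ≃ κ, ∀ i, g i - g' (σ i) ∈ N := by
  choose φ hφ hφu using fun i => hg'.existsUnique (g i) (hg.mem i)
  choose χ hχ hχu using fun j => hg.existsUnique (g' j) (hg'.mem j)
  refine ⟨⟨φ, χ, fun i => ?_, fun j => ?_⟩, hφ⟩
  · refine (hχu _ i ?_).symm
    have := N.neg_mem (hφ i)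
    simpa using this
  · refine (hφu _ j ?_).symm
    have := N.neg_mem (hχ j)
    simpa using this

theorem sum_eq [Fintype ι] [Fintype κ] (hg : IsTransversal H N g) (hg' : IsTransversal H N g')
    {f : V → ℂ} (hf : PeriodicOn H N f) : ∑ i, f (g i) = ∑ j, f (g' j) := by
  obtain ⟨σ, hσ⟩ := hg.exists_equiv hg'
  rw [← σ.sum_comp]
  exact Finset.sum_congr rfl fun i _ => hf.eq_of_sub_mem (hg'.mem _) (hσ i)

theorem card_eq [Fintype ι] [Fintype κ] (hg : IsTransversal H N g) (hg' : IsTransversal H N g') :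
    Fintype.card ι = Fintype.card κ :=
  Fintype.card_congr (hg.exists_equiv hg').choose

theorem add_right (hg : IsTransversal H N g) {h : V} (hh : h ∈ H) :
    IsTransversal H N fun i => g i + h where
  mem i := H.add_mem (hg.mem i) hh
  existsUnique x hx := by
    obtain ⟨i, hi, hu⟩ := hg.existsUnique (x - h) (H.sub_mem hx hh)
    refine ⟨i, ?_, fun j hj => hu j ?_⟩
    · simpa [sub_sub, add_comm] using hi
    · simpa [sub_sub, add_comm] using hj

theorem sum_add_right [Fintype ι] (hg : IsTransversal H N g) {f : V → ℂ} (hf : PeriodicOn H N f)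
    {h : V} (hh : h ∈ H) : ∑ i, f (g i + h) = ∑ i, f (g i) :=
  (hg.add_right hh).sum_eq hg hf

theorem prod (hg : IsTransversal H K g) (hg' : IsTransversal K N g') (hKH : K ≤ H) (hNK : N ≤ K) :
    IsTransversal H N fun p : ι × κ => g p.1 + g' p.2 where
  mem p := H.add_mem (hg.mem _) (hKH (hg'.mem _))
  existsUnique x hx := by
    obtain ⟨i, hi, hiu⟩ := hg.existsUnique x hx
    obtain ⟨j, hj, hju⟩ := hg'.existsUnique _ hi
    refine ⟨(i, j), by simpa [sub_sub] using hj, ?_⟩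
    rintro ⟨i', j'⟩ h
    have h1 : x - g i' - g' j' ∈ N := by simpa [sub_sub] using h
    have h2 : i' = i := hiu i' (by simpa using K.add_mem (hNK h1) (hg'.mem j'))
    subst h2
    rw [hju j' h1]

theorem sum_prod [Fintype ι] [Fintype κ] {μ : Type*} [Fintype μ] {g'' : μ → V}
    (hg'' : IsTransversal H N g'')
    (hg : IsTransversal H K g) (hg' : IsTransversal K N g') (hKH : K ≤ H) (hNK : N ≤ K)
    {f : V → ℂ} (hf : PeriodicOn H N f) : ∑ i, f (g'' i) = ∑ i, ∑ j, f (g i + g' j) := by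
  rw [hg''.sum_eq (hg.prod hg' hKH hNK) hf, Fintype.sum_prod_type]

theorem subtype (hg : IsTransversal H N g) (hKH : K ≤ H) (hNK : N ≤ K) :
    IsTransversal K N fun i : {i // g i ∈ K} => g i where
  mem i := i.2
  existsUnique x hx := by
    obtain ⟨i, hi, hiu⟩ := hg.existsUnique x (hKH hx)
    have hiK : g i ∈ K := by simpa using K.sub_mem hx (hNK hi)
    exact ⟨⟨i, hiK⟩, hi, fun j hj => Subtype.ext (hiu j hj)⟩

theorem map (hg : IsTransversal H N g) (f : V →ₗ[ℤ] V) (hf : Function.Injective f) :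
    IsTransversal (H.map f) (N.map f) fun i => f (g i) where
  mem i := ⟨_, hg.mem i, rfl⟩
  existsUnique x hx := by
    obtain ⟨y, hy, rfl⟩ := hx
    obtain ⟨i, hi, hiu⟩ := hg.existsUnique y hy
    refine ⟨i, ⟨_, hi, by simp⟩, fun j hj => hiu j ?_⟩
    obtain ⟨z, hz, hzj⟩ := hj
    have : z = y - g j := hf (by simpa using hzj)
    exact this ▸ hz

/-- Orthogonality of characters. -/
theorem sum_char [Fintype ι] (hg : IsTransversal H N g) {χ : V → ℂ}
    (hadd : ∀ x y, χ (x + y) = χ x * χ y) (hχ : ∀ y ∈ N, χ y = 1) [Decidable (∀ x ∈ H, χ x = 1)] :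
    ∑ i, χ (g i) = if ∀ x ∈ H, χ x = 1 then (Fintype.card ι : ℂ) else 0 := by
  split_ifs with h
  · rw [Finset.sum_congr rfl fun i _ => h _ (hg.mem i)]
    simp
  · push Not at h
    obtain ⟨x, hx, hx1⟩ := h
    have hp : PeriodicOn H N χ := fun a _ b hb => by rw [hadd, hχ b hb, mul_one]
    have h2 := hg.sum_add_right hp hx
    simp only [hadd, ← Finset.sum_mul] at h2
    have h3 : (∑ i, χ (g i)) * (χ x - 1) = 0 := by rw [mul_sub, h2]; ring
    exact (mul_eq_zero.1 h3).resolve_right (sub_ne_zero.2 hx1)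

end IsTransversal

end

/-! ### Rescaled lattices -/

section

variable {V : Type*} [AddCommGroup V] [Module ℚ V]

/-- The lattice `c L`. -/
def scale (c : ℚ) (L : Submodule ℤ V) : Submodule ℤ V :=
  L.map ((LinearMap.lsmul ℚ V c).restrictScalars ℤ)

theorem mem_scale {c : ℚ} {L : Submodule ℤ V} {x : V} : x ∈ scale c L ↔ ∃ y ∈ L, c • y = x :=
  Iff.rfl

theorem smul_mem_scale {c : ℚ} {L : Submodule ℤ V} {x : V} (hx : x ∈ L) : c • x ∈ scale c L :=
  ⟨x, hx, rfl⟩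

theorem natCast_smul_mem (L : Submodule ℤ V) (m : ℕ) {x : V} (hx : x ∈ L) : (m : ℚ) • x ∈ L := by
  rw [Nat.cast_smul_eq_nsmul]; exact L.toAddSubgroup.nsmul_mem hx m

theorem intCast_smul_mem (L : Submodule ℤ V) (m : ℤ) {x : V} (hx : x ∈ L) : (m : ℚ) • x ∈ L := by
  rw [Int.cast_smul_eq_zsmul]; exact L.smul_mem m hx

theorem scale_natCast_le (c : ℕ) (L : Submodule ℤ V) : scale (c : ℚ) L ≤ L := by
  rintro _ ⟨y, hy, rfl⟩
  exact natCast_smul_mem L c hy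

theorem scale_mul (c d : ℚ) (L : Submodule ℤ V) : scale (c * d) L = scale c (scale d L) := by
  ext x
  constructor
  · rintro ⟨y, hy, rfl⟩
    exact ⟨d • y, smul_mem_scale hy, (mul_smul c d y).symm⟩
  · rintro ⟨_, ⟨y, hy, rfl⟩, rfl⟩
    exact ⟨y, hy, mul_smul c d y⟩

@[simp] theorem scale_one (L : Submodule ℤ V) : scale 1 L = L := by
  ext x; simp [mem_scale]

theorem scale_mono (c : ℚ) {L M : Submodule ℤ V} (h : L ≤ M) : scale c L ≤ scale c M :=
  Submodule.map_mono h

theorem IsTransversal.scale {ι : Type*} {H N : Submodule ℤ V} {g : ι → V}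
    (hg : IsTransversal H N g) {c : ℚ} (hc : c ≠ 0) :
    IsTransversal (scale c H) (scale c N) fun i => c • g i :=
  hg.map _ fun _ _ h => smul_right_injective V hc h

/-- For `δ` prime to `c`, multiplication by `δ` permutes the classes modulo `c`. -/
theorem IsTransversal.unit_smul {ι : Type*} {L : Submodule ℤ V} {g : ι → V} {c : ℕ}
    (hg : IsTransversal L (_root_.scale (c : ℚ) L) g) {a δ : ℤ} (h : (c : ℤ) ∣ a * δ - 1) :
    IsTransversal L (_root_.scale (c : ℚ) L) fun i => (δ : ℚ) • g i := by
  obtain ⟨b, hb⟩ := h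
  have hbq : (a : ℚ) * δ = 1 + c * b := by
    have : ((a * δ - 1 : ℤ) : ℚ) = ((c * b : ℤ) : ℚ) := by rw [hb]
    push_cast at this
    linarith
  refine ⟨fun i => intCast_smul_mem L δ (hg.mem i), fun x hx => ?_⟩
  have key : ∀ i, x - (δ : ℚ) • g i ∈ _root_.scale (c : ℚ) L ↔
      (a : ℚ) • x - g i ∈ _root_.scale (c : ℚ) L := by
    intro i
    constructor
    · intro h1
      have h2 := intCast_smul_mem _ a h1
      have h3 : (a : ℚ) • x - g i = (a : ℚ) • (x - (δ : ℚ) • g i) +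
          (c : ℚ) • ((b : ℚ) • g i) := by
        rw [smul_sub, smul_smul, smul_smul, hbq, add_smul, one_smul]; abel
      rw [h3]
      exact Submodule.add_mem _ h2 (smul_mem_scale (intCast_smul_mem L b (hg.mem i)))
    · intro h1
      have h2 := intCast_smul_mem _ δ h1
      have h3 : x - (δ : ℚ) • g i = (δ : ℚ) • ((a : ℚ) • x - g i) -
          (c : ℚ) • ((b : ℚ) • x) := by
        rw [smul_sub, smul_smul, smul_smul, mul_comm (δ : ℚ), hbq, add_smul, one_smul]; abel
      rw [h3]
      exact Submodule.sub_mem _ h2 (smul_mem_scale (intCast_smul_mem L b hx))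
  simp only [key]
  exact hg.existsUnique _ (intCast_smul_mem L a hx)

/-- Representatives of `L / c L` in coordinates. -/
noncomputable def box {V : Type*} [AddCommGroup V] {ι : Type*} [Fintype ι]
    {L : Submodule ℤ V} (b : Module.Basis ι ℤ L) (c : ℕ) (x : ι → Fin c) : V :=
  ((∑ i, (x i : ℤ) • b i : L) : V)

theorem isTransversal_box {ι : Type*} [Fintype ι] {L : Submodule ℤ V} (b : Module.Basis ι ℤ L)
    (c : ℕ) [NeZero c] : IsTransversal L (_root_.scale (c : ℚ) L) (box b c) where
  mem x := Subtype.prop _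
  existsUnique h hh := by
    have hc : (0 : ℤ) < c := by exact_mod_cast Nat.pos_of_ne_zero (NeZero.ne c)
    have key : ∀ x : ι → Fin c, h - box b c x ∈ _root_.scale (c : ℚ) L ↔
        ∀ i, (c : ℤ) ∣ b.repr ⟨h, hh⟩ i - x i := by
      intro x
      have hrepr : ∀ i, b.repr (⟨h, hh⟩ - ∑ i, (x i : ℤ) • b i) i = b.repr ⟨h, hh⟩ i - x i := by
        intro i
        rw [map_sub, Finsupp.sub_apply, b.repr_sum_self]
      constructor
      · rintro ⟨y, hy, hxy⟩ i
        have h1 : (c : ℤ) • (⟨y, hy⟩ : L) = ⟨h, hh⟩ - ∑ i, (x i : ℤ) • b i := by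
          refine Subtype.ext ?_
          have h2 : (c : ℚ) • y = h - box b c x := hxy
          rw [Nat.cast_smul_eq_nsmul] at h2
          simpa [box] using h2
        refine ⟨b.repr ⟨y, hy⟩ i, ?_⟩
        rw [← hrepr, ← h1, map_smul, Finsupp.smul_apply, smul_eq_mul]
      · intro hd
        choose z hz using hd
        refine ⟨((∑ i, z i • b i : L) : V), Subtype.prop _, ?_⟩
        have h1 : (c : ℤ) • (∑ i, z i • b i : L) = ⟨h, hh⟩ - ∑ i, (x i : ℤ) • b i := by
          refine b.repr.injective (Finsupp.ext fun i => ?_)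
          rw [hrepr, hz, map_smul, Finsupp.smul_apply, b.repr_sum_self, smul_eq_mul]
        have h2 := congrArg (Subtype.val) h1
        change (c : ℚ) • ((∑ i, z i • b i : L) : V) = h - box b c x
        rw [Nat.cast_smul_eq_nsmul]
        simpa [box] using h2
    simp only [key]
    refine ⟨fun i => ⟨(b.repr ⟨h, hh⟩ i % c).toNat, ?_⟩, fun i => ?_, fun y hy => ?_⟩
    · have := Int.emod_lt_of_pos (b.repr ⟨h, hh⟩ i) hc
      have := Int.emod_nonneg (b.repr ⟨h, hh⟩ i) hc.ne'
      omega
    · have := Int.emod_nonneg (b.repr ⟨h, hh⟩ i) hc.ne'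
      simp only [Int.toNat_of_nonneg this]
      exact Int.dvd_self_sub_emod
    · funext i
      refine Fin.ext ?_
      have h3 : (b.repr ⟨h, hh⟩ i) % c = (y i : ℤ) % c :=
        Int.emod_eq_emod_iff_emod_sub_eq_zero.2 (Int.emod_eq_zero_of_dvd (hy i))
      simp only
      rw [h3, Int.emod_eq_of_lt (by positivity) (by exact_mod_cast (y i).2)]
      simp

theorem isTransversal_out (B : LinearMap.BilinForm ℚ V) (L : Submodule ℤ V)
    (h : L ≤ B.dualSubmodule L) :
    IsTransversal (B.dualSubmodule L) L fun γ : disc B L => Quotient.out (γ : V ⧸ L) where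
  mem γ := by
    obtain ⟨x, hx, hxγ⟩ := γ.2
    rw [← hxγ]
    have h1 := h (out_sub_mem L x)
    simpa using Submodule.add_mem _ h1 hx
  existsUnique x hx := by
    refine ⟨⟨L.mkQ x, x, hx, rfl⟩, ?_, fun γ hγ => Subtype.ext ?_⟩
    · have := L.neg_mem (out_sub_mem L x)
      simpa using this
    · have h1 : L.mkQ x = L.mkQ (Quotient.out (γ : V ⧸ L)) := (Submodule.Quotient.eq L).2 hγ
      simp only
      rw [h1]
      exact (Quotient.out_eq (γ : V ⧸ L)).symm

end

/-! ### Means over a lattice -/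

theorem isTransversal_box_scale {V ι : Type*} [AddCommGroup V] [Module ℚ V] [Fintype ι]
    {L : Submodule ℤ V} (b : Module.Basis ι ℤ L) (c m : ℕ) [NeZero c] [NeZero m] :
    IsTransversal (scale (c : ℚ) L) (scale ((c * m : ℕ) : ℚ) L)
      fun x => (c : ℚ) • box b m x := by
  rw [Nat.cast_mul, scale_mul]
  exact (isTransversal_box b m).scale (NeZero.ne _)

section

variable {V ι : Type*} [AddCommGroup V] [Fintype ι] [DecidableEq ι]
  {L : Submodule ℤ V} (b : Module.Basis ι ℤ L)

/-- The mean of a function on `L / c L`. -/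
noncomputable def latMean (c : ℕ) (f : V → ℂ) : ℂ :=
  ((c : ℂ) ^ Fintype.card ι)⁻¹ * ∑ x : ι → Fin c, f (box b c x)

theorem latMean_comm (c d : ℕ) (f : V → V → ℂ) :
    latMean b c (fun x => latMean b d (f x)) = latMean b d fun y => latMean b c fun x => f x y := by
  simp only [latMean, Finset.mul_sum]
  rw [Finset.sum_comm]
  refine Finset.sum_congr rfl fun y _ => Finset.sum_congr rfl fun x _ => ?_
  ring

theorem latMean_mul_left (c : ℕ) (a : ℂ) (f : V → ℂ) :
    latMean b c (fun x => a * f x) = a * latMean b c f := by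
  simp only [latMean, ← Finset.mul_sum]
  ring

theorem latMean_mul_right (c : ℕ) (a : ℂ) (f : V → ℂ) :
    latMean b c (fun x => f x * a) = latMean b c f * a := by
  simp only [latMean, ← Finset.sum_mul]
  ring

theorem latMean_sum {κ : Type*} (s : Finset κ) (c : ℕ) (f : κ → V → ℂ) :
    latMean b c (fun x => ∑ j ∈ s, f j x) = ∑ j ∈ s, latMean b c (f j) := by
  simp only [latMean, ← Finset.mul_sum]
  rw [Finset.sum_comm]

@[simp] theorem latMean_const (c : ℕ) [NeZero c] (a : ℂ) : latMean b c (fun _ => a) = a := by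
  have : (c : ℂ) ≠ 0 := NeZero.ne _
  simp [latMean]
  field_simp

variable [Module ℚ V]

theorem latMean_congr {c : ℕ} [NeZero c] {f g : V → ℂ} (h : ∀ x ∈ L, f x = g x) :
    latMean b c f = latMean b c g := by
  unfold latMean
  rw [Finset.sum_congr rfl fun x _ => h _ ((isTransversal_box b c).mem x)]

theorem latMean_add {c : ℕ} [NeZero c] {f : V → ℂ} (hf : PeriodicOn L (scale (c : ℚ) L) f)
    {t : V} (ht : t ∈ L) : latMean b c (fun x => f (x + t)) = latMean b c f := by
  rw [latMean, latMean, (isTransversal_box b c).sum_add_right hf ht]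

theorem latMean_unit_smul {c : ℕ} [NeZero c] {f : V → ℂ}
    (hf : PeriodicOn L (scale (c : ℚ) L) f) {a δ : ℤ} (h : (c : ℤ) ∣ a * δ - 1) :
    latMean b c (fun x => f ((δ : ℚ) • x)) = latMean b c f := by
  rw [latMean, latMean, (isTransversal_box b c).sum_eq ((isTransversal_box b c).unit_smul h) hf]

theorem scale_natCast_mul_le (c m : ℕ) (L : Submodule ℤ V) :
    scale ((c * m : ℕ) : ℚ) L ≤ scale (c : ℚ) L := by
  rw [Nat.cast_mul, scale_mul]
  exact scale_mono _ (scale_natCast_le m L)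

/-- The normalization makes a mean independent of the chosen period, so that sums with different
periods can be brought to a common modulus and interchanged. -/
theorem latMean_mul {c : ℕ} [NeZero c] (m : ℕ) [NeZero m] {f : V → ℂ}
    (hf : PeriodicOn L (scale (c : ℚ) L) f) : latMean b (c * m) f = latMean b c f := by
  have hm : (m : ℂ) ≠ 0 := NeZero.ne _
  rw [latMean, latMean, (isTransversal_box b (c * m)).sum_prod (isTransversal_box b c)
    (isTransversal_box_scale b c m) (scale_natCast_le c L) (scale_natCast_mul_le c m L)
    (hf.mono le_rfl (scale_natCast_mul_le c m L))]
  have : ∀ x : ι → Fin c, ∑ y : ι → Fin m, f (box b c x + (c : ℚ) • box b m y) =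
      (m : ℂ) ^ Fintype.card ι * f (box b c x) := by
    intro x
    rw [Finset.sum_congr rfl fun y _ => hf _ ((isTransversal_box b c).mem x) _
      (smul_mem_scale ((isTransversal_box b m).mem y))]
    simp
  rw [Finset.sum_congr rfl fun x _ => this x, ← Finset.mul_sum]
  push_cast
  rw [mul_pow]
  field_simp

end

/-! ### Duality and the characters of L -/

section

variable {V : Type*} [AddCommGroup V] [Module ℚ V]

theorem mem_dual_iff (B : LinearMap.BilinForm ℚ V) (L : Submodule ℤ V) (x : V) :
    x ∈ B.dualSubmodule L ↔ ∀ y ∈ L, ∃ m : ℤ, B x y = m := by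
  refine forall₂_congr fun y _ => ?_
  rw [Submodule.mem_one]
  exact ⟨fun ⟨m, hm⟩ => ⟨m, by simpa using hm.symm⟩, fun ⟨m, hm⟩ => ⟨m, by simpa using hm.symm⟩⟩

variable (B : LinearMap.BilinForm ℚ V) (L : Submodule ℤ V)

theorem le_dual [h : IsEvenLattice B L] : L ≤ B.dualSubmodule L := fun x hx =>
  (mem_dual_iff B L x).2 fun y hy => h.integral x hx y hy

theorem mem_dual_rescale_iff (m : ℕ) [NeZero m] (x : V) :
    x ∈ (rescale m B).dualSubmodule L ↔ (m : ℚ) • x ∈ B.dualSubmodule L := by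
  simp [mem_dual_iff, rescale]

theorem mk_mem_disc_iff [IsEvenLattice B L] (x : V) :
    L.mkQ x ∈ disc B L ↔ x ∈ B.dualSubmodule L := by
  constructor
  · intro h
    exact (mem_dual_iff B L x).2 (mem_dual_of_mk B L x h)
  · exact fun h => ⟨x, h, rfl⟩

open scoped Classical in
theorem IsTransversal.sum_expTwoPiI {ι : Type*} [Fintype ι] {H N : Submodule ℤ V} {g : ι → V}
    (hg : IsTransversal H N g) (z : V) (hz : ∀ y ∈ N, ∃ m : ℤ, B z y = m) :
    ∑ i, expTwoPiI (-B z (g i)) =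
      if z ∈ B.dualSubmodule H then (Fintype.card ι : ℂ) else 0 := by
  have h1 := hg.sum_char (χ := fun y => expTwoPiI (-B z y))
    (fun x y => by rw [map_add, neg_add, expTwoPiI_add])
    (fun y hy => by
      obtain ⟨m, hm⟩ := hz y hy
      rw [hm]
      exact_mod_cast expTwoPiI_int (-m))
  rw [h1]
  congr 1
  rw [mem_dual_iff]
  refine propext (forall₂_congr fun y _ => ?_)
  rw [expTwoPiI_eq_one_iff]
  exact ⟨fun ⟨m, hm⟩ => ⟨-m, by push_cast; linarith⟩, fun ⟨m, hm⟩ => ⟨-m, by push_cast; linarith⟩⟩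

-- Orthogonality of characters on L/cL. Conditions of the form z ∈ L' enter and leave the sums below
-- in this way.
open scoped Classical in
theorem latMean_char {ι : Type*} [Fintype ι] [DecidableEq ι] (b : Module.Basis ι ℤ L) (c : ℕ)
    [NeZero c] (z : V) (hz : (c : ℚ) • z ∈ B.dualSubmodule L) :
    latMean b c (fun x => expTwoPiI (-B z x)) = if z ∈ B.dualSubmodule L then 1 else 0 := by
  have hc : (c : ℂ) ≠ 0 := NeZero.ne _
  rw [latMean, (isTransversal_box b c).sum_expTwoPiI B z]
  · split_ifs
    · simp
    · simp
  · rintro _ ⟨y, hy, rfl⟩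
    obtain ⟨m, hm⟩ := (mem_dual_iff B L _).1 hz y hy
    exact ⟨m, by simpa using hm⟩

end

/-! ### The quadratic Gauss sum -/

theorem sum_range_add_of_periodic {f : ℤ → ℂ} {m : ℕ} (hf : Function.Periodic f (m : ℤ)) (n : ℤ) :
    ∑ x ∈ Finset.range m, f (x + n) = ∑ x ∈ Finset.range m, f x := by
  have step : ∀ n : ℤ, ∑ x ∈ Finset.range m, f (x + (n + 1)) = ∑ x ∈ Finset.range m, f (x + n) := by
    intro n
    have h1 := Finset.sum_range_succ (fun x : ℕ => f (x + n)) m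
    rw [Finset.sum_range_succ'] at h1
    have h2 : f ((m : ℤ) + n) = f (((0 : ℕ) : ℤ) + n) := by
      rw [add_comm, hf]
      simp
    rw [h2] at h1
    rw [← add_right_cancel h1]
    exact Finset.sum_congr rfl fun x _ => by push_cast; ring_nf
  induction n using Int.induction_on with
  | zero => simp
  | succ k ih => rw [step, ih]
  | pred k ih => rw [← ih, ← step, sub_add_cancel]

theorem tsum_int_eq_sum_range_tsum {f : ℤ → ℂ} (hf : Summable f) (m : ℕ) [NeZero m] :
    ∑' n, f n = ∑ x ∈ Finset.range m, ∑' n : ℤ, f (x + m * n) := by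
  rw [← (Int.divModEquiv m).symm.tsum_eq f]
  have hs : Summable fun p : ℤ × Fin m => f ((Int.divModEquiv m).symm p) :=
    (Int.divModEquiv m).symm.summable_iff.2 hf
  rw [← (Equiv.prodComm (Fin m) ℤ).tsum_eq, Summable.tsum_prod, tsum_fintype, Finset.sum_range]
  · refine Finset.sum_congr rfl fun x _ => tsum_congr fun n => ?_
    simp only [Equiv.prodComm_apply, Prod.swap_prod_mk, Int.divModEquiv_symm_apply]
    congr 1
    ring
  · exact (Equiv.prodComm (Fin m) ℤ).summable_iff.2 hs

/-- The value of the quadratic Gauss sum, up to a positive factor. -/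
theorem exists_gaussSum_eq (a : ℕ) (ha : 0 < a) : ∃ r : ℝ, 0 < r ∧
    ∑ x ∈ Finset.range (2 * a), expTwoPiI ((x : ℚ) ^ 2 / (4 * a)) = r * expTwoPiI (1 / 8) := by
  set m : ℕ := 2 * a with hm
  have hm0 : 0 < m := by omega
  have : NeZero m := ⟨hm0.ne'⟩
  have hmC : (m : ℂ) ≠ 0 := NeZero.ne _
  have hmR : (0 : ℝ) < m := by exact_mod_cast hm0
  have haC : (a : ℂ) ≠ 0 := by exact_mod_cast ha.ne'
  have haQ : (a : ℚ) ≠ 0 := by exact_mod_cast ha.ne'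
  have hma : (m : ℂ) = 2 * a := by rw [hm]; push_cast; ring
  have hpi : (Real.pi : ℂ) ≠ 0 := by exact_mod_cast Real.pi_ne_zero
  let E : ℤ → ℂ := fun x => expTwoPiI ((x : ℚ) ^ 2 / (4 * a))
  let D : ℤ → ℂ := fun n => Complex.exp (-Real.pi * (n : ℂ) ^ 2 / m)
  let G : ℂ := ∑ x ∈ Finset.range m, E x
  -- At this point the n-th theta term is E n * D n, a Gauss sum term of period m times a real
  -- Gaussian. Moreover -1/τ = a(-1 + i), where theta is real.
  let τ : ℂ := (1 + Complex.I) / m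
  have hτim : τ.im = 1 / m := by
    simp only [τ]
    rw [show (m : ℂ) = ((m : ℝ) : ℂ) by push_cast; rfl, Complex.div_ofReal_im]
    simp
  have hτ : 0 < τ.im := by rw [hτim]; positivity
  have hE : ∀ n : ℤ, E n = Complex.exp (Real.pi * Complex.I * (n : ℂ) ^ 2 / m) := by
    intro n
    simp only [E, expTwoPiI, hma]
    congr 1
    push_cast
    field_simp
    ring
  have hterm : ∀ n : ℤ, Complex.exp (Real.pi * Complex.I * (n : ℂ) ^ 2 * τ) = E n * D n := by
    intro n
    rw [hE, ← Complex.exp_add]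
    congr 1
    simp only [τ]
    field_simp
    linear_combination ((n : ℂ) ^ 2) * Complex.I_sq
  have hsum : Summable fun n : ℤ => E n * D n := by
    have := (hasSum_jacobiTheta₂_term 0 hτ).summable
    refine this.congr fun n => ?_
    rw [← hterm, jacobiTheta₂_term]
    simp
  have hΘ : jacobiTheta τ = ∑' n, E n * D n := tsum_congr hterm
  have hper : ∀ n : ℤ, Function.Periodic (fun x : ℤ => E (x + n)) (m : ℤ) := by
    intro n x
    refine expTwoPiI_congr (x + n + a) ?_
    rw [hm]
    push_cast
    field_simp
    ring
  -- Shifting the Gauss sum by n and cancelling conj (E n) leaves the additive character x ↦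
  -- e(xn/m).
  have hEE : ∀ n : ℤ, G * conj (E n) = ∑ x ∈ Finset.range m,
      E x * Complex.exp (2 * Real.pi * (Complex.I * x / m) * n) := by
    intro n
    have h1 : G = ∑ x ∈ Finset.range m, E (x + n) :=
      (sum_range_add_of_periodic (by simpa using hper 0) n).symm
    rw [h1, Finset.sum_mul]
    refine Finset.sum_congr rfl fun x _ => ?_
    rw [conj_expTwoPiI, ← expTwoPiI_add]
    have h2 : Complex.exp (2 * Real.pi * (Complex.I * x / m) * n) =
        expTwoPiI ((x : ℚ) * n / (2 * a)) := by
      unfold expTwoPiI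
      congr 1
      rw [hma]
      push_cast
      field_simp
    rw [h2, ← expTwoPiI_add]
    congr 1
    push_cast
    field_simp
    ring
  have hDreal : ∀ n, conj (D n) = D n := by
    intro n
    simp only [D]
    rw [← Complex.exp_conj]
    congr 1
    simp
  have hconj : conj (jacobiTheta τ) = ∑' n, conj (E n) * D n := by
    rw [hΘ, Complex.conj_tsum]
    exact tsum_congr fun n => by rw [map_mul, hDreal]
  have hsq : (0 : ℝ) < ‖((1 / m : ℂ)) ^ (1 / 2 : ℂ)‖ := by
    rw [norm_pos_iff]
    intro h0
    have := (Complex.cpow_eq_zero_iff _ _).1 h0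
    simp [hmC] at this
  obtain ⟨u, hu, hu1⟩ : ∃ u : ℝ, 0 < u ∧ 1 / ((1 / m : ℂ)) ^ (1 / 2 : ℂ) = u := by
    refine ⟨1 / ((1 / m : ℝ)) ^ (1 / 2 : ℝ), by positivity, ?_⟩
    rw [Complex.ofReal_div, Complex.ofReal_cpow (by positivity)]
    push_cast
    rfl
  -- Poisson summation for the Gaussian D. Up to the positive factor u, the phase of G is thereby
  -- that of θ/conj θ.
  have hA : G * conj (jacobiTheta τ) = u * jacobiTheta τ := by
    have hre : 0 < ((1 / m : ℂ)).re := by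
      rw [show (1 / m : ℂ) = ((1 / m : ℝ) : ℂ) by push_cast; rfl, Complex.ofReal_re]
      positivity
    have hsx : ∀ x : ℕ, Summable fun n : ℤ =>
        Complex.exp (2 * Real.pi * (Complex.I * x / m) * n) * D n := by
      intro x
      refine Summable.of_norm ?_
      refine hsum.norm.congr fun n => ?_
      rw [norm_mul, norm_mul, norm_expTwoPiI]
      congr 1
      rw [show 2 * Real.pi * (Complex.I * x / m) * n =
        ((2 * Real.pi * x / m * n : ℝ) : ℂ) * Complex.I by push_cast; ring,
        Complex.norm_exp_ofReal_mul_I]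
    rw [hconj, ← tsum_mul_left]
    calc ∑' n, G * (conj (E n) * D n)
        = ∑' n : ℤ, ∑ x ∈ Finset.range m,
            E x * (Complex.exp (2 * Real.pi * (Complex.I * x / m) * n) * D n) := by
          refine tsum_congr fun n => ?_
          rw [← mul_assoc, hEE, Finset.sum_mul]
          exact Finset.sum_congr rfl fun x _ => by ring
      _ = ∑ x ∈ Finset.range m, E x *
            ∑' n : ℤ, Complex.exp (2 * Real.pi * (Complex.I * x / m) * n) * D n := by
          rw [Summable.tsum_finsetSum fun x _ => (hsx x).mul_left _]
          exact Finset.sum_congr rfl fun x _ => tsum_mul_left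
      _ = ∑ x ∈ Finset.range m, u * ∑' n : ℤ, (E (x + m * n) * D (x + m * n)) := by
          refine Finset.sum_congr rfl fun x _ => ?_
          -- After n ↦ -n, the Poisson dual of D twisted by e(xn/m) is D on the class x + mℤ, where
          -- E is constant.
          have h1 := Complex.tsum_exp_neg_quadratic hre (Complex.I * x / m)
          have h2 : ∀ n : ℤ, Complex.exp (2 * Real.pi * (Complex.I * x / m) * n) * D n =
              Complex.exp (-Real.pi * (1 / m) * n ^ 2 + 2 * Real.pi * (Complex.I * x / m) * n) := by
            intro n
            simp only [D]
            rw [← Complex.exp_add]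
            congr 1
            ring
          rw [tsum_congr h2, h1, hu1, ← (Equiv.neg ℤ).tsum_eq, mul_left_comm, ← tsum_mul_left]
          congr 1
          refine tsum_congr fun n => ?_
          have h3 : E (x + m * n) = E x := by
            have := ((hper 0).int_mul n) x
            simpa [mul_comm] using this
          rw [h3]
          congr 1
          simp only [D]
          congr 1
          push_cast
          field_simp
          rw [Complex.I_sq]
          simp only [Equiv.neg_apply]
          push_cast
          ring
      _ = u * ∑' n, E n * D n := by
          rw [← Finset.mul_sum, tsum_int_eq_sum_range_tsum hsum m]
      _ = u * jacobiTheta τ := by rw [hΘ]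
  have hS := jacobiTheta_S_smul ⟨τ, hτ⟩
  set w : ℂ := (-Complex.I * τ) ^ (1 / 2 : ℂ) with hw
  have hτ0 : -Complex.I * τ = (1 - Complex.I) / m := by
    simp only [τ]
    field_simp
    linear_combination -Complex.I_sq
  have hw2 : w ^ 2 = (1 - Complex.I) / m := by
    rw [hw, ← Complex.cpow_nat_mul, hτ0]
    simp
  have hI : (1 - Complex.I) ≠ 0 := fun h => by simpa using congrArg Complex.re h
  have hw0 : w ≠ 0 := by
    rintro h
    rw [h, zero_pow two_ne_zero] at hw2
    exact (div_ne_zero hI hmC) hw2.symm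
  set R : ℂ := w * jacobiTheta τ with hR
  have hSτ : ((ModularGroup.S • (⟨τ, hτ⟩ : ℍ) : ℍ) : ℂ) = a * (-1 + Complex.I) := by
    rw [UpperHalfPlane.modular_S_smul]
    change (-τ)⁻¹ = _
    simp only [τ, hma]
    have h1 : (1 + Complex.I) ≠ 0 := fun h => by simpa using congrArg Complex.re h
    field_simp
    linear_combination -Complex.I_sq
  rw [hSτ] at hS
  change _ = R at hS
  -- The terms of θ(a(-1 + i)) are (-1)^(a n²) times a positive real number.
  have hRreal : conj R = R := by
    rw [← hS, jacobiTheta, Complex.conj_tsum]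
    refine tsum_congr fun n => ?_
    rw [← Complex.exp_conj]
    refine Complex.exp_eq_exp_iff_exists_int.2 ⟨n ^ 2 * a, ?_⟩
    simp only [map_mul, map_add, map_neg, map_one, map_pow, Complex.conj_I, Complex.conj_ofReal,
      Complex.conj_natCast, map_intCast]
    push_cast
    ring
  -- Only non-vanishing matters, because the real number R cancels in θ/conj θ. It holds since the
  -- imaginary part a ≥ 1 puts theta within distance 1 of 1.
  have hR0 : R ≠ 0 := by
    intro h0
    have him : (a * (-1 + Complex.I) : ℂ).im = a := by simp
    have h1 : (1 : ℝ) ≤ a := by exact_mod_cast ha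
    have hb := norm_jacobiTheta_sub_one_le (τ := a * (-1 + Complex.I)) (by rw [him]; linarith)
    rw [hS, h0, him] at hb
    have h2 : Real.exp (-Real.pi * a) < 1 / 3 := by
      have h3 : (3 : ℝ) < Real.exp (Real.pi * a) := by
        have h4 := Real.add_one_le_exp (Real.pi * a)
        have := Real.pi_gt_three
        nlinarith
      rw [neg_mul, Real.exp_neg, one_div]
      exact inv_strictAnti₀ (by norm_num) h3
    have h5 : 2 / (1 - Real.exp (-Real.pi * a)) * Real.exp (-Real.pi * a) < 1 := by
      rw [div_mul_eq_mul_div, div_lt_one (by linarith)]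
      linarith
    simp at hb
    simp at h5
    linarith
  have hΘ' : jacobiTheta τ = R / w := by rw [hR]; field_simp
  have hw0' : conj w ≠ 0 := by simpa using hw0
  have hww : (conj w) ^ 2 = (1 + Complex.I) / m := by
    rw [← map_pow, hw2]
    simp
  -- With θ = R/w the relation reads G = u · conj w / w = u · (conj w)²/|w|², and (conj w)² = (1 +
  -- i)/m.
  have hG : G = u / (Complex.normSq w * m) * (1 + Complex.I) := by
    rw [hΘ', map_div₀, hRreal] at hA
    rw [← Complex.mul_conj]
    field_simp at hA
    have h1 : G * w * conj w * m = u * ((conj w) ^ 2 * m) := by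
      linear_combination (conj w * m) * hA
    rw [hww] at h1
    field_simp at h1 ⊢
    rw [← h1]
  have h8 : expTwoPiI (1 / 8) = (1 + Complex.I) * ((√2 / 2 : ℝ) : ℂ) := by
    unfold expTwoPiI
    rw [show (2 * Real.pi * Complex.I * ((1 / 8 : ℚ) : ℂ)) =
      ((Real.pi / 4 : ℝ) : ℂ) * Complex.I by push_cast; ring, Complex.exp_mul_I,
      ← Complex.ofReal_cos, ← Complex.ofReal_sin, Real.cos_pi_div_four, Real.sin_pi_div_four]
    ring
  have hn : 0 < Complex.normSq w := Complex.normSq_pos.2 hw0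
  have hs2 : (0 : ℝ) < √2 := by positivity
  refine ⟨u / (Complex.normSq w * m) * (2 / √2), by positivity, ?_⟩
  have hGE : ∑ x ∈ Finset.range m, expTwoPiI ((x : ℚ) ^ 2 / (4 * a)) = G :=
    Finset.sum_congr rfl fun x _ => by simp only [E]; push_cast; rfl
  have hs2C : ((√2 : ℝ) : ℂ) ≠ 0 := by exact_mod_cast hs2.ne'
  rw [hGE, hG, h8]
  push_cast
  field_simp

/-! ### Milgram's formula -/

section

variable {V : Type*} [AddCommGroup V] [Module ℚ V]

theorem exists_natCast_smul_mem (L : Submodule ℤ V) [h : L.IsLattice ℚ] (x : V) :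
    ∃ N : ℕ, N ≠ 0 ∧ (N : ℚ) • x ∈ L := by
  have hx : x ∈ Submodule.span ℚ (L : Set V) := by rw [h.span_eq_top]; trivial
  induction hx using Submodule.span_induction with
  | mem y hy => exact ⟨1, one_ne_zero, by simpa using hy⟩
  | zero => exact ⟨1, one_ne_zero, by simp⟩
  | add y z _ _ hy hz =>
    obtain ⟨N, hN, h1⟩ := hy
    obtain ⟨M, hM, h2⟩ := hz
    refine ⟨N * M, mul_ne_zero hN hM, ?_⟩
    rw [smul_add, Nat.cast_mul]
    refine L.add_mem ?_ ?_
    · rw [mul_comm, mul_smul]; exact natCast_smul_mem L M h1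
    · rw [mul_smul]; exact natCast_smul_mem L N h2
  | smul a y _ hy =>
    obtain ⟨N, hN, h1⟩ := hy
    refine ⟨a.den * N, mul_ne_zero a.den_nz hN, ?_⟩
    have h2 : ((a.den * N : ℕ) : ℚ) • a • y = (a.num : ℚ) • (N : ℚ) • y := by
      rw [smul_smul, smul_smul, Nat.cast_mul, mul_right_comm, Rat.den_mul_eq_num]
    rw [h2]
    exact intCast_smul_mem L _ h1

theorem exists_basis_lattice (L : Submodule ℤ V) [h : L.IsLattice ℚ] :
    Nonempty (Module.Basis (Fin (Module.finrank ℚ V)) ℤ L) := by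
  have : Module.Finite ℤ L := Submodule.IsLattice.finite ℚ L
  have : Module.Free ℤ L := Submodule.IsLattice.free ℚ L
  have hr : Module.finrank ℤ L = Module.finrank ℚ V :=
    congrArg Cardinal.toNat (Submodule.IsLattice.rank' ℚ L)
  exact ⟨(Module.finBasis ℤ L).reindex (finCongr hr)⟩

/-- A `ℤ`-basis of a lattice. -/
noncomputable def latticeBasis (L : Submodule ℤ V) [L.IsLattice ℚ] :
    Module.Basis (Fin (Module.finrank ℚ V)) ℤ L :=
  (exists_basis_lattice L).some

theorem finiteDimensional_of_isLattice (L : Submodule ℤ V) [L.IsLattice ℚ] :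
    FiniteDimensional ℚ V :=
  Module.Finite.of_basis ((latticeBasis L).extendOfIsLattice ℚ)

variable (B : LinearMap.BilinForm ℚ V) (L : Submodule ℤ V)

theorem bilin_comm [h : IsEvenLattice B L] (x y : V) : B x y = B y x := h.symm.eq x y

theorem quad_add [IsEvenLattice B L] (x y : V) :
    B (x + y) (x + y) / 2 = B x x / 2 + B x y + B y y / 2 := by
  simp only [map_add, LinearMap.add_apply]
  rw [bilin_comm B L y x]
  ring

theorem dual_dual [h : IsEvenLattice B L] : B.dualSubmodule (B.dualSubmodule L) = L := by
  have := h.lattice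
  set b := latticeBasis L
  have hL : Submodule.span ℤ (Set.range (b.extendOfIsLattice ℚ)) = L := by
    have h1 : (Set.range (b.extendOfIsLattice ℚ)) = L.subtype '' Set.range b := by
      rw [← Set.range_comp]
      congr 1
      funext i
      simp
    rw [h1, ← Submodule.map_span, b.span_eq, Submodule.map_top, Submodule.range_subtype]
  have h2 := LinearMap.BilinForm.dualSubmodule_dualSubmodule_of_basis (R := ℤ) B h.nondegenerate
    h.symm (b.extendOfIsLattice ℚ)
  rwa [hL] at h2

theorem even_div_two [h : IsEvenLattice B L] {x : V} (hx : x ∈ L) : ∃ m : ℤ, B x x / 2 = m := by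
  obtain ⟨m, hm⟩ := h.even x hx
  exact ⟨m, by rw [hm]; ring⟩

theorem dual_bilin {x y : V} (hx : x ∈ B.dualSubmodule L) (hy : y ∈ L) : ∃ m : ℤ, B x y = m :=
  (mem_dual_iff B L x).1 hx y hy

/-- `e(q(x))` is well-defined on `L' / L`. -/
theorem periodicOn_quad [IsEvenLattice B L] :
    PeriodicOn (B.dualSubmodule L) L fun x => expTwoPiI (B x x / 2) := by
  intro x hx y hy
  obtain ⟨m, hm⟩ := dual_bilin B L hx hy
  obtain ⟨k, hk⟩ := even_div_two B L hy
  refine expTwoPiI_congr (m + k) ?_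
  rw [quad_add B L, hm, hk]
  push_cast
  ring

/-- The Gauss sum `∑_{γ ∈ L'/L} e(q(γ))`. -/
noncomputable def discGaussSum [IsEvenLattice B L] : ℂ :=
  ∑ γ : disc B L, expTwoPiI (quadRep B L γ)

/-- In the double sum of e(q(x) - q(y)), the shift x ↦ x + y leaves e(q(x)) e((x, y)). The sum over
y then retains only x in L'' = L. -/
theorem discGaussSum_mul_conj [IsEvenLattice B L] :
    discGaussSum B L * conj (discGaussSum B L) = Nat.card (disc B L) := by
  classical
  have ht := isTransversal_out B L (le_dual B L)
  let g : disc B L → V := fun γ => Quotient.out (γ : V ⧸ L)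
  have h0 : ∃ γ₀ : disc B L, g γ₀ ∈ L ∧ ∀ γ, g γ ∈ L → γ = γ₀ := by
    obtain ⟨i, hi, hu⟩ := ht.existsUnique 0 (Submodule.zero_mem _)
    exact ⟨i, by simpa using hi, fun γ hγ => hu γ (by simpa using hγ)⟩
  obtain ⟨γ₀, hγ₀, hγ₀u⟩ := h0
  calc discGaussSum B L * conj (discGaussSum B L)
      = ∑ y, ∑ x, expTwoPiI (B (g x) (g x) / 2 - B (g y) (g y) / 2) := by
        rw [discGaussSum, map_sum, Finset.sum_mul_sum, Finset.sum_comm]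
        refine Finset.sum_congr rfl fun y _ => Finset.sum_congr rfl fun x _ => ?_
        rw [conj_expTwoPiI, ← expTwoPiI_add, ← sub_eq_add_neg]
        rfl
    _ = ∑ y, ∑ x, expTwoPiI (B (g x) (g x) / 2) * expTwoPiI (-B (-g x) (g y)) := by
        refine Finset.sum_congr rfl fun y _ => ?_
        have hp : PeriodicOn (B.dualSubmodule L) L
            fun x => expTwoPiI (B x x / 2 - B (g y) (g y) / 2) := by
          intro x hx z hz
          simp only [sub_eq_add_neg, expTwoPiI_add]
          exact congrArg (· * _) (periodicOn_quad B L x hx z hz)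
        rw [← ht.sum_add_right hp (ht.mem y)]
        refine Finset.sum_congr rfl fun x _ => ?_
        rw [← expTwoPiI_add]
        congr 1
        change B (g x + g y) (g x + g y) / 2 - B (g y) (g y) / 2 = _
        rw [quad_add B L, map_neg, LinearMap.neg_apply]
        ring
    _ = ∑ x, expTwoPiI (B (g x) (g x) / 2) *
          if g x ∈ L then (Fintype.card (disc B L) : ℂ) else 0 := by
        rw [Finset.sum_comm]
        refine Finset.sum_congr rfl fun x _ => ?_
        rw [← Finset.mul_sum, ht.sum_expTwoPiI B (-g x) fun y hy => ?_]
        · rw [dual_dual, Submodule.neg_mem_iff]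
        · exact dual_bilin B L (Submodule.neg_mem _ (ht.mem x)) hy
    _ = Nat.card (disc B L) := by
        rw [Finset.sum_eq_single γ₀]
        · obtain ⟨k, hk⟩ := even_div_two B L hγ₀
          rw [if_pos hγ₀, hk, expTwoPiI_int, one_mul, Nat.card_eq_fintype_card]
        · intro γ _ hγ
          rw [if_neg fun h => hγ (hγ₀u γ h), mul_zero]
        · simp

theorem norm_discGaussSum [IsEvenLattice B L] :
    ‖discGaussSum B L‖ = Real.sqrt (Nat.card (disc B L)) := by
  have h := discGaussSum_mul_conj B L
  rw [Complex.mul_conj, Complex.normSq_eq_norm_sq] at h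
  rw [eq_comm, Real.sqrt_eq_iff_mul_self_eq (by positivity) (norm_nonneg _), ← sq]
  exact_mod_cast h.symm

/-- The phase of the Gauss sum does not change on passing to a sublattice. -/
theorem exists_discGaussSum_eq_mul {L₀ : Submodule ℤ V} [IsEvenLattice B L] [IsEvenLattice B L₀]
    (hL : L₀ ≤ L) : ∃ m : ℕ, 0 < m ∧ discGaussSum B L₀ = m * discGaussSum B L := by
  classical
  have hD : B.dualSubmodule L ≤ B.dualSubmodule L₀ := fun x hx y hy => hx y (hL hy)
  have ht₀ := isTransversal_out B L₀ (le_dual B L₀)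
  have ht := isTransversal_out B L (le_dual B L)
  let g : disc B L₀ → V := fun γ => Quotient.out (γ : V ⧸ L₀)
  have hLD : L ≤ B.dualSubmodule L₀ := (le_dual B L).trans hD
  have htL : IsTransversal L L₀ fun i : {i // g i ∈ L} => g i := ht₀.subtype hLD hL
  have htD : IsTransversal (B.dualSubmodule L) L₀ fun i : {i // g i ∈ B.dualSubmodule L} => g i :=
    ht₀.subtype hD (hL.trans (le_dual B L))
  obtain ⟨i₀, -⟩ := htL.existsUnique 0 L.zero_mem
  have hpos : 0 < Fintype.card {i // g i ∈ L} := Fintype.card_pos_iff.2 ⟨i₀⟩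
  have hm0 : ((Fintype.card {i // g i ∈ L} : ℕ) : ℂ) ≠ 0 := by exact_mod_cast hpos.ne'
  refine ⟨_, hpos, ?_⟩
  have h1 : (Fintype.card {i // g i ∈ L} : ℂ) * discGaussSum B L₀ =
      (Fintype.card {i // g i ∈ L} : ℂ) *
        ∑ i : {i // g i ∈ B.dualSubmodule L}, expTwoPiI (B (g i) (g i) / 2) := by
    -- Translating by k in L does not change the sum over L₀'/L₀, but it multiplies e(q(x)) by e((x,
    -- k)). Summing over k in L/L₀ retains only x in L'.
    calc (Fintype.card {i // g i ∈ L} : ℂ) * discGaussSum B L₀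
        = ∑ k : {i // g i ∈ L}, ∑ i, expTwoPiI (B (g i) (g i) / 2) := by
          rw [Finset.sum_const, nsmul_eq_mul]
          rfl
      _ = ∑ k : {i // g i ∈ L}, ∑ i,
            expTwoPiI (B (g i) (g i) / 2) * expTwoPiI (-B (-g i) (g k)) := by
          refine Finset.sum_congr rfl fun k _ => ?_
          rw [← ht₀.sum_add_right (periodicOn_quad B L₀) (hLD k.2)]
          refine Finset.sum_congr rfl fun i _ => ?_
          rw [← expTwoPiI_add]
          obtain ⟨m, hm⟩ := even_div_two B L k.2
          refine expTwoPiI_congr m ?_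
          change B (g i + g k) (g i + g k) / 2 = _
          rw [quad_add B L, hm, map_neg, LinearMap.neg_apply]
          ring
      _ = ∑ i, if g i ∈ B.dualSubmodule L then
            (Fintype.card {i // g i ∈ L} : ℂ) * expTwoPiI (B (g i) (g i) / 2) else 0 := by
          rw [Finset.sum_comm]
          refine Finset.sum_congr rfl fun i _ => ?_
          rw [← Finset.mul_sum, htL.sum_expTwoPiI B (-g i) fun y hy => ?_]
          · rw [Submodule.neg_mem_iff, mul_ite, mul_zero, mul_comm]
          · exact dual_bilin B L₀ (Submodule.neg_mem _ (ht₀.mem i)) hy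
      _ = _ := by
          rw [← Finset.sum_filter, Finset.mul_sum]
          exact Finset.sum_subtype _ (by simp) _
  -- The remaining sum runs over L'/L₀, and e(q) is constant on the [L : L₀] classes above each
  -- class of L'/L.
  rw [mul_left_cancel₀ hm0 h1, htD.sum_prod ht htL (le_dual B L) hL
    ((periodicOn_quad B L).mono le_rfl hL), discGaussSum, Finset.mul_sum]
  refine Finset.sum_congr rfl fun γ _ => ?_
  rw [Finset.sum_congr rfl fun k _ => periodicOn_quad B L _ (ht.mem γ) _ (htL.mem k),
    Finset.sum_const, nsmul_eq_mul]
  rfl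

end

/-! ### Diagonal lattices and the evaluation of the Gauss sum -/

section

variable {V : Type*} [AddCommGroup V] [Module ℚ V] (B : LinearMap.BilinForm ℚ V)

section Diagonal

variable {ι : Type*} [Fintype ι] [DecidableEq ι] {w : Module.Basis ι ℚ V} {a : ι → ℤ}

theorem bilin_diag_apply (hB : ∀ i j, B (w i) (w j) = if i = j then 2 * (a i : ℚ) else 0)
    (c : ι → ℚ) (j : ι) : B (∑ i, c i • w i) (w j) = c j * (2 * a j) := by
  rw [map_sum, LinearMap.sum_apply, Finset.sum_eq_single j]
  · simp [hB]
  · intro i _ hij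
    simp [hB, hij]
  · simp

theorem quad_diag_apply (hB : ∀ i j, B (w i) (w j) = if i = j then 2 * (a i : ℚ) else 0)
    (c : ι → ℚ) : B (∑ i, c i • w i) (∑ i, c i • w i) / 2 = ∑ i, a i * c i ^ 2 := by
  rw [map_sum (B (∑ i, c i • w i)), Finset.sum_div]
  refine Finset.sum_congr rfl fun j _ => ?_
  rw [map_smul, bilin_diag_apply B hB, smul_eq_mul]
  ring

/-- The dual basis is w_i/(2a_i), so the discriminant group is the product of the groups ℤ/2a_i. The
denominator keeps the sign of a_i, and only the number of representatives uses |a_i|. -/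
theorem isTransversal_diag (ha : ∀ i, a i ≠ 0)
    (hB : ∀ i j, B (w i) (w j) = if i = j then 2 * (a i : ℚ) else 0) :
    IsTransversal (B.dualSubmodule (Submodule.span ℤ (Set.range w)))
      (Submodule.span ℤ (Set.range w))
      fun x : ∀ i, Fin (2 * (a i).natAbs) => ∑ i, ((x i : ℚ) / (2 * a i)) • w i := by
  have haQ : ∀ i, (a i : ℚ) ≠ 0 := fun i => by exact_mod_cast ha i
  have hdual : ∀ x, x ∈ B.dualSubmodule (Submodule.span ℤ (Set.range w)) ↔
      ∀ j, ∃ m : ℤ, B x (w j) = m := by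
    intro x
    rw [mem_dual_iff]
    refine ⟨fun h j => h _ (Submodule.subset_span ⟨j, rfl⟩), fun h y hy => ?_⟩
    induction hy using Submodule.span_induction with
    | mem y hy => obtain ⟨j, rfl⟩ := hy; exact h j
    | zero => exact ⟨0, by simp⟩
    | add y z _ _ hy hz =>
      obtain ⟨m, hm⟩ := hy
      obtain ⟨k, hk⟩ := hz
      exact ⟨m + k, by rw [map_add, hm, hk]; push_cast; ring⟩
    | smul t y _ hy =>
      obtain ⟨m, hm⟩ := hy
      refine ⟨t * m, ?_⟩
      rw [← Int.cast_smul_eq_zsmul ℚ, map_smul, hm]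
      push_cast
      rfl
  refine ⟨fun x => (hdual _).2 fun j => ⟨x j, ?_⟩, fun h hh => ?_⟩
  · rw [bilin_diag_apply B hB]
    have := haQ j
    push_cast
    field_simp
  · choose m hm using (hdual h).1 hh
    have hrep : ∀ i, w.repr h i = m i / (2 * a i) := by
      intro i
      have h1 := bilin_diag_apply B hB (w.repr h) i
      rw [w.sum_repr, hm] at h1
      have := haQ i
      rw [h1]
      field_simp
    have key : ∀ x : ∀ i, Fin (2 * (a i).natAbs),
        h - ∑ i, ((x i : ℚ) / (2 * a i)) • w i ∈ Submodule.span ℤ (Set.range w) ↔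
          ∀ i, 2 * a i ∣ m i - x i := by
      intro x
      rw [w.mem_span_iff_repr_mem ℤ]
      refine forall_congr' fun i => ?_
      rw [map_sub, Finsupp.sub_apply, w.repr_sum_self, hrep, ← sub_div]
      have := haQ i
      constructor
      · rintro ⟨k, hk⟩
        refine ⟨k, ?_⟩
        have hk' : (k : ℚ) = (m i - x i) / (2 * a i) := by simpa using hk
        field_simp at hk'
        have : (((k * (2 * a i)) : ℤ) : ℚ) = ((m i - x i : ℤ) : ℚ) := by
          push_cast
          linarith
        have := Int.cast_injective this
        linarith
      · rintro ⟨k, hk⟩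
        refine ⟨k, ?_⟩
        have hk' : ((m i - x i : ℤ) : ℚ) = ((2 * a i * k : ℤ) : ℚ) := by rw [hk]
        push_cast at hk'
        simp only [algebraMap_int_eq, Int.coe_castRingHom]
        rw [hk']
        field_simp
    simp only [key]
    have hpos : ∀ i, (0 : ℤ) < 2 * (a i).natAbs := fun i => by have := ha i; omega
    have hdvd : ∀ i (z : ℤ), 2 * a i ∣ z ↔ (2 * (a i).natAbs : ℤ) ∣ z := by
      intro i z
      rcases Int.natAbs_eq (a i) with h1 | h1
      · rw [← h1]
      · conv_lhs => rw [h1]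
        rw [mul_neg, neg_dvd]
    refine ⟨fun i => ⟨(m i % (2 * (a i).natAbs : ℤ)).toNat, ?_⟩, fun i => ?_, fun y hy => ?_⟩
    · have := Int.emod_lt_of_pos (m i) (hpos i)
      have := Int.emod_nonneg (m i) (hpos i).ne'
      omega
    · rw [hdvd]
      simp only [Int.toNat_of_nonneg (Int.emod_nonneg (m i) (hpos i).ne')]
      exact Int.dvd_self_sub_emod
    · funext i
      refine Fin.ext ?_
      have h3 : m i % (2 * (a i).natAbs : ℤ) = (y i : ℤ) % (2 * (a i).natAbs : ℤ) :=
        Int.emod_eq_emod_iff_emod_sub_eq_zero.2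
          (Int.emod_eq_zero_of_dvd ((hdvd i _).1 (hy i)))
      simp only
      rw [h3, Int.emod_eq_of_lt (by positivity) (by exact_mod_cast (y i).2)]
      simp

/-- The exponent is x²/(4a), so for negative a the sum is the complex conjugate of the Gauss sum for
|a|. This is the origin of the sign of a in the phase. -/
theorem exists_sum_fin_expTwoPiI (a : ℤ) (ha : a ≠ 0) : ∃ r : ℝ, 0 < r ∧
    ∑ x : Fin (2 * a.natAbs), expTwoPiI (a * ((x : ℚ) / (2 * a)) ^ 2) =
      r * expTwoPiI ((a.sign : ℚ) / 8) := by
  have haQ : (a : ℚ) ≠ 0 := by exact_mod_cast ha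
  obtain ⟨r, hr, h⟩ := exists_gaussSum_eq a.natAbs (Int.natAbs_pos.2 ha)
  rw [Finset.sum_range] at h
  refine ⟨r, hr, ?_⟩
  rcases lt_or_gt_of_ne ha with h0 | h0
  · have h1 : (a.natAbs : ℚ) = -a := by
      rw [← Int.cast_natCast, Int.ofNat_natAbs_of_nonpos h0.le]; push_cast; rfl
    have h2 := congrArg conj h
    rw [map_sum, map_mul, Complex.conj_ofReal, conj_expTwoPiI] at h2
    rw [Int.sign_eq_neg_one_of_neg h0, show (((-1 : ℤ) : ℚ)) / 8 = -(1 / 8) by norm_num, ← h2]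
    refine Finset.sum_congr rfl fun x _ => ?_
    rw [conj_expTwoPiI, h1]
    congr 1
    field_simp
    ring
  · have h1 : (a.natAbs : ℚ) = a := by
      rw [← Int.cast_natCast, Int.natAbs_of_nonneg h0.le]
    rw [Int.sign_eq_one_of_pos h0, show (((1 : ℤ) : ℚ)) / 8 = 1 / 8 by norm_num, ← h]
    refine Finset.sum_congr rfl fun x _ => ?_
    rw [h1]
    congr 1
    field_simp
    ring

theorem expTwoPiI_sum {κ : Type*} (s : Finset κ) (f : κ → ℚ) :
    expTwoPiI (∑ i ∈ s, f i) = ∏ i ∈ s, expTwoPiI (f i) := by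
  classical
  induction s using Finset.induction_on with
  | empty => simp
  | insert i s hi ih => rw [Finset.sum_insert hi, Finset.prod_insert hi, expTwoPiI_add, ih]

theorem exists_discGaussSum_diag (ha : ∀ i, a i ≠ 0)
    (hB : ∀ i j, B (w i) (w j) = if i = j then 2 * (a i : ℚ) else 0)
    [IsEvenLattice B (Submodule.span ℤ (Set.range w))] : ∃ r : ℝ, 0 < r ∧
      discGaussSum B (Submodule.span ℤ (Set.range w)) =
        r * expTwoPiI ((∑ i, ((a i).sign : ℚ)) / 8) := by
  choose r hr h using fun i => exists_sum_fin_expTwoPiI (a i) (ha i)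
  refine ⟨∏ i, r i, Finset.prod_pos fun i _ => hr i, ?_⟩
  have h1 := (isTransversal_out B _ (le_dual B (Submodule.span ℤ (Set.range w)))).sum_eq
    (isTransversal_diag B ha hB) (periodicOn_quad B _)
  refine (h1 : discGaussSum B _ = _).trans ?_
  simp only [quad_diag_apply B hB, expTwoPiI_sum]
  have h2 := Finset.prod_univ_sum (fun i => (Finset.univ : Finset (Fin (2 * (a i).natAbs))))
    fun i x => expTwoPiI (a i * ((x : ℚ) / (2 * a i)) ^ 2)
  rw [Fintype.piFinset_univ] at h2
  rw [← h2, Finset.prod_congr rfl fun i _ => h i, Finset.prod_mul_distrib, Finset.sum_div,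
    expTwoPiI_sum]
  push_cast
  rfl

end Diagonal

/-- Sylvester's law of inertia: b⁺ and b⁻ count the positive and negative diagonal entries in any
orthogonal basis. -/
theorem sum_sign_eq {ι : Type*} [Fintype ι] {w : Module.Basis ι ℚ V} {a : ι → ℚ}
    (hs : ∀ x y, B x y = B y x) (ho : B.IsOrthoᵢ w) (ha : ∀ i, B (w i) (w i) = a i) :
    ∑ i, (SignType.sign (a i) : ℚ) = (bPlus B : ℚ) - bMinus B := by
  classical
  have : Invertible (2 : ℚ) := invertibleOfNonzero two_ne_zero
  have h1 : QuadraticMap.Equivalent (LinearMap.BilinMap.toQuadraticMap B)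
      (QuadraticMap.weightedSumSquares ℚ a) := by
    refine ⟨?_⟩
    have h2 := QuadraticMap.basisRepr_eq_of_iIsOrtho (LinearMap.BilinMap.toQuadraticMap B) w
      (by rwa [QuadraticMap.associated_left_inverse ℚ hs])
    have h3 : (fun i => LinearMap.BilinMap.toQuadraticMap B (w i)) = a := by
      funext i
      simpa using ha i
    rw [h3] at h2
    rw [← h2]
    exact QuadraticMap.isometryEquivBasisRepr _ w
  rw [bPlus, bMinus, QuadraticForm.sigPos_of_equiv_weightedSumSquares h1,
    QuadraticForm.sigNeg_of_equiv_weightedSumSquares h1, Set.ncard_eq_toFinset_card',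
    Set.ncard_eq_toFinset_card', Finset.card_eq_sum_ones, Finset.card_eq_sum_ones]
  push_cast
  rw [Set.toFinset_ofPred, Set.toFinset_ofPred, Finset.sum_filter, Finset.sum_filter,
    ← Finset.sum_sub_distrib]
  refine Finset.sum_congr rfl fun i _ => ?_
  rcases lt_trichotomy (a i) 0 with h | h | h
  · simp [h, not_lt.2 h.le]
  · simp [h]
  · simp [h, not_lt.2 h.le]

variable (L : Submodule ℤ V)

/-- A lattice contains an orthogonal basis of the ambient space. -/
theorem exists_orthogonal_basis_mem [h : IsEvenLattice B L] :
    ∃ w : Module.Basis (Fin (Module.finrank ℚ V)) ℚ V, B.IsOrthoᵢ w ∧ ∀ i, w i ∈ L := by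
  have := h.lattice
  have := finiteDimensional_of_isLattice L
  have : Invertible (2 : ℚ) := invertibleOfNonzero two_ne_zero
  obtain ⟨v, hv⟩ := LinearMap.BilinForm.exists_orthogonal_basis
    (LinearMap.BilinForm.isSymm_iff.1 h.symm)
  choose N hN hNv using fun i => exists_natCast_smul_mem L (v i)
  have hNQ : ∀ i, (N i : ℚ) ≠ 0 := fun i => by exact_mod_cast hN i
  refine ⟨v.unitsSMul fun i => Units.mk0 (N i : ℚ) (hNQ i), ?_, fun i => ?_⟩
  · intro i j hij
    have := hv hij
    simp only [Function.onFun] at this ⊢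
    simp [Module.Basis.unitsSMul_apply, Units.smul_def, this]
  · simpa [Module.Basis.unitsSMul_apply, Units.smul_def] using hNv i

/-- **Milgram's formula**. -/
theorem discGaussSum_eq [h : IsEvenLattice B L] :
    discGaussSum B L = (Real.sqrt (Nat.card (disc B L)) : ℂ) *
      expTwoPiI (((bPlus B : ℚ) - bMinus B) / 8) := by
  classical
  obtain ⟨w, hw, hwL⟩ := exists_orthogonal_basis_mem B L
  choose a ha using fun i => h.even _ (hwL i)
  have hB : ∀ i j, B (w i) (w j) = if i = j then 2 * (a i : ℚ) else 0 := by
    intro i j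
    split_ifs with hij
    · rw [← hij, ha]
    · exact hw hij
  have ha0 : ∀ i, a i ≠ 0 := by
    intro i h0
    refine w.ne_zero i (h.nondegenerate.1 (w i) fun y => ?_)
    rw [← w.sum_repr y, map_sum]
    refine Finset.sum_eq_zero fun j _ => ?_
    rw [map_smul, hB]
    split_ifs with hij
    · simp [h0]
    · simp
  have hle : Submodule.span ℤ (Set.range w) ≤ L := by
    rw [Submodule.span_le]
    rintro _ ⟨i, rfl⟩
    exact hwL i
  have hL₀ : IsEvenLattice B (Submodule.span ℤ (Set.range w)) :=
    { lattice := ⟨Submodule.fg_span (Set.finite_range w), by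
        rw [Submodule.span_span_of_tower, w.span_eq]⟩
      symm := h.symm
      nondegenerate := h.nondegenerate
      integral := fun x hx y hy => h.integral x (hle hx) y (hle hy)
      even := fun x hx => h.even x (hle hx) }
  obtain ⟨r, hr, hr'⟩ := exists_discGaussSum_diag B ha0 hB
  obtain ⟨m, hm, hm'⟩ := exists_discGaussSum_eq_mul B L hle
  have hsign : ∑ i, ((a i).sign : ℚ) = (bPlus B : ℚ) - bMinus B := by
    rw [← sum_sign_eq B (bilin_comm B L) hw fun i => rfl]
    refine Finset.sum_congr rfl fun i _ => ?_
    rw [ha]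
    rcases lt_or_gt_of_ne (ha0 i) with h1 | h1
    · have h2 : (2 * (a i : ℚ)) < 0 := by
        have : (a i : ℚ) < 0 := by exact_mod_cast h1
        linarith
      rw [Int.sign_eq_neg_one_of_neg h1, sign_neg h2]
      simp
    · have h2 : 0 < (2 * (a i : ℚ)) := by
        have : (0 : ℚ) < (a i : ℚ) := by exact_mod_cast h1
        linarith
      rw [Int.sign_eq_one_of_pos h1, sign_pos h2]
      simp
  rw [hm', hsign] at hr'
  set u := expTwoPiI (((bPlus B : ℚ) - bMinus B) / 8) with hu
  have hmR : (0 : ℝ) < m := by exact_mod_cast hm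
  have hmC : (m : ℂ) ≠ 0 := by exact_mod_cast hm.ne'
  -- The orthogonal sublattice determines the phase up to a positive factor. The factor is then read
  -- off from the absolute value √|A|.
  have hG : discGaussSum B L = ((r / m : ℝ) : ℂ) * u := by
    push_cast
    field_simp
    linear_combination hr'
  have hn := norm_discGaussSum B L
  rw [hG, norm_mul, norm_expTwoPiI, mul_one, Complex.norm_real, Real.norm_of_nonneg
    (by positivity)] at hn
  rw [hG, hn]

end

/-! ### Sums over `L' / c L` -/

section

variable {V : Type*} [AddCommGroup V] [Module ℚ V] (B : LinearMap.BilinForm ℚ V)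
  {L : Submodule ℤ V} [IsEvenLattice B L]
  {ι : Type*} [Fintype ι] (b : Module.Basis ι ℤ L)

theorem isTransversal_out_add_box (c : ℕ) [NeZero c] :
    IsTransversal (B.dualSubmodule L) (scale (c : ℚ) L)
      fun p : disc B L × (ι → Fin c) => Quotient.out (p.1 : V ⧸ L) + box b c p.2 :=
  (isTransversal_out B L (le_dual B L)).prod (isTransversal_box b c) (le_dual B L)
    (scale_natCast_le c L)

variable [DecidableEq ι]

/-- The sum of a function over `L' / c L`, divided by the order of `L / c L`. -/
noncomputable def dualMean (c : ℕ) (f : V → ℂ) : ℂ :=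
  ∑ γ : disc B L, latMean b c fun l => f (Quotient.out (γ : V ⧸ L) + l)

theorem dualMean_eq {κ : Type*} [Fintype κ] {c : ℕ} [NeZero c] {g : κ → V}
    (hg : IsTransversal (B.dualSubmodule L) (scale (c : ℚ) L) g) {f : V → ℂ}
    (hf : PeriodicOn (B.dualSubmodule L) (scale (c : ℚ) L) f) :
    dualMean B b c f = ((c : ℂ) ^ Fintype.card ι)⁻¹ * ∑ j, f (g j) := by
  rw [hg.sum_prod (isTransversal_out B L (le_dual B L)) (isTransversal_box b c) (le_dual B L)
    (scale_natCast_le c L) hf, Finset.mul_sum]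
  rfl

theorem dualMean_congr {c : ℕ} [NeZero c] {f g : V → ℂ} (h : ∀ x ∈ B.dualSubmodule L, f x = g x) :
    dualMean B b c f = dualMean B b c g :=
  Finset.sum_congr rfl fun γ _ => latMean_congr b fun _ hl =>
    h _ (Submodule.add_mem _ ((isTransversal_out B L (le_dual B L)).mem γ) (le_dual B L hl))

theorem dualMean_sub {c : ℕ} [NeZero c] {f : V → ℂ}
    (hf : PeriodicOn (B.dualSubmodule L) (scale (c : ℚ) L) f) {p : V} (hp : p ∈ B.dualSubmodule L) :
    dualMean B b c (fun y => f (y - p)) = dualMean B b c f := by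
  have ht := isTransversal_out_add_box B b c
  have hf' : PeriodicOn (B.dualSubmodule L) (scale (c : ℚ) L) fun y => f (y - p) := by
    intro x hx y hy
    simp only
    rw [add_sub_right_comm, hf _ (Submodule.sub_mem _ hx hp) y hy]
  rw [dualMean_eq B b ht hf', dualMean_eq B b ht hf,
    ← ht.sum_add_right hf (Submodule.neg_mem _ hp)]
  simp only [sub_eq_add_neg]

theorem dualMean_mul_left (c : ℕ) (a : ℂ) (f : V → ℂ) :
    dualMean B b c (fun x => a * f x) = a * dualMean B b c f := by
  simp only [dualMean, latMean_mul_left, Finset.mul_sum]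

theorem latMean_dualMean_comm (c d : ℕ) (f : V → V → ℂ) :
    latMean b c (fun x => dualMean B b d (f x)) =
      dualMean B b d fun y => latMean b c fun x => f x y := by
  simp only [dualMean]
  rw [latMean_sum]
  exact Finset.sum_congr rfl fun γ _ => latMean_comm b c d _

theorem dualMean_of_periodicOn (c : ℕ) [NeZero c] {f : V → ℂ}
    (hf : PeriodicOn (B.dualSubmodule L) L f) :
    dualMean B b c f = ∑ γ : disc B L, f (Quotient.out (γ : V ⧸ L)) := by
  refine Finset.sum_congr rfl fun γ _ => ?_
  rw [latMean_congr b fun l hl => hf _ ((isTransversal_out B L (le_dual B L)).mem γ) l hl,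
    latMean_const]

open scoped Classical in
/-- The substitution `y ↦ c y`. -/
theorem dualMean_ite_mem_scale (c m : ℕ) [NeZero c] [NeZero m] {f : V → ℂ}
    (hf : PeriodicOn (B.dualSubmodule L) (scale ((c * m : ℕ) : ℚ) L) f) :
    dualMean B b (c * m) (fun y => if y ∈ scale (c : ℚ) (B.dualSubmodule L) then f y else 0) =
      ((c : ℂ) ^ Fintype.card ι)⁻¹ * dualMean B b m fun y => f ((c : ℚ) • y) := by
  have hle : scale ((c * m : ℕ) : ℚ) L ≤ scale (c : ℚ) (B.dualSubmodule L) :=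
    (scale_natCast_mul_le c m L).trans (scale_mono _ (le_dual B L))
  have hcD := scale_natCast_le c (B.dualSubmodule L)
  have ht := isTransversal_out_add_box B b (c * m)
  have htm := isTransversal_out_add_box B b m
  have hf1 : PeriodicOn (B.dualSubmodule L) (scale ((c * m : ℕ) : ℚ) L)
      fun y => if y ∈ scale (c : ℚ) (B.dualSubmodule L) then f y else 0 := by
    intro x hx y hy
    simp only
    rw [hf x hx y hy, Submodule.add_mem_iff_left _ (hle hy)]
  have hf2 : PeriodicOn (B.dualSubmodule L) (scale (m : ℚ) L) fun y => f ((c : ℚ) • y) := by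
    intro x hx y hy
    simp only
    rw [smul_add, hf _ (natCast_smul_mem _ c hx)]
    rw [Nat.cast_mul, scale_mul]
    exact smul_mem_scale hy
  have hts := ht.subtype hcD hle
  have htc : IsTransversal (scale (c : ℚ) (B.dualSubmodule L)) (scale ((c * m : ℕ) : ℚ) L)
      fun p : disc B L × (ι → Fin m) => (c : ℚ) • (Quotient.out (p.1 : V ⧸ L) + box b m p.2) := by
    rw [Nat.cast_mul, scale_mul]
    exact htm.scale (NeZero.ne _)
  rw [dualMean_eq B b ht hf1, dualMean_eq B b htm hf2,
    ← hts.sum_eq htc (hf.mono hcD le_rfl), ← Finset.sum_filter]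
  have hs := Finset.sum_subtype (F := Subtype.fintype _)
    (p := fun i : disc B L × (ι → Fin (c * m)) =>
    Quotient.out (i.1 : V ⧸ L) + box b (c * m) i.2 ∈ scale (c : ℚ) (B.dualSubmodule L))
    (Finset.univ.filter fun i : disc B L × (ι → Fin (c * m)) =>
    Quotient.out (i.1 : V ⧸ L) + box b (c * m) i.2 ∈ scale (c : ℚ) (B.dualSubmodule L)) (by simp)
    fun i => f (Quotient.out (i.1 : V ⧸ L) + box b (c * m) i.2)
  rw [hs, Nat.cast_mul, mul_pow, mul_inv]
  ring

theorem periodicOn_quad_div (m : ℕ) [NeZero m] :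
    PeriodicOn (B.dualSubmodule L) (scale (m : ℚ) L) fun x => expTwoPiI (B x x / 2 / m) := by
  rintro x hx _ ⟨y, hy, rfl⟩
  have hm : (m : ℚ) ≠ 0 := NeZero.ne _
  obtain ⟨k, hk⟩ := dual_bilin B L hx hy
  obtain ⟨j, hj⟩ := even_div_two B L hy
  refine expTwoPiI_congr (k + m * j) ?_
  change B (x + (m : ℚ) • y) (x + (m : ℚ) • y) / 2 / m = _
  rw [quad_add B L]
  simp only [map_smul, LinearMap.smul_apply, smul_eq_mul]
  push_cast
  rw [← hk, ← hj]
  field_simp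
  ring

theorem sign_rescale (L : Submodule ℤ V) [IsEvenLattice B L] (m : ℕ) [NeZero m] :
    (bPlus (rescale m B) : ℚ) - bMinus (rescale m B) = (bPlus B : ℚ) - bMinus B := by
  obtain ⟨w, hw, -⟩ := exists_orthogonal_basis_mem B L
  have hm : (0 : ℚ) < m := by exact_mod_cast Nat.pos_of_ne_zero (NeZero.ne m)
  rw [← sum_sign_eq B (bilin_comm B L) hw fun i => rfl,
    ← sum_sign_eq (rescale m B) (bilin_comm (rescale m B) L) (w := w) ?_ fun i => rfl]
  · refine Finset.sum_congr rfl fun i _ => ?_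
    simp [rescale, sign_mul, sign_pos hm]
  · intro i j hij
    have := hw hij
    simp only [Function.onFun] at this ⊢
    simp [rescale, this]

theorem bPlus_add_bMinus (L : Submodule ℤ V) [h : IsEvenLattice B L] :
    bPlus B + bMinus B = Module.finrank ℚ V := by
  have := h.lattice
  have := finiteDimensional_of_isLattice L
  have h1 := QuadraticForm.sigPos_add_sigNeg_add_radical
    (Q := LinearMap.BilinMap.toQuadraticMap B)
  have h2 : (LinearMap.BilinMap.toQuadraticMap B).radical = ⊥ := by
    refine (Submodule.eq_bot_iff _).2 fun x hx => h.nondegenerate.1 x fun y => ?_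
    have h3 := LinearMap.congr_fun (LinearMap.mem_ker.1
      (QuadraticMap.radical_le_ker_polarBilin hx)) y
    have h4 : B x y + B y x = 0 := by
      rw [← LinearMap.BilinMap.polar_toQuadraticMap]
      simpa using h3
    have := bilin_comm B L x y
    linarith
  rw [h2, finrank_bot, add_zero] at h1
  exact h1

/-- Milgram's formula for the rescaled lattice `L(m)`. -/
theorem dualMean_quad_div (m : ℕ) [NeZero m] :
    dualMean B b m (fun y => expTwoPiI (B y y / 2 / m)) =
      (Real.sqrt (Nat.card (disc B L)) : ℂ) / (Real.sqrt m : ℂ) ^ Fintype.card ι *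
        expTwoPiI (((bPlus B : ℚ) - bMinus B) / 8) := by
  have hm : (m : ℚ) ≠ 0 := NeZero.ne _
  have hmR : (0 : ℝ) < m := by exact_mod_cast Nat.pos_of_ne_zero (NeZero.ne m)
  -- Multiplication by m maps L(m)'/L onto L'/mL and turns q_m into q/m, so the sum is the Gauss sum
  -- of L(m). Counting L'/mL gives |A(m)| = |A| m^(dim L).
  have hD : scale (m : ℚ) ((rescale m B).dualSubmodule L) = B.dualSubmodule L := by
    ext x
    constructor
    · rintro ⟨y, hy, rfl⟩
      exact (mem_dual_rescale_iff B L m y).1 hy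
    · intro hx
      refine ⟨(m : ℚ)⁻¹ • x, (mem_dual_rescale_iff B L m _).2 ?_, ?_⟩
      · rwa [smul_inv_smul₀ hm]
      · exact smul_inv_smul₀ hm x
  have ht := (isTransversal_out (rescale m B) L (le_dual _ L)).scale hm
  rw [hD] at ht
  have hcard := ht.card_eq (isTransversal_out_add_box B b m)
  rw [dualMean_eq B b ht (periodicOn_quad_div B m)]
  have h1 : ∑ γ : disc (rescale m B) L, expTwoPiI
      (B ((m : ℚ) • Quotient.out (γ : V ⧸ L)) ((m : ℚ) • Quotient.out (γ : V ⧸ L)) / 2 / m) =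
      discGaussSum (rescale m B) L := by
    refine Finset.sum_congr rfl fun γ _ => ?_
    congr 1
    simp only [quadRep, rescale, map_smul, LinearMap.smul_apply, smul_eq_mul]
    field_simp
  rw [h1, discGaussSum_eq, sign_rescale B L, Nat.card_eq_fintype_card, hcard]
  simp only [Fintype.card_prod, Nat.card_eq_fintype_card]
  have h2 : Real.sqrt ((Fintype.card (disc B L) * m ^ Fintype.card ι : ℕ) : ℝ) =
      Real.sqrt (Fintype.card (disc B L)) * Real.sqrt m ^ Fintype.card ι := by
    push_cast
    rw [Real.sqrt_mul (by positivity)]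
    congr 1
    refine (Real.sqrt_eq_iff_mul_self_eq (by positivity) (by positivity)).2 ?_
    rw [← mul_pow, Real.mul_self_sqrt hmR.le]
  have h3 : (m : ℂ) = (Real.sqrt m : ℂ) * (Real.sqrt m : ℂ) := by
    rw [← Complex.ofReal_mul, Real.mul_self_sqrt hmR.le]
    simp
  have h4 : (Real.sqrt m : ℂ) ≠ 0 := by
    exact_mod_cast (Real.sqrt_pos.2 hmR).ne'
  have h5 : Fintype.card (ι → Fin m) = m ^ Fintype.card ι := by simp
  rw [h5, h2, h3, mul_pow]
  push_cast
  field_simp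

end

/-! ### The coefficients of the Weil representation -/

section

variable {V : Type*} [AddCommGroup V] [Module ℚ V] (B : LinearMap.BilinForm ℚ V)
  {L : Submodule ℤ V} [IsEvenLattice B L]
  {ι : Type*} [Fintype ι] [DecidableEq ι] (b : Module.Basis ι ℤ L)

/-- The coefficient at `(x, z)` of the Weil representation of a matrix with entries `a`, `c > 0`
and `d`, up to a factor depending on `c` only. -/
noncomputable def weilKernel (c : ℕ) (a d : ℤ) (x z : V) : ℂ :=
  latMean b c fun r =>
    expTwoPiI ((a * (B (x + r) (x + r) / 2) - B (x + r) z + d * (B z z / 2)) / c)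

theorem periodicOn_weilKernel (c : ℕ) [NeZero c] (a d : ℤ) {x z : V}
    (hx : x ∈ B.dualSubmodule L) (hz : z ∈ B.dualSubmodule L) :
    PeriodicOn L (scale (c : ℚ) L) fun r =>
      expTwoPiI ((a * (B (x + r) (x + r) / 2) - B (x + r) z + d * (B z z / 2)) / c) := by
  rintro r hr _ ⟨y, hy, rfl⟩
  have hc : (c : ℚ) ≠ 0 := NeZero.ne _
  obtain ⟨k, hk⟩ := dual_bilin B L (Submodule.add_mem _ hx (le_dual B L hr)) hy
  obtain ⟨j, hj⟩ := even_div_two B L hy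
  obtain ⟨i, hi⟩ := dual_bilin B L hz hy
  refine expTwoPiI_congr (a * (k + c * j) - i) ?_
  change (a * (B (x + (r + (c : ℚ) • y)) (x + (r + (c : ℚ) • y)) / 2) -
    B (x + (r + (c : ℚ) • y)) z + _) / (c : ℚ) = _
  rw [← add_assoc, quad_add B L, map_add B (x + r), LinearMap.add_apply]
  simp only [map_smul, LinearMap.smul_apply, smul_eq_mul]
  rw [bilin_comm B L y z]
  push_cast
  rw [← hk, ← hj, ← hi]
  field_simp
  ring

theorem weilKernel_mul (c m : ℕ) [NeZero c] [NeZero m] (a d : ℤ) {x z : V}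
    (hx : x ∈ B.dualSubmodule L) (hz : z ∈ B.dualSubmodule L) :
    weilKernel B b c a d x z = latMean b (c * m) fun r =>
      expTwoPiI ((a * (B (x + r) (x + r) / 2) - B (x + r) z + d * (B z z / 2)) / c) :=
  (latMean_mul b m (periodicOn_weilKernel B c a d hx hz)).symm

/-- A change of z by y in L is compensated by the shift r ↦ r + dy of the summation variable, since
ad ≡ 1 mod c. -/
theorem periodicOn_weilKernel_right (c : ℕ) [NeZero c] {a d : ℤ} (h : (c : ℤ) ∣ a * d - 1) {x : V}
    (hx : x ∈ B.dualSubmodule L) :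
    PeriodicOn (B.dualSubmodule L) L fun z => weilKernel B b c a d x z := by
  intro z hz y hy
  have hc : (c : ℚ) ≠ 0 := NeZero.ne _
  obtain ⟨s, hs⟩ := h
  have hsq : (a : ℚ) * d = 1 + c * s := by
    have : ((a * d - 1 : ℤ) : ℚ) = ((c * s : ℤ) : ℚ) := by rw [hs]
    push_cast at this
    linarith
  have hzy := Submodule.add_mem _ hz (le_dual B L hy)
  simp only [weilKernel]
  rw [← latMean_add b (periodicOn_weilKernel B c a d hx hzy) (intCast_smul_mem L d hy)]
  refine latMean_congr b fun r hr => ?_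
  obtain ⟨k, hk⟩ := dual_bilin B L (Submodule.add_mem _ hx (le_dual B L hr)) hy
  obtain ⟨j, hj⟩ := even_div_two B L hy
  refine expTwoPiI_congr (s * k + d * s * j) ?_
  rw [← add_assoc, quad_add B L (x + r), quad_add B L z, map_add B (x + r), LinearMap.add_apply]
  simp only [map_add, map_smul, LinearMap.smul_apply, smul_eq_mul]
  have h1 := bilin_comm B L y z
  rw [map_add, LinearMap.add_apply] at hk
  simp only [LinearMap.add_apply]
  push_cast
  rw [← hk, ← hj, h1]
  field_simp
  linear_combination (B x y + B r y + B y y / 2 * d) * 2 * hsq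

/-- This is the product (a₁ b₁; c₁ c) · S = (b₁ -a₁; c -c₁) at the level of kernels. After
completing the square, the sum over L'/cc₁L is supported on cL', where it becomes the sum over γ on
the right. -/
theorem dualMean_mul_weilKernel (c c₁ : ℕ) [NeZero c] [NeZero c₁] {a₁ b₁ : ℤ}
    (h : a₁ * c - b₁ * c₁ = 1) {x z : V} (hx : x ∈ B.dualSubmodule L)
    (hz : z ∈ B.dualSubmodule L) :
    dualMean B b (c * c₁) (fun y => expTwoPiI (B y y / 2 / (c * c₁ : ℕ))) *
        weilKernel B b c b₁ (-c₁) x z =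
      ((c : ℂ) ^ Fintype.card ι)⁻¹ * ∑ γ : disc B L,
        weilKernel B b c₁ a₁ c x (Quotient.out (γ : V ⧸ L)) *
          expTwoPiI (-B (Quotient.out (γ : V ⧸ L)) z) := by
  classical
  have hc : (c : ℚ) ≠ 0 := NeZero.ne _
  have hc₁ : (c₁ : ℚ) ≠ 0 := NeZero.ne _
  have hq : (a₁ : ℚ) * c - b₁ * c₁ = 1 := by exact_mod_cast h
  have hz₁ : (c₁ : ℚ) • z ∈ B.dualSubmodule L := natCast_smul_mem _ c₁ hz
  let F : V → V → ℚ := fun t y =>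
    a₁ * (B (x + t) (x + t) / 2) / c₁ + B y y / 2 / (c * c₁) - B y (x + t) / (c * c₁) - B y z / c
  let H : V → ℂ := fun y => latMean b (c * c₁) fun t => expTwoPiI (F t y)
  have hFt : ∀ y ∈ B.dualSubmodule L,
      PeriodicOn L (scale ((c * c₁ : ℕ) : ℚ) L) fun t => expTwoPiI (F t y) := by
    rintro y hy t ht _ ⟨l, hl, rfl⟩
    obtain ⟨k, hk⟩ := dual_bilin B L (Submodule.add_mem _ hx (le_dual B L ht)) hl
    obtain ⟨j, hj⟩ := even_div_two B L hl
    obtain ⟨i, hi⟩ := dual_bilin B L hy hl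
    refine expTwoPiI_congr (a₁ * c * k + a₁ * c * c * c₁ * j - i) ?_
    change F (t + ((c * c₁ : ℕ) : ℚ) • l) y = _
    simp only [F]
    rw [← add_assoc, quad_add B L]
    simp only [map_add, map_smul, LinearMap.smul_apply, smul_eq_mul]
    push_cast
    rw [← hk, ← hj, ← hi, map_add, LinearMap.add_apply]
    field_simp
    ring
  have h1 : dualMean B b (c * c₁) (fun y => expTwoPiI (B y y / 2 / (c * c₁ : ℕ))) *
      weilKernel B b c b₁ (-c₁) x z = dualMean B b (c * c₁) H := by
    rw [weilKernel_mul B b c c₁ b₁ (-c₁) hx hz, mul_comm, ← latMean_mul_right]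
    simp only [H]
    rw [← latMean_dualMean_comm]
    refine latMean_congr b fun t ht => ?_
    have hp : x + t + (c₁ : ℚ) • z ∈ B.dualSubmodule L :=
      Submodule.add_mem _ (Submodule.add_mem _ hx (le_dual B L ht)) hz₁
    -- Replacing y by y - (x + t + c₁z) cancels the terms (x + t, z)/c and c₁q(z)/c. Because 1 +
    -- b₁c₁ = a₁c, the coefficient of q(x + t) becomes a₁/c₁.
    rw [← dualMean_sub B b (periodicOn_quad_div B (c * c₁)) hp, ← dualMean_mul_left]
    refine dualMean_congr B b fun y hy => ?_
    rw [← expTwoPiI_add]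
    congr 1
    simp only [F]
    have e1 := bilin_comm B L x y
    have e2 := bilin_comm B L t y
    have e3 := bilin_comm B L z y
    have e4 := bilin_comm B L z x
    have e5 := bilin_comm B L z t
    have e6 := bilin_comm B L t x
    simp only [map_add, map_sub, map_smul, LinearMap.smul_apply, LinearMap.add_apply,
      LinearMap.sub_apply, smul_eq_mul, e1, e2, e3, e4, e5, e6]
    push_cast
    field_simp
    linear_combination (-(B x x + 2 * B x t + B t t)) * hq
  -- The shift t ↦ t + c₁v multiplies the summand by e(-(y/c, v)). Averaging over v in L/cL
  -- annihilates H y unless y/c lies in L'.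
  have hH0 : ∀ y ∈ B.dualSubmodule L, y ∉ scale (c : ℚ) (B.dualSubmodule L) → H y = 0 := by
    intro y hy hyc
    have h2 : ∀ v ∈ L, H y = latMean b (c * c₁) fun t =>
        expTwoPiI (F t y) * expTwoPiI (-B ((c : ℚ)⁻¹ • y) v) := by
      intro v hv
      simp only [H]
      rw [← latMean_add b (hFt y hy) (natCast_smul_mem L c₁ hv)]
      refine latMean_congr b fun t ht => ?_
      rw [← expTwoPiI_add]
      obtain ⟨k, hk⟩ := dual_bilin B L (Submodule.add_mem _ hx (le_dual B L ht)) hv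
      obtain ⟨j, hj⟩ := even_div_two B L hv
      refine expTwoPiI_congr (a₁ * k + a₁ * c₁ * j) ?_
      simp only [F]
      rw [← add_assoc, quad_add B L]
      simp only [map_add, map_smul, LinearMap.smul_apply, smul_eq_mul]
      push_cast
      rw [← hk, ← hj, map_add, LinearMap.add_apply]
      field_simp
      ring
    have h3 : H y = latMean b c fun v => latMean b (c * c₁) fun t =>
        expTwoPiI (F t y) * expTwoPiI (-B ((c : ℚ)⁻¹ • y) v) := by
      rw [← latMean_congr b h2, latMean_const]
    rw [h3, latMean_comm]
    have h4 : latMean b c (fun v => expTwoPiI (-B ((c : ℚ)⁻¹ • y) v)) = 0 := by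
      rw [latMean_char B L b c _ (by rwa [smul_inv_smul₀ hc]), if_neg]
      intro h5
      exact hyc ⟨_, h5, smul_inv_smul₀ hc y⟩
    simp only [latMean_mul_left, h4, mul_zero]
    exact latMean_const b (c * c₁) 0
  have hHp : PeriodicOn (B.dualSubmodule L) (scale ((c * c₁ : ℕ) : ℚ) L) H := by
    rintro y hy _ ⟨l, hl, rfl⟩
    refine latMean_congr b fun t ht => ?_
    obtain ⟨k, hk⟩ := dual_bilin B L (Submodule.add_mem _ hx (le_dual B L ht)) hl
    obtain ⟨j, hj⟩ := even_div_two B L hl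
    obtain ⟨i, hi⟩ := dual_bilin B L hy hl
    obtain ⟨i', hi'⟩ := dual_bilin B L hz hl
    refine expTwoPiI_congr (i + c * c₁ * j - k - c₁ * i') ?_
    change F t (y + ((c * c₁ : ℕ) : ℚ) • l) = _
    simp only [F]
    rw [quad_add B L]
    simp only [map_add, map_smul, LinearMap.smul_apply, smul_eq_mul, LinearMap.add_apply]
    rw [bilin_comm B L l z, bilin_comm B L l x, bilin_comm B L l t,
      bilin_comm B L l y]
    push_cast
    rw [← hk, ← hj, ← hi, ← hi', map_add, LinearMap.add_apply]
    field_simp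
    ring
  have hzc : PeriodicOn (B.dualSubmodule L) L fun y =>
      weilKernel B b c₁ a₁ c x y * expTwoPiI (-B y z) := by
    intro y hy l hl
    have h5 := periodicOn_weilKernel_right B b c₁ (a := a₁) (d := c) ⟨b₁, by linarith⟩ hx y hy l hl
    simp only at h5 ⊢
    rw [h5]
    congr 1
    obtain ⟨i, hi⟩ := dual_bilin B L hz hl
    refine expTwoPiI_congr (-i) ?_
    rw [map_add, LinearMap.add_apply, bilin_comm B L l z, hi]
    push_cast
    ring
  rw [h1, dualMean_congr B b (g := fun y => if y ∈ scale (c : ℚ) (B.dualSubmodule L) then H y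
    else 0), dualMean_ite_mem_scale B b c c₁ hHp, ← dualMean_of_periodicOn B b c₁ hzc]
  · congr 1
    refine dualMean_congr B b fun y hy => ?_
    rw [weilKernel_mul B b c₁ c a₁ c hx hy, ← latMean_mul_right, mul_comm c₁ c]
    refine latMean_congr b fun t ht => ?_
    rw [← expTwoPiI_add]
    congr 1
    simp only [F, map_smul, LinearMap.smul_apply, smul_eq_mul]
    rw [bilin_comm B L (x + t) y]
    push_cast
    field_simp
    ring
  · intro y hy
    split_ifs with h6
    · rfl
    · exact hH0 y hy h6

end

/-! ### Automorphy factors -/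

/-- `φ^κ · conj(φ)^κ'` for the principal root `φ = √z`. -/
noncomputable def autFactor (κ κ' : ℤ) (z : ℂ) : ℂ :=
  (z ^ (1 / 2 : ℂ)) ^ κ * conj (z ^ (1 / 2 : ℂ)) ^ κ'

/-- Both arguments lie in [0, π], so their sum is at most 2π. Positivity of Im(uz) forces it below
π, and there the principal logarithm is additive. -/
theorem sqrt_mul_of_im_pos {u z : ℂ} (hu : 0 ≤ u.arg) (hu0 : u ≠ 0) (hz : 0 < z.im)
    (huz : 0 < (u * z).im) :
    (u * z) ^ (1 / 2 : ℂ) = u ^ (1 / 2 : ℂ) * z ^ (1 / 2 : ℂ) := by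
  have hz0 : z ≠ 0 := by rintro rfl; simp at hz
  have h1 : (u * z).im = ‖u‖ * ‖z‖ * Real.sin (u.arg + z.arg) := by
    rw [Real.sin_add, Complex.mul_im]
    nth_rewrite 1 [← Complex.norm_mul_cos_arg u]
    nth_rewrite 1 [← Complex.norm_mul_sin_arg u]
    nth_rewrite 1 [← Complex.norm_mul_cos_arg z]
    nth_rewrite 1 [← Complex.norm_mul_sin_arg z]
    ring
  have h2 : 0 < Real.sin (u.arg + z.arg) := by
    rw [h1] at huz
    exact pos_of_mul_pos_right huz (by positivity)
  have h3 : 0 ≤ z.arg := Complex.arg_nonneg_iff.2 hz.le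
  have h4 : u.arg + z.arg ∈ Set.Ioc (-Real.pi) Real.pi := by
    refine ⟨by linarith [Real.pi_pos], ?_⟩
    by_contra! h5
    have h6 : Real.sin (u.arg + z.arg) ≤ 0 := by
      have h7 := Real.sin_nonneg_of_nonneg_of_le_pi (x := u.arg + z.arg - Real.pi) (by linarith)
        (by linarith [Complex.arg_le_pi u, Complex.arg_le_pi z])
      rw [Real.sin_sub_pi] at h7
      linarith
    linarith
  rw [Complex.cpow_def_of_ne_zero (mul_ne_zero hu0 hz0), Complex.cpow_def_of_ne_zero hu0,
    Complex.cpow_def_of_ne_zero hz0, Complex.log_mul hu0 hz0 h4, add_mul, Complex.exp_add]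

theorem autFactor_mul (κ κ' : ℤ) {u z : ℂ} (hu : 0 ≤ u.arg) (hu0 : u ≠ 0) (hz : 0 < z.im)
    (huz : 0 < (u * z).im) :
    autFactor κ κ' (u * z) = autFactor κ κ' u * autFactor κ κ' z := by
  unfold autFactor
  rw [sqrt_mul_of_im_pos hu hu0 hz huz, map_mul, mul_zpow, mul_zpow]
  ring

theorem autFactor_ofReal (κ κ' : ℤ) {r : ℝ} (hr : 0 < r) :
    autFactor κ κ' (r : ℂ) = ((r ^ ((κ + κ' : ℝ) / 2) : ℝ) : ℂ) := by
  have h1 : (r : ℂ) ^ (1 / 2 : ℂ) = ((r ^ (1 / 2 : ℝ) : ℝ) : ℂ) := by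
    rw [Complex.ofReal_cpow hr.le]
    push_cast
    rfl
  have h2 : (0 : ℝ) < r ^ (1 / 2 : ℝ) := by positivity
  rw [autFactor, h1, Complex.conj_ofReal, ← zpow_add₀ (by exact_mod_cast h2.ne'),
    ← Complex.ofReal_zpow, ← Real.rpow_intCast, ← Real.rpow_mul hr.le]
  congr 2
  push_cast
  ring

theorem autFactor_ofReal_mul (κ κ' : ℤ) {r : ℝ} (hr : 0 < r) {z : ℂ} (hz : 0 < z.im) :
    autFactor κ κ' (r * z) = ((r ^ ((κ + κ' : ℝ) / 2) : ℝ) : ℂ) * autFactor κ κ' z := by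
  rw [autFactor_mul κ κ' (by rw [Complex.arg_ofReal_of_nonneg hr.le]) (by exact_mod_cast hr.ne') hz
    (by rw [Complex.im_ofReal_mul]; positivity), autFactor_ofReal κ κ' hr]

/-! ### Generators -/

section

variable {V : Type*} [AddCommGroup V] [Module ℚ V] {B : LinearMap.BilinForm ℚ V}
  {L : Submodule ℤ V} [IsEvenLattice B L] {κ κ' : ℤ} {ψ : ℍ → (disc B L → ℂ)}

variable (B L) in
/-- The constant in the definition of `ρ_L(S)`. -/
noncomputable def weilConst : ℂ :=
  expTwoPiI (-((bPlus B : ℚ) - (bMinus B : ℚ)) / 8) / (Real.sqrt (Nat.card (disc B L)) : ℂ)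

theorem IsVVModular.apply_T (hψ : IsVVModular B L κ κ' ψ) (τ : ℍ) (γ : disc B L) :
    ψ (ModularGroup.T • τ) γ = expTwoPiI (quadRep B L γ) * ψ τ γ := by
  classical
  have h := congrFun (hψ.transform Mp2Z.T (weilT B L) (Submonoid.subset_closure (by simp)) τ) γ
  simpa [Mp2Z.T, weilT, Matrix.mulVec_diagonal] using h

theorem IsVVModular.apply_S (hψ : IsVVModular B L κ κ' ψ) (τ : ℍ) (γ : disc B L) :
    ψ (ModularGroup.S • τ) γ = autFactor κ κ' τ *
      (weilConst B L * ∑ δ : disc B L, expTwoPiI (-bilinRep B L δ γ) * ψ τ δ) := by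
  classical
  have h := congrFun (hψ.transform Mp2Z.S (weilS B L) (Submonoid.subset_closure (by simp)) τ) γ
  refine h.trans ?_
  simp only [Mp2Z.S, weilS, autFactor, weilConst, Pi.smul_apply, smul_eq_mul, Matrix.mulVec,
    dotProduct, Matrix.of_apply, Finset.mul_sum, mul_assoc]

/-- The transformation law is stable under products of pairs (g, R), by the cocycle rule for φ. It
therefore passes from the two generators to the whole of `weilGraph`. -/
theorem isVVModular_of_generators
    (hA : ∀ γ, AnalyticOnNhd ℝ (fun z : ℂ => ψ (ofComplex z) γ) {z : ℂ | 0 < z.im})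
    (hT : ∀ (τ : ℍ) (γ : disc B L),
      ψ (ModularGroup.T • τ) γ = expTwoPiI (quadRep B L γ) * ψ τ γ)
    (hS : ∀ (τ : ℍ) (γ : disc B L), ψ (ModularGroup.S • τ) γ = autFactor κ κ' τ *
      (weilConst B L * ∑ δ : disc B L, expTwoPiI (-bilinRep B L δ γ) * ψ τ δ)) :
    IsVVModular B L κ κ' ψ := by
  classical
  refine ⟨hA, fun g R hgR => ?_⟩
  have key : ∀ p ∈ weilGraph B L, ∀ τ : ℍ,
      ψ (p.1.mat • τ) = (p.1.phi τ ^ κ * conj (p.1.phi τ) ^ κ') • p.2.mulVec (ψ τ) := by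
    intro p hp
    induction hp using Submonoid.closure_induction with
    | mem p hp =>
      intro τ
      rcases hp with rfl | rfl
      · funext γ
        simpa [Mp2Z.T, weilT, Matrix.mulVec_diagonal] using hT τ γ
      · funext γ
        refine (hS τ γ).trans ?_
        simp only [Mp2Z.S, weilS, autFactor, weilConst, Pi.smul_apply, smul_eq_mul, Matrix.mulVec,
          dotProduct, Matrix.of_apply, Finset.mul_sum, mul_assoc]
    | one => intro τ; simp
    | mul p q _ _ h1 h2 =>
      intro τ
      rw [Prod.fst_mul, Prod.snd_mul, Mp2Z.mul_mat, Mp2Z.mul_phi, mul_smul, h1, h2,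
        Matrix.mulVec_smul, Matrix.mulVec_mulVec, smul_smul, map_mul, mul_zpow, mul_zpow]
      congr 1
      ring
  exact key (g, R) hgR

/-- The components of a `ℂ[A]`-valued function, as functions on `ℂ × V`. -/
noncomputable def extension (ψ : ℍ → (disc B L → ℂ)) (z : ℂ) (x : V) : ℂ :=
  component (ψ (ofComplex z)) (L.mkQ x)

theorem extension_eq_zero (z : ℂ) {x : V} (hx : x ∉ B.dualSubmodule L) :
    extension ψ z x = 0 :=
  dif_neg fun h => hx ((mk_mem_disc_iff B L x).1 h)

theorem extension_of_mem (z : ℂ) {x : V} (hx : x ∈ B.dualSubmodule L) :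
    extension ψ z x = ψ (ofComplex z) ⟨L.mkQ x, (mk_mem_disc_iff B L x).2 hx⟩ :=
  dif_pos _

theorem extension_out (z : ℂ) (γ : disc B L) :
    extension ψ z (Quotient.out (γ : V ⧸ L)) = ψ (ofComplex z) γ := by
  have h : L.mkQ (Quotient.out (γ : V ⧸ L)) = γ := Quotient.out_eq (γ : V ⧸ L)
  rw [extension, h]
  exact dif_pos γ.2

theorem extension_add (z : ℂ) (x : V) {l : V} (hl : l ∈ L) :
    extension ψ z (x + l) = extension ψ z x := by
  have h : L.mkQ (x + l) = L.mkQ x := by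
    rw [map_add, (LinearMap.mem_ker.1 (by rwa [Submodule.ker_mkQ]) : L.mkQ l = 0), add_zero]
  rw [extension, h, extension]

theorem mkQ_out (γ : V ⧸ L) : L.mkQ (Quotient.out γ) = γ := Quotient.out_eq γ

theorem expTwoPiI_bilinRep {x : V} (δ : disc B L) (hx : x ∈ B.dualSubmodule L) :
    expTwoPiI (-bilinRep B L δ (L.mkQ x)) = expTwoPiI (-B (Quotient.out (δ : V ⧸ L)) x) := by
  obtain ⟨m, hm⟩ := bilinRep_mk B L (Quotient.out (δ : V ⧸ L)) x
    (by rw [mkQ_out]; exact δ.2) ((mk_mem_disc_iff B L x).2 hx)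
  rw [mkQ_out] at hm
  exact expTwoPiI_congr (-m) (by rw [hm]; push_cast; ring)

theorem expTwoPiI_quadRep {x : V} (hx : x ∈ B.dualSubmodule L) :
    expTwoPiI (quadRep B L (L.mkQ x)) = expTwoPiI (B x x / 2) := by
  obtain ⟨m, hm⟩ := quadRep_mk B L x ((mk_mem_disc_iff B L x).2 hx)
  exact expTwoPiI_congr m hm

theorem IsVVModular.extension_add_one (hψ : IsVVModular B L κ κ' ψ) {z : ℂ} (hz : 0 < z.im)
    (x : V) : extension ψ (z + 1) x = expTwoPiI (B x x / 2) * extension ψ z x := by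
  by_cases hx : x ∈ B.dualSubmodule L
  · have h := hψ.apply_T ⟨z, hz⟩ ⟨L.mkQ x, (mk_mem_disc_iff B L x).2 hx⟩
    rw [expTwoPiI_quadRep hx] at h
    rw [extension_of_mem _ hx, extension_of_mem _ hx, ofComplex_apply_of_im_pos hz, ← h]
    congr 1
    rw [UpperHalfPlane.modular_T_smul]
    ext
    rw [ofComplex_apply_of_im_pos (by simpa using hz)]
    simp [add_comm]
  · rw [extension_eq_zero _ hx, extension_eq_zero _ hx, mul_zero]

theorem IsVVModular.extension_add_int (hψ : IsVVModular B L κ κ' ψ) {z : ℂ} (hz : 0 < z.im) (x : V)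
    (j : ℤ) : extension ψ (z + j) x = expTwoPiI (j * (B x x / 2)) * extension ψ z x := by
  have hz' : ∀ k : ℤ, 0 < (z + k).im := fun k => by simpa using hz
  induction j using Int.induction_on with
  | zero => simp
  | succ k ih =>
    have h := hψ.extension_add_one (hz' k) x
    rw [ih] at h
    push_cast at h ⊢
    rw [← add_assoc, h, ← mul_assoc, ← expTwoPiI_add]
    congr 2
    ring
  | pred k ih =>
    have h := hψ.extension_add_one (hz' (-k - 1)) x
    rw [show z + ((-(k : ℤ) - 1 : ℤ) : ℂ) + 1 = z + ((-(k : ℤ) : ℤ) : ℂ) by push_cast; ring,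
      ih] at h
    have h2 : expTwoPiI (((-(k : ℤ) - 1 : ℤ) : ℚ) * (B x x / 2)) =
        expTwoPiI (((-(k : ℤ) : ℤ) : ℚ) * (B x x / 2)) * (expTwoPiI (B x x / 2))⁻¹ := by
      rw [← expTwoPiI_neg, ← expTwoPiI_add]
      congr 1
      push_cast
      ring
    rw [h2, mul_right_comm, h, mul_comm, inv_mul_cancel_left₀ (expTwoPiI_ne_zero _)]

theorem IsVVModular.extension_neg_inv (hψ : IsVVModular B L κ κ' ψ) {z : ℂ} (hz : 0 < z.im)
    {x : V} (hx : x ∈ B.dualSubmodule L) :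
    extension ψ (-1 / z) x = autFactor κ κ' z * (weilConst B L * ∑ γ : disc B L,
      expTwoPiI (-B (Quotient.out (γ : V ⧸ L)) x) *
        extension ψ z (Quotient.out (γ : V ⧸ L))) := by
  have h := hψ.apply_S ⟨z, hz⟩ ⟨L.mkQ x, (mk_mem_disc_iff B L x).2 hx⟩
  rw [UpperHalfPlane.modular_S_smul] at h
  have hz' : 0 < (-1 / z).im := by
    have := UpperHalfPlane.im_inv_neg_coe_pos ⟨z, hz⟩
    rw [neg_div, one_div, ← inv_neg]
    exact this
  have h1 : ofComplex (-1 / z) =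
      UpperHalfPlane.mk (-z)⁻¹ (UpperHalfPlane.im_inv_neg_coe_pos ⟨z, hz⟩) := by
    rw [ofComplex_apply_of_im_pos hz']
    ext
    simp [neg_div, inv_neg]
  rw [extension_of_mem _ hx, h1]
  refine h.trans ?_
  congr 2
  refine Finset.sum_congr rfl fun γ _ => ?_
  rw [expTwoPiI_bilinRep γ hx, extension_out, ofComplex_apply_of_im_pos hz]

end

/-! ### The action of a general matrix with positive lower left entry -/

section

variable {V : Type*} [AddCommGroup V] [Module ℚ V] {B : LinearMap.BilinForm ℚ V}
  {L : Submodule ℤ V} [IsEvenLattice B L] {κ κ' : ℤ} {ψ : ℍ → (disc B L → ℂ)}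
  {ι : Type*} [Fintype ι] [DecidableEq ι] (b : Module.Basis ι ℤ L)

theorem im_neg_one_div_pos {z : ℂ} (hz : 0 < z.im) : 0 < (-1 / z).im := by
  have := UpperHalfPlane.im_inv_neg_coe_pos ⟨z, hz⟩
  rwa [neg_div, one_div, ← inv_neg]

theorem natCast_mul_add_im_pos {c : ℕ} (hc : 0 < c) (d : ℤ) {z : ℂ} (hz : 0 < z.im) :
    0 < ((c : ℂ) * z + d).im := by
  have : (0 : ℝ) < c := by exact_mod_cast hc
  simpa using mul_pos this hz

theorem ne_zero_of_im_pos {z : ℂ} (hz : 0 < z.im) : z ≠ 0 := by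
  rintro rfl
  simp at hz

theorem weilKernel_add_mul (c : ℕ) [NeZero c] (a d j : ℤ) (x y : V) :
    weilKernel B b c a (d + j * c) x y =
      weilKernel B b c a d x y * expTwoPiI (j * (B y y / 2)) := by
  have hc : (c : ℚ) ≠ 0 := NeZero.ne _
  rw [weilKernel, weilKernel, ← latMean_mul_right]
  refine latMean_congr b fun r _ => ?_
  rw [← expTwoPiI_add]
  congr 1
  push_cast
  field_simp
  ring

theorem weilKernel_one (a d : ℤ) {x y : V} (hx : x ∈ B.dualSubmodule L)
    (hy : y ∈ B.dualSubmodule L) :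
    weilKernel B b 1 a d x y =
      expTwoPiI (a * (B x x / 2)) * expTwoPiI (-B y x) * expTwoPiI (d * (B y y / 2)) := by
  have hp := periodicOn_weilKernel B 1 a d hx hy
  rw [Nat.cast_one, scale_one] at hp
  rw [weilKernel, latMean_congr b (g := fun _ => expTwoPiI (a * (B x x / 2)) *
    expTwoPiI (-B y x) * expTwoPiI (d * (B y y / 2))), latMean_const]
  intro r hr
  have h := hp 0 L.zero_mem r hr
  rw [Nat.cast_one]
  simp only [zero_add, add_zero] at h
  rw [h, ← expTwoPiI_add, ← expTwoPiI_add, bilin_comm B L x y]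
  congr 1
  ring

/-- The product of the normalized coefficients for `S` and for a matrix with entries `a₁`, `c₁`
and `c`. -/
theorem sum_weilKernel_mul (c c₁ : ℕ) [NeZero c] [NeZero c₁] {a₁ b₁ : ℤ}
    (h : a₁ * c - b₁ * c₁ = 1) {x z : V} (hx : x ∈ B.dualSubmodule L)
    (hz : z ∈ B.dualSubmodule L) :
    weilConst B L * (Real.sqrt c₁ : ℂ) ^ Fintype.card ι * ∑ γ : disc B L,
        weilKernel B b c₁ a₁ c x (Quotient.out (γ : V ⧸ L)) *
          expTwoPiI (-B (Quotient.out (γ : V ⧸ L)) z) =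
      (Real.sqrt c : ℂ) ^ Fintype.card ι * weilKernel B b c b₁ (-c₁) x z := by
  have hk := dualMean_mul_weilKernel B b c c₁ h hx hz
  have : NeZero (c * c₁) := ⟨mul_ne_zero (NeZero.ne c) (NeZero.ne c₁)⟩
  rw [dualMean_quad_div] at hk
  have hcR : (0 : ℝ) < c := by exact_mod_cast Nat.pos_of_ne_zero (NeZero.ne c)
  have hcR₁ : (0 : ℝ) < c₁ := by exact_mod_cast Nat.pos_of_ne_zero (NeZero.ne c₁)
  have h1 : (Real.sqrt c : ℂ) ≠ 0 := by exact_mod_cast (Real.sqrt_pos.2 hcR).ne'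
  have h2 : (Real.sqrt c₁ : ℂ) ≠ 0 := by exact_mod_cast (Real.sqrt_pos.2 hcR₁).ne'
  have hA : (0 : ℝ) < Nat.card (disc B L) := by exact_mod_cast Nat.card_pos
  have h3 : (Real.sqrt (Nat.card (disc B L)) : ℂ) ≠ 0 := by
    exact_mod_cast (Real.sqrt_pos.2 hA).ne'
  have h4 : (c : ℂ) = (Real.sqrt c : ℂ) * (Real.sqrt c : ℂ) := by
    rw [← Complex.ofReal_mul, Real.mul_self_sqrt hcR.le]
    simp
  have h5 : ((Real.sqrt (c * c₁ : ℕ) : ℝ) : ℂ) = (Real.sqrt c : ℂ) * (Real.sqrt c₁ : ℂ) := by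
    rw [Nat.cast_mul, Real.sqrt_mul hcR.le, Complex.ofReal_mul]
  have h6 : expTwoPiI (-((bPlus B : ℚ) - bMinus B) / 8) *
      expTwoPiI (((bPlus B : ℚ) - bMinus B) / 8) = 1 := by
    rw [← expTwoPiI_add, ← expTwoPiI_zero]
    congr 1
    ring
  rw [h5] at hk
  conv_rhs at hk => rw [h4]
  rw [mul_pow, mul_pow] at hk
  set s := (Real.sqrt c : ℂ) ^ Fintype.card ι
  set s₁ := (Real.sqrt c₁ : ℂ) ^ Fintype.card ι
  have hs : s ≠ 0 := pow_ne_zero _ h1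
  have hs₁ : s₁ ≠ 0 := pow_ne_zero _ h2
  rw [weilConst]
  set S := ∑ γ : disc B L, weilKernel B b c₁ a₁ c x (Quotient.out (γ : V ⧸ L)) *
          expTwoPiI (-B (Quotient.out (γ : V ⧸ L)) z)
  set e₁ := expTwoPiI (-((bPlus B : ℚ) - bMinus B) / 8)
  set e₂ := expTwoPiI (((bPlus B : ℚ) - bMinus B) / 8)
  set K := weilKernel B b c b₁ (-c₁) x z
  field_simp at hk ⊢
  linear_combination (-e₁) * hk + (Real.sqrt (Nat.card (disc B L)) : ℂ) * s * K * h6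

/-- The action of a matrix `(a b; c d)` with `c > 0` on the components of a modular form. -/
theorem IsVVModular.extension_moebius (hψ : IsVVModular B L κ κ' ψ) {c : ℕ} (hc : 0 < c)
    (a b₀ d : ℤ) (hdet : a * d - b₀ * c = 1) {z : ℂ} (hz : 0 < z.im) {x : V}
    (hx : x ∈ B.dualSubmodule L) :
    extension ψ ((a * z + b₀) / (c * z + d)) x =
      autFactor κ κ' (c * z + d) * (weilConst B L * (Real.sqrt c : ℂ) ^ Fintype.card ι *
        ∑ γ : disc B L, weilKernel B b c a d x (Quotient.out (γ : V ⧸ L)) *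
          extension ψ z (Quotient.out (γ : V ⧸ L))) := by
  induction c using Nat.strong_induction_on generalizing a b₀ d z x with
  | _ c ih =>
  have hmem : ∀ γ : disc B L, Quotient.out (γ : V ⧸ L) ∈ B.dualSubmodule L :=
    (isTransversal_out B L (le_dual B L)).mem
  rcases Nat.lt_or_ge 1 c with hc1 | hc1
  · have : NeZero c := ⟨hc.ne'⟩
    have hcZ : (0 : ℤ) < c := by exact_mod_cast hc
    have hmod0 : d % c ≠ 0 := by
      intro h0
      obtain ⟨k, hk⟩ := Int.dvd_of_emod_eq_zero h0
      have : (c : ℤ) ∣ 1 := ⟨a * k - b₀, by rw [← hdet, hk]; ring⟩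
      have := Int.le_of_dvd one_pos this
      omega
    have hmod1 := Int.emod_nonneg d hcZ.ne'
    have hmod2 := Int.emod_lt_of_pos d hcZ
    -- Euclidean step with d = -c₁ + jc and 0 < c₁ < c, which gives (a b₀; c d) = (aj-b₀ a; c₁ c) ·
    -- S · T^j. Taking the negative remainder keeps the lower left entry positive, so all automorphy
    -- factors come from principal roots of points of ℍ.
    obtain ⟨c₁, hc₁⟩ : ∃ c₁ : ℕ, (c₁ : ℤ) = c - d % c := ⟨(c - d % c).toNat, by omega⟩
    have hc₁0 : 0 < c₁ := by omega
    have : NeZero c₁ := ⟨hc₁0.ne'⟩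
    set j : ℤ := d / c + 1 with hj
    have hd : d = -c₁ + j * c := by
      have := Int.emod_add_mul_ediv d c
      rw [hj, hc₁]
      linarith
    have hdet₁ : (-(b₀ - a * j)) * c - a * c₁ = 1 := by
      rw [← hdet, hd]
      ring
    have hz' : 0 < (z + j).im := by simpa using hz
    set w : ℂ := -1 / (z + j) with hw
    have hw0 : 0 < w.im := im_neg_one_div_pos hz'
    have hzj : z + j ≠ 0 := ne_zero_of_im_pos hz'
    have hD := natCast_mul_add_im_pos hc d hz
    have hD0 := ne_zero_of_im_pos hD
    have hprod : ((c₁ : ℂ) * w + (c : ℤ)) * (z + j) = c * z + d := by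
      rw [hw, hd]
      push_cast
      field_simp
      ring
    have hD₁ := natCast_mul_add_im_pos hc₁0 c hw0
    have hpt : ((a : ℂ) * z + b₀) / (c * z + d) =
        (((-(b₀ - a * j) : ℤ) : ℂ) * w + a) / (c₁ * w + (c : ℤ)) := by
      rw [div_eq_div_iff hD0 (ne_zero_of_im_pos hD₁), ← hprod, hw]
      push_cast
      field_simp
      ring
    have hI := ih c₁ (by omega) hc₁0 (-(b₀ - a * j)) a c hdet₁ hw0 hx
    rw [hpt, hI]
    have hw' : ∀ γ : disc B L, extension ψ w (Quotient.out (γ : V ⧸ L)) =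
        autFactor κ κ' (z + j) * (weilConst B L * ∑ δ : disc B L,
          expTwoPiI (-B (Quotient.out (γ : V ⧸ L)) (Quotient.out (δ : V ⧸ L))) *
            extension ψ (z + j) (Quotient.out (δ : V ⧸ L))) := by
      intro γ
      rw [hw, hψ.extension_neg_inv hz' (hmem γ)]
      congr 2
      refine Finset.sum_congr rfl fun δ _ => ?_
      rw [bilin_comm B L]
    have hcomp : ∑ γ : disc B L, weilKernel B b c₁ (-(b₀ - a * j)) c x (Quotient.out (γ : V ⧸ L)) *
        extension ψ w (Quotient.out (γ : V ⧸ L)) = autFactor κ κ' (z + j) * weilConst B L *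
        ∑ δ : disc B L, (∑ γ : disc B L,
          weilKernel B b c₁ (-(b₀ - a * j)) c x (Quotient.out (γ : V ⧸ L)) *
          expTwoPiI (-B (Quotient.out (γ : V ⧸ L)) (Quotient.out (δ : V ⧸ L)))) *
            extension ψ (z + j) (Quotient.out (δ : V ⧸ L)) := by
      simp only [hw', Finset.mul_sum, Finset.sum_mul]
      rw [Finset.sum_comm]
      refine Finset.sum_congr rfl fun δ _ => Finset.sum_congr rfl fun γ _ => ?_
      ring
    have hfac : autFactor κ κ' (c * z + d) =
        autFactor κ κ' (c₁ * w + (c : ℤ)) * autFactor κ κ' (z + j) := by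
      rw [← hprod]
      exact autFactor_mul κ κ' (Complex.arg_nonneg_iff.2 hD₁.le) (ne_zero_of_im_pos hD₁) hz'
        (by rwa [hprod])
    have hker : ∀ δ : disc B L,
        weilKernel B b c a d x (Quotient.out (δ : V ⧸ L)) *
          extension ψ z (Quotient.out (δ : V ⧸ L)) =
        weilKernel B b c a (-c₁) x (Quotient.out (δ : V ⧸ L)) *
          extension ψ (z + j) (Quotient.out (δ : V ⧸ L)) := by
      intro δ
      rw [hψ.extension_add_int hz, hd, weilKernel_add_mul]
      ring
    rw [hcomp, hfac, Finset.sum_congr rfl fun δ _ => hker δ]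
    -- Composing the kernel for c₁ with that of S gives the kernel for c with last entry -c₁. The
    -- power T^j was already absorbed in `hker`.
    have hS : ∀ δ : disc B L, _ := fun δ => sum_weilKernel_mul b c c₁ hdet₁ hx (hmem δ)
    simp only [Finset.mul_sum, mul_assoc] at hS ⊢
    refine Finset.sum_congr rfl fun δ _ => ?_
    have := hS δ
    rw [← mul_assoc ((Real.sqrt c : ℂ) ^ Fintype.card ι), ← this]
    simp only [Finset.mul_sum, Finset.sum_mul]
    refine Finset.sum_congr rfl fun γ _ => ?_
    ring
  -- Base case: the matrix is T^a · S · T^d.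
  · obtain rfl : c = 1 := by omega
    have hb₀ : b₀ = a * d - 1 := by push_cast at hdet; linarith
    have hz' : 0 < (z + d).im := by simpa using hz
    have hpt : ((a : ℂ) * z + b₀) / ((1 : ℕ) * z + d) = -1 / (z + d) + a := by
      have := ne_zero_of_im_pos hz'
      rw [hb₀]
      push_cast
      rw [one_mul]
      field_simp
      ring
    rw [hpt, hψ.extension_add_int (im_neg_one_div_pos hz'), hψ.extension_neg_inv hz' hx]
    simp only [Nat.cast_one, one_mul, Real.sqrt_one, Complex.ofReal_one, one_pow, mul_one,
      Finset.mul_sum]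
    refine Finset.sum_congr rfl fun γ _ => ?_
    rw [weilKernel_one b a d hx (hmem γ), hψ.extension_add_int hz]
    ring

end

/-! ### Sums over the dual lattice and rescaling -/

section

variable {V : Type*} [AddCommGroup V] [Module ℚ V] (B : LinearMap.BilinForm ℚ V)
  {L : Submodule ℤ V} [IsEvenLattice B L]
  {ι : Type*} [Fintype ι] [DecidableEq ι] (b : Module.Basis ι ℤ L)

theorem dualMean_mul {c : ℕ} [NeZero c] (m : ℕ) [NeZero m] {f : V → ℂ}
    (hf : PeriodicOn (B.dualSubmodule L) (scale (c : ℚ) L) f) :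
    dualMean B b (c * m) f = dualMean B b c f :=
  Finset.sum_congr rfl fun γ _ => latMean_mul b m fun x hx y hy => by
    rw [← add_assoc]
    exact hf _ (Submodule.add_mem _ ((isTransversal_out B L (le_dual B L)).mem γ)
      (le_dual B L hx)) y hy

theorem sum_subtype_eq_sum_ite {α : Type*} [Fintype α] {P : α → Prop} [DecidablePred P]
    [Fintype {i // P i}] (F : α → ℂ) :
    ∑ i : {i // P i}, F i = ∑ i, if P i then F i else 0 := by
  rw [← Finset.sum_filter]
  exact (Finset.sum_subtype (Finset.univ.filter P) (by simp) F).symm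

theorem mem_scale_iff {ρ : ℚ} (hρ : ρ ≠ 0) {M : Submodule ℤ V} {x : V} :
    x ∈ scale ρ M ↔ ρ⁻¹ • x ∈ M := by
  constructor
  · rintro ⟨y, hy, rfl⟩
    change ρ⁻¹ • ρ • y ∈ M
    rwa [inv_smul_smul₀ hρ]
  · exact fun h => ⟨_, h, smul_inv_smul₀ hρ x⟩

open scoped Classical in
/-- The substitution `y = ρ Y` for rational `ρ`. -/
theorem dualMean_ite_smul {ρ : ℚ} (hρ : ρ ≠ 0) {m m' : ℕ} [NeZero m] [NeZero m']
    (h : ρ * m = m') {f : V → ℂ}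
    (hf : PeriodicOn (B.dualSubmodule L) (scale (m' : ℚ) L)
      fun y => if ρ⁻¹ • y ∈ B.dualSubmodule L then f y else 0) :
    (m : ℂ) ^ Fintype.card ι *
        dualMean B b m (fun y => if ρ • y ∈ B.dualSubmodule L then f (ρ • y) else 0) =
      (m' : ℂ) ^ Fintype.card ι *
        dualMean B b m' (fun y => if ρ⁻¹ • y ∈ B.dualSubmodule L then f y else 0) := by
  set D := B.dualSubmodule L with hD
  have hm : (m : ℂ) ≠ 0 := NeZero.ne _
  have hm' : (m' : ℂ) ≠ 0 := NeZero.ne _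
  have hLD : ∀ c : ℕ, scale (c : ℚ) L ≤ D := fun c => (scale_natCast_le c L).trans (le_dual B L)
  have hN : scale ρ (scale (m : ℚ) L) = scale (m' : ℚ) L := by rw [← scale_mul, h]
  have hNρ : scale (m' : ℚ) L ≤ scale ρ D := hN ▸ scale_mono ρ (hLD m)
  have hf1 : PeriodicOn D (scale (m : ℚ) L) fun y => if ρ • y ∈ D then f (ρ • y) else 0 := by
    intro x hx y hy
    have hy' : ρ • y ∈ scale (m' : ℚ) L := hN ▸ smul_mem_scale hy
    simp only
    rw [smul_add]
    by_cases hx' : ρ • x ∈ D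
    · have h1 := hf _ hx' _ hy'
      simp only at h1
      rw [← smul_add, inv_smul_smul₀ hρ, inv_smul_smul₀ hρ, if_pos hx,
        if_pos (D.add_mem hx (hLD m hy)), smul_add] at h1
      rw [if_pos hx', if_pos (D.add_mem hx' (hLD m' hy')), h1]
    · rw [if_neg hx', if_neg fun h2 => hx' ?_]
      simpa using D.sub_mem h2 (hLD m' hy')
  have ht := isTransversal_out_add_box B b m
  have ht' := isTransversal_out_add_box B b m'
  rw [dualMean_eq B b ht hf1, dualMean_eq B b ht' hf, mul_inv_cancel_left₀ (pow_ne_zero _ hm),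
    mul_inv_cancel_left₀ (pow_ne_zero _ hm')]
  -- The conditional sums run over L' ∩ ρ⁻¹L' modulo mL and over L' ∩ ρL' modulo m'L. Multiplication
  -- by ρ identifies these two quotients.
  have hK : scale ρ (D ⊓ scale ρ⁻¹ D) = D ⊓ scale ρ D := by
    ext x
    rw [mem_scale_iff hρ, Submodule.mem_inf, Submodule.mem_inf, mem_scale_iff hρ,
      mem_scale_iff (inv_ne_zero hρ), inv_inv, smul_inv_smul₀ hρ, and_comm]
  have hmem : ∀ x ∈ scale (m : ℚ) L, x ∈ scale ρ⁻¹ D := fun x hx => by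
    rw [mem_scale_iff (inv_ne_zero hρ), inv_inv]
    exact hLD m' (hN ▸ smul_mem_scale hx)
  have hs := (ht.subtype (K := D ⊓ scale ρ⁻¹ D) inf_le_left
    (le_inf (hLD m) hmem)).scale hρ
  rw [hK, hN] at hs
  have hs' := ht'.subtype (K := D ⊓ scale ρ D) inf_le_left (le_inf (hLD m') hNρ)
  have hfK : PeriodicOn (D ⊓ scale ρ D) (scale (m' : ℚ) L) f := by
    rintro x ⟨hx, hx'⟩ y hy
    have h1 := hf x hx y hy
    have hx' := (mem_scale_iff hρ).1 hx'
    have hy' := (mem_scale_iff hρ).1 (hNρ hy)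
    simp only at h1
    rwa [if_pos hx', if_pos (by rw [smul_add]; exact D.add_mem hx' hy')] at h1
  have key := hs.sum_eq hs' hfK
  rw [sum_subtype_eq_sum_ite (fun i : disc B L × (ι → Fin m) =>
      f (ρ • (Quotient.out (i.1 : V ⧸ L) + box b m i.2))),
    sum_subtype_eq_sum_ite (fun i : disc B L × (ι → Fin m') =>
      f (Quotient.out (i.1 : V ⧸ L) + box b m' i.2))] at key
  refine (Finset.sum_congr rfl fun i _ => if_congr ?_ rfl rfl).trans
    (key.trans (Finset.sum_congr rfl fun i _ => if_congr ?_ rfl rfl))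
  · rw [Submodule.mem_inf, mem_scale_iff (inv_ne_zero hρ), inv_inv, and_iff_right (ht.mem i)]
  · rw [Submodule.mem_inf, mem_scale_iff hρ, and_iff_right (ht'.mem i)]

end

/-! ### The kernel identity -/

section

variable {V : Type*} [AddCommGroup V] [Module ℚ V] (B : LinearMap.BilinForm ℚ V)
  {L : Submodule ℤ V} [IsEvenLattice B L]
  {ι : Type*} [Fintype ι] [DecidableEq ι] (b : Module.Basis ι ℤ L)

/-- The substitution r ↦ -δr is allowed because δ is a unit modulo c, and aδ ≡ 1 then makes the
exponent depend only on y = γ + r. The sums over γ and r merge into one over L'/cL, and the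
quadratic dependence on x is confined to the prefactor. -/
theorem exp_mul_sum_weilKernel (c : ℕ) [NeZero c] {a δ : ℤ} (h : (c : ℤ) ∣ a * δ - 1) {x : V}
    (hx : x ∈ B.dualSubmodule L) {f : V → ℂ} (hf : PeriodicOn (B.dualSubmodule L) L f) :
    expTwoPiI (-(a * (B x x / 2)) / c) * ∑ γ : disc B L,
        weilKernel B b c a δ x (Quotient.out (γ : V ⧸ L)) * f (Quotient.out (γ : V ⧸ L)) =
      dualMean B b c fun y => expTwoPiI ((-B y x + δ * (B y y / 2)) / c) * f y := by
  have hc : (c : ℚ) ≠ 0 := NeZero.ne _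
  rw [dualMean, Finset.mul_sum]
  refine Finset.sum_congr rfl fun γ _ => ?_
  have hγ := (isTransversal_out B L (le_dual B L)).mem γ
  set z := Quotient.out (γ : V ⧸ L)
  rw [latMean_congr b (g := fun l =>
    expTwoPiI ((-B (z + l) x + δ * (B (z + l) (z + l) / 2)) / c) * f z)
    fun l hl => by rw [hf z hγ l hl], latMean_mul_right, ← mul_assoc]
  congr 1
  rw [weilKernel, ← latMean_unit_smul b (periodicOn_weilKernel B c a δ hx hγ) (a := -a) (δ := -δ)
    (by rwa [neg_mul_neg]), ← latMean_mul_left]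
  obtain ⟨s, hs⟩ := h
  have hsq : (a : ℚ) * δ = 1 + c * s := by
    have : ((a * δ - 1 : ℤ) : ℚ) = ((c * s : ℤ) : ℚ) := by rw [hs]
    push_cast at this
    linarith
  refine latMean_congr b fun l hl => ?_
  rw [← expTwoPiI_add]
  obtain ⟨k, hk⟩ := dual_bilin B L hx hl
  obtain ⟨j, hj⟩ := even_div_two B L hl
  refine expTwoPiI_congr (-(s * k) + δ * s * j) ?_
  rw [quad_add B L x, quad_add B L z]
  have e1 := bilin_comm B L z x
  have e2 := bilin_comm B L l x
  have e3 := bilin_comm B L l z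
  simp only [map_add, map_smul, LinearMap.smul_apply, LinearMap.add_apply, smul_eq_mul, e1, e2, e3]
  push_cast
  rw [← hk, ← hj]
  field_simp
  linear_combination (-2 * B x l + δ * B l l) * hsq

open scoped Classical in
/-- For `k d c = n²`, a sum over `x + L / n L` and `L' / c L` restricted to `(d c / n) (x + t) ∈ L'`
equals a sum over `L' / n L` restricted to `(c k / n) y ∈ L'`. -/
theorem latMean_ite_dualMean {n k d c : ℕ} [NeZero n] [NeZero k] [NeZero d] [NeZero c]
    (hn : k * d * c = n ^ 2) (δ : ℤ) {x : V} (hx : x ∈ B.dualSubmodule L) {f : V → ℂ}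
    (hf : PeriodicOn (B.dualSubmodule L) L f) :
    latMean b n (fun t => if ((d * c : ℚ) / n) • (x + t) ∈ B.dualSubmodule L then
        dualMean B b c fun y => expTwoPiI
          ((-B y (((d * c : ℚ) / n) • (x + t)) + δ * (B y y / 2)) / c) * f y else 0) =
      ((n : ℂ) / (c * k : ℕ)) ^ Fintype.card ι * dualMean B b n fun y =>
        expTwoPiI (-B y x) * (expTwoPiI (k * δ / d * (B y y / 2)) *
          if ((c * k : ℚ) / n) • y ∈ B.dualSubmodule L then f (((c * k : ℚ) / n) • y) else 0) := by
  have hnq : (n : ℚ) ≠ 0 := NeZero.ne _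
  have hkq : (k : ℚ) ≠ 0 := NeZero.ne _
  have hdq : (d : ℚ) ≠ 0 := NeZero.ne _
  have hcq : (c : ℚ) ≠ 0 := NeZero.ne _
  have hnn : (k : ℚ) * d * c = n ^ 2 := by exact_mod_cast hn
  have : NeZero (c * k) := ⟨mul_ne_zero (NeZero.ne c) (NeZero.ne k)⟩
  set D := B.dualSubmodule L with hD
  let h : V → V → ℂ := fun t y =>
    expTwoPiI (-((d : ℚ) / n) * B y (x + t) + δ * (B y y / 2) / c) * f y
  have hxt : ∀ t ∈ L, x + t ∈ D := fun t ht => D.add_mem hx (le_dual B L ht)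
  have hper : ∀ t ∈ L, PeriodicOn D (scale ((c * k : ℕ) : ℚ) L) (h t) := by
    rintro t ht y hy _ ⟨u, hu, rfl⟩
    obtain ⟨i, hi⟩ := dual_bilin B L (hxt t ht) hu
    obtain ⟨i', hi'⟩ := dual_bilin B L hy hu
    obtain ⟨j, hj⟩ := even_div_two B L hu
    simp only [h]
    refine congrArg₂ _ ?_ (hf y hy _ (natCast_smul_mem L _ hu))
    refine expTwoPiI_congr (-(n * i) + δ * k * i' + δ * c * k * k * j) ?_
    change -((d : ℚ) / n) * B (y + ((c * k : ℕ) : ℚ) • u) (x + t) +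
      δ * (B (y + ((c * k : ℕ) : ℚ) • u) (y + ((c * k : ℕ) : ℚ) • u) / 2) / c = _
    rw [quad_add B L, map_add B, LinearMap.add_apply, map_smul, LinearMap.smul_apply,
      bilin_comm B L u]
    simp only [map_smul, LinearMap.smul_apply, smul_eq_mul]
    push_cast
    rw [← hi, ← hi', ← hj]
    field_simp
    linear_combination (-2 * c * B (x + t) u) * hnn
  -- Passing to the modulus ck, a period of h t because dck/n = n, removes the condition on X =
  -- (dc/n)(x + t). If X is in L', the summand already has period cL and its mean is unchanged.
  -- Otherwise the mean over the larger modulus vanishes.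
  have hstep1 : ∀ t ∈ L, (if ((d * c : ℚ) / n) • (x + t) ∈ D then
        dualMean B b c fun y => expTwoPiI
          ((-B y (((d * c : ℚ) / n) • (x + t)) + δ * (B y y / 2)) / c) * f y else 0) =
      dualMean B b (c * k) (h t) := by
    intro t ht
    split_ifs with hX
    · have h1 : (fun y => expTwoPiI
          ((-B y (((d * c : ℚ) / n) • (x + t)) + δ * (B y y / 2)) / c) * f y) = h t := by
        funext y
        simp only [h]
        congr 2
        rw [map_smul, smul_eq_mul]
        field_simp
      rw [h1, dualMean_mul B b k]
      rintro y hy _ ⟨u, hu, rfl⟩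
      obtain ⟨i, hi⟩ := dual_bilin B L hX hu
      obtain ⟨i', hi'⟩ := dual_bilin B L hy hu
      obtain ⟨j, hj⟩ := even_div_two B L hu
      simp only [h]
      refine congrArg₂ _ ?_ (hf y hy _ (natCast_smul_mem L _ hu))
      refine expTwoPiI_congr (-i + δ * i' + δ * c * j) ?_
      change -((d : ℚ) / n) * B (y + (c : ℚ) • u) (x + t) +
        δ * (B (y + (c : ℚ) • u) (y + (c : ℚ) • u) / 2) / c = _
      rw [quad_add B L, map_add B, LinearMap.add_apply, map_smul, LinearMap.smul_apply,
        bilin_comm B L u]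
      simp only [map_smul, LinearMap.smul_apply, smul_eq_mul] at hi ⊢
      push_cast
      rw [← hi, ← hi', ← hj]
      field_simp
      ring
    -- Some j in L has non-integral (X, j), and translating y by cj multiplies the mean by e(-(X,
    -- j)) ≠ 1.
    · rw [mem_dual_iff] at hX
      push Not at hX
      obtain ⟨j, hj, hjm⟩ := hX
      have hcj : (c : ℚ) • j ∈ L := natCast_smul_mem L c hj
      have h1 := dualMean_sub B b (hper t ht) (D.neg_mem (le_dual B L hcj))
      have h2 : ∀ y ∈ D, h t (y - -((c : ℚ) • j)) =
          expTwoPiI (-B (((d * c : ℚ) / n) • (x + t)) j) * h t y := by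
        intro y hy
        rw [sub_neg_eq_add]
        simp only [h]
        rw [hf y hy _ hcj, ← mul_assoc, ← expTwoPiI_add]
        congr 1
        obtain ⟨i', hi'⟩ := dual_bilin B L hy hj
        obtain ⟨j', hj'⟩ := even_div_two B L hj
        refine expTwoPiI_congr (δ * i' + δ * c * j') ?_
        rw [quad_add B L, map_add B, LinearMap.add_apply, map_smul, LinearMap.smul_apply,
          bilin_comm B L j]
        simp only [map_smul, LinearMap.smul_apply, smul_eq_mul]
        push_cast
        rw [← hi', ← hj']
        field_simp
        ring
      rw [dualMean_congr B b h2, dualMean_mul_left] at h1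
      have h3 : expTwoPiI (-B (((d * c : ℚ) / n) • (x + t)) j) ≠ 1 := by
        rw [Ne, expTwoPiI_eq_one_iff]
        rintro ⟨m, hm⟩
        exact hjm (-m) (by push_cast; linarith)
      by_contra h4
      exact h3 (mul_right_cancel₀ (Ne.symm h4) (by rw [h1, one_mul]))
  rw [latMean_congr b hstep1, latMean_dualMean_comm]
  let g : V → ℂ := fun y => expTwoPiI (-((d : ℚ) / n) * B y x + δ * (B y y / 2) / c) * f y
  have hρ : ((c * k : ℚ) / n)⁻¹ = (d : ℚ) / n := by
    field_simp
    linear_combination -hnn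
  -- After the interchange, t occurs only in the character e(-((d/n)y, t)), and its mean over L/nL
  -- imposes (d/n)y ∈ L'.
  have hstep2 : ∀ y ∈ D, latMean b n (fun t => h t y) =
      if ((c * k : ℚ) / n)⁻¹ • y ∈ D then g y else 0 := by
    intro y hy
    have h1 : ∀ t ∈ L, h t y = g y * expTwoPiI (-B (((d : ℚ) / n) • y) t) := by
      intro t ht
      simp only [h, g]
      rw [mul_right_comm, ← expTwoPiI_add]
      congr 2
      rw [map_add, map_smul, LinearMap.smul_apply, smul_eq_mul]
      ring
    rw [latMean_congr b h1, latMean_mul_left, latMean_char B L b n, hρ, mul_ite, mul_one, mul_zero]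
    rw [smul_smul, mul_div_cancel₀ _ hnq]
    exact natCast_smul_mem _ d hy
  rw [dualMean_congr B b hstep2]
  have hgper : PeriodicOn D (scale ((c * k : ℕ) : ℚ) L)
      fun y => if ((c * k : ℚ) / n)⁻¹ • y ∈ D then g y else 0 := by
    intro y hy u hu
    have hyu : y + u ∈ D := D.add_mem hy (le_dual B L (scale_natCast_le _ L hu))
    simp only
    rw [← hstep2 y hy, ← hstep2 _ hyu]
    exact latMean_congr b fun t ht => hper t ht y hy u hu
  -- The substitution y = (ck/n)Y maps nL to ckL. Since its inverse is d/n, it turns (d/n)(y, x)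
  -- into (Y, x).
  have hfin := dualMean_ite_smul B b (ρ := (c * k : ℚ) / n) (m := n) (m' := c * k)
    (by positivity) (by push_cast; field_simp) hgper
  have hck : ((c * k : ℕ) : ℂ) ≠ 0 := NeZero.ne _
  rw [div_pow, div_mul_eq_mul_div, eq_div_iff (pow_ne_zero _ hck), mul_comm, ← hfin]
  congr 1
  refine dualMean_congr B b fun y hy => ?_
  rw [mul_ite, mul_zero, mul_ite, mul_zero]
  refine if_congr Iff.rfl ?_ rfl
  simp only [g]
  rw [← mul_assoc, ← expTwoPiI_add]
  congr 2
  simp only [map_smul, LinearMap.smul_apply, smul_eq_mul]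
  field_simp
  linear_combination (-(d * B y x * 2) + k * δ * B y y) * hnn

end

/-! ### The terms of the Hecke operator -/

section

variable {V : Type*} [AddCommGroup V] [Module ℚ V] {B : LinearMap.BilinForm ℚ V}
  {L : Submodule ℤ V} [IsEvenLattice B L] {κ κ' : ℤ} {ψ : ℍ → (disc B L → ℂ)}
  {ι : Type*} [Fintype ι] [DecidableEq ι] (b : Module.Basis ι ℤ L)

/-- The contribution of `k`, `l` and `s` to the component at `x` of the Hecke operator, up to a
power of `l`. -/
noncomputable def heckeTerm (ψ : ℍ → (disc B L → ℂ)) (n k l : ℕ) (s : ℤ) (z : ℂ) (x : V) : ℂ :=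
  latMean b n fun t => expTwoPiI (-(s / k * (B (x + t) (x + t) / 2))) *
    extension ψ ((k * z + s) / l) (((l : ℚ) / n) • (x + t))

theorem affine_im_pos {k l : ℕ} (hk : k ≠ 0) (hl : l ≠ 0) (s : ℤ) {z : ℂ} (hz : 0 < z.im) :
    0 < (((k : ℂ) * z + s) / l).im := by
  have hk : (0 : ℝ) < k := by exact_mod_cast Nat.pos_of_ne_zero hk
  have hl : (0 : ℝ) < l := by exact_mod_cast Nat.pos_of_ne_zero hl
  rw [Complex.div_natCast_im]
  simpa using div_pos (mul_pos hk hz) hl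

/-- Adding l to s translates the argument of ψ by 1. The resulting phase q((l/n)(x+t)) = (l/k)
q(x+t) cancels the change of the explicit one. -/
theorem IsVVModular.heckeTerm_add_right (hψ : IsVVModular B L κ κ' ψ) {n k l : ℕ} [NeZero n]
    (hkl : k * l = n ^ 2) (s : ℤ) {z : ℂ} (hz : 0 < z.im) (x : V) :
    heckeTerm b ψ n k l (s + l) z x = heckeTerm b ψ n k l s z x := by
  have hnq : (n : ℚ) ≠ 0 := NeZero.ne _
  have hkl0 : k * l ≠ 0 := hkl ▸ pow_ne_zero 2 (NeZero.ne n)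
  have hk := left_ne_zero_of_mul hkl0
  have hl := right_ne_zero_of_mul hkl0
  have hkq : (k : ℚ) ≠ 0 := by exact_mod_cast hk
  have hlc : (l : ℂ) ≠ 0 := by exact_mod_cast hl
  have hkn : (k : ℚ) * l = n ^ 2 := by exact_mod_cast hkl
  refine latMean_congr b fun t ht => ?_
  have h1 : ((k : ℂ) * z + ((s + l : ℤ) : ℂ)) / l = (k * z + s) / l + (1 : ℤ) := by
    push_cast
    field_simp
    ring
  rw [h1, hψ.extension_add_int (affine_im_pos hk hl s hz), ← mul_assoc, ← expTwoPiI_add]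
  congr 2
  simp only [map_smul, LinearMap.smul_apply, smul_eq_mul]
  push_cast
  field_simp
  linear_combination B (x + t) (x + t) * l * hkn

/-- Here k(z + 1) + s = kz + (s + k), and the compensating phase e(q(x + t)) equals e(q(x)) for x in
L' and t in L. -/
theorem heckeTerm_add_one (n : ℕ) [NeZero n] {k : ℕ} (hk : k ≠ 0) (l : ℕ) (s : ℤ) (z : ℂ) {x : V}
    (hx : x ∈ B.dualSubmodule L) :
    heckeTerm b ψ n k l s (z + 1) x = expTwoPiI (B x x / 2) * heckeTerm b ψ n k l (s + k) z x := by
  have hkq : (k : ℚ) ≠ 0 := by exact_mod_cast hk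
  rw [heckeTerm, heckeTerm, ← latMean_mul_left]
  refine latMean_congr b fun t ht => ?_
  rw [← mul_assoc, ← expTwoPiI_add]
  obtain ⟨i, hi⟩ := dual_bilin B L hx ht
  obtain ⟨j, hj⟩ := even_div_two B L ht
  congr 1
  · refine expTwoPiI_congr (i + j) ?_
    rw [quad_add B L]
    push_cast
    rw [← hi, ← hj]
    field_simp
    ring
  · congr 1
    push_cast
    ring

/-- The matrix formula for ψ turns each point of the mean over L/nL into a sum over L'/cL, and
`latMean_ite_dualMean` exchanges the two. The roles of k and d are thereby swapped, and the only
dependence on x left is the character of ρ_L(S). -/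
theorem IsVVModular.heckeTerm_neg_inv (hψ : IsVVModular B L κ κ' ψ) {n k d c : ℕ} [NeZero n]
    [NeZero k] [NeZero d] [NeZero c] (hn : k * d * c = n ^ 2) {a m : ℤ} (h : (c : ℤ) ∣ a * m + 1)
    {z : ℂ} (hz : 0 < z.im) {x : V} (hx : x ∈ B.dualSubmodule L) :
    heckeTerm b ψ n k (d * c) (d * a) (-1 / z) x =
      autFactor κ κ' z * weilConst B L * ((((d / k : ℝ) ^ ((κ + κ' : ℝ) / 2) : ℝ) : ℂ) *
        (Real.sqrt c : ℂ) ^ Fintype.card ι * ((n : ℂ) / (c * k : ℕ)) ^ Fintype.card ι) *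
        ∑ γ : disc B L, expTwoPiI (-B (Quotient.out (γ : V ⧸ L)) x) *
          heckeTerm b ψ n d (c * k) (k * m) z (Quotient.out (γ : V ⧸ L)) := by
  classical
  have hnq : (n : ℚ) ≠ 0 := NeZero.ne _
  have hkq : (k : ℚ) ≠ 0 := NeZero.ne _
  have hdq : (d : ℚ) ≠ 0 := NeZero.ne _
  have hcq : (c : ℚ) ≠ 0 := NeZero.ne _
  have hkc : (k : ℂ) ≠ 0 := NeZero.ne _
  have hdc : (d : ℂ) ≠ 0 := NeZero.ne _
  have hcc : (c : ℂ) ≠ 0 := NeZero.ne _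
  have hz0 := ne_zero_of_im_pos hz
  have hnn : (k : ℚ) * d * c = n ^ 2 := by exact_mod_cast hn
  have hdk : (0 : ℝ) < d / k := by
    have h1 : (0 : ℝ) < d := by exact_mod_cast Nat.pos_of_ne_zero (NeZero.ne d)
    have h2 : (0 : ℝ) < k := by exact_mod_cast Nat.pos_of_ne_zero (NeZero.ne k)
    positivity
  have hck : c * k ≠ 0 := mul_ne_zero (NeZero.ne c) (NeZero.ne k)
  -- With am + 1 = ce, the matrix (a -e; c -m) has determinant 1 and sends w to the argument of ψ at
  -- -1/z. Its denominator at w is (d/k)z, so the automorphy factor splits off that of z.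
  set w : ℂ := (d * z + ((k * m : ℤ) : ℂ)) / (c * k : ℕ) with hw
  have hw0 : 0 < w.im := affine_im_pos (NeZero.ne d) hck _ hz
  have hcw : (c : ℂ) * w + ((-m : ℤ) : ℂ) = ((d / k : ℝ) : ℂ) * z := by
    rw [hw]
    push_cast
    field_simp
    ring
  obtain ⟨e, he⟩ := h
  have hec : (a : ℂ) * m + 1 = c * e := by exact_mod_cast he
  have hpt : ((k : ℂ) * (-1 / z) + ((d * a : ℤ) : ℂ)) / (d * c : ℕ) =
      (a * w + ((-e : ℤ) : ℂ)) / (c * w + ((-m : ℤ) : ℂ)) := by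
    rw [hcw, hw]
    push_cast
    field_simp
    linear_combination (-k) * hec
  have hF : PeriodicOn (B.dualSubmodule L) L (extension ψ w) := fun x _ l hl => extension_add w x hl
  have hpoint : ∀ t ∈ L, expTwoPiI (-(((d * a : ℤ) : ℚ) / k * (B (x + t) (x + t) / 2))) *
      extension ψ ((k * (-1 / z) + ((d * a : ℤ) : ℂ)) / (d * c : ℕ))
        ((((d * c : ℕ) : ℚ) / n) • (x + t)) =
      autFactor κ κ' z * weilConst B L * ((((d / k : ℝ) ^ ((κ + κ' : ℝ) / 2) : ℝ) : ℂ) *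
        (Real.sqrt c : ℂ) ^ Fintype.card ι) *
        if ((d * c : ℚ) / n) • (x + t) ∈ B.dualSubmodule L then
        dualMean B b c fun y => expTwoPiI
          ((-B y (((d * c : ℚ) / n) • (x + t)) + (-m : ℤ) * (B y y / 2)) / c) * extension ψ w y
        else 0 := by
    intro t ht
    rw [show ((d * c : ℕ) : ℚ) = d * c from Nat.cast_mul d c]
    split_ifs with hX
    · rw [hpt, hψ.extension_moebius b (Nat.pos_of_ne_zero (NeZero.ne c)) a (-e) (-m)
        (by linarith) hw0 hX, hcw, autFactor_ofReal_mul κ κ' hdk hz,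
        ← exp_mul_sum_weilKernel B b c (a := a) ⟨-e, by linarith⟩ hX hF]
      -- Because q(X) = (dc/k) q(x + t) for X = (dc/n)(x + t), the Hecke phase is exactly the
      -- prefactor in `exp_mul_sum_weilKernel`.
      have h1 : -(((d * a : ℤ) : ℚ) / k * (B (x + t) (x + t) / 2)) =
          -(a * (B (((d * c : ℚ) / n) • (x + t)) (((d * c : ℚ) / n) • (x + t)) / 2)) / c := by
        simp only [map_smul, LinearMap.smul_apply, smul_eq_mul]
        push_cast
        field_simp
        linear_combination (a * B (x + t) (x + t)) * hnn
      rw [h1]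
      ring
    · rw [extension_eq_zero _ hX, mul_zero, mul_zero]
  rw [heckeTerm, latMean_congr b hpoint, latMean_mul_left, latMean_ite_dualMean B b hn (-m) hx hF,
    dualMean]
  have hsum : ∀ γ : disc B L, latMean b n (fun l =>
      expTwoPiI (-B (Quotient.out (γ : V ⧸ L) + l) x) *
        (expTwoPiI (k * (-m : ℤ) / d *
            (B (Quotient.out (γ : V ⧸ L) + l) (Quotient.out (γ : V ⧸ L) + l) / 2)) *
          if ((c * k : ℚ) / n) • (Quotient.out (γ : V ⧸ L) + l) ∈ B.dualSubmodule L then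
            extension ψ w (((c * k : ℚ) / n) • (Quotient.out (γ : V ⧸ L) + l)) else 0)) =
      expTwoPiI (-B (Quotient.out (γ : V ⧸ L)) x) *
        heckeTerm b ψ n d (c * k) (k * m) z (Quotient.out (γ : V ⧸ L)) := by
    intro γ
    rw [heckeTerm, ← latMean_mul_left]
    refine latMean_congr b fun l hl => ?_
    obtain ⟨i, hi⟩ := dual_bilin B L hx hl
    congr 1
    · refine expTwoPiI_congr (-i) ?_
      rw [map_add, LinearMap.add_apply, bilin_comm B L l, hi]
      push_cast
      ring
    · congr 1
      · congr 1
        push_cast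
        ring
      · rw [← hw, show ((c * k : ℕ) : ℚ) = c * k from Nat.cast_mul c k]
        split_ifs with hX
        · rfl
        · exact (extension_eq_zero _ hX).symm
  rw [Finset.sum_congr rfl fun γ _ => hsum γ]
  ring

end

/-! ### An involution of the index set -/

/-- The representative of `-1 / a` modulo `c`. -/
def negInvMod (c a : ℕ) : ℕ := (-(a : ZMod c)⁻¹).val

theorem negInvMod_lt (c a : ℕ) [NeZero c] : negInvMod c a < c := ZMod.val_lt _

theorem mul_negInvMod_cast {c a : ℕ} [NeZero c] (h : a.Coprime c) :
    (a : ZMod c) * negInvMod c a = -1 := by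
  rw [negInvMod, ZMod.natCast_zmod_val, mul_neg, ZMod.coe_mul_inv_eq_one a h]

theorem dvd_mul_negInvMod {c a : ℕ} [NeZero c] (h : a.Coprime c) :
    (c : ℤ) ∣ a * negInvMod c a + 1 := by
  rw [← ZMod.intCast_zmod_eq_zero_iff_dvd]
  push_cast
  rw [mul_negInvMod_cast h, neg_add_cancel]

theorem coprime_negInvMod {c a : ℕ} [NeZero c] (h : a.Coprime c) : (negInvMod c a).Coprime c := by
  rw [← Nat.isCoprime_iff_coprime]
  obtain ⟨e, he⟩ := dvd_mul_negInvMod h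
  exact ⟨-a, e, by linear_combination -he⟩

theorem negInvMod_negInvMod {c a : ℕ} [NeZero c] (h : a.Coprime c) (ha : a < c) :
    negInvMod c (negInvMod c a) = a := by
  have h1 := mul_negInvMod_cast h
  have h2 := mul_negInvMod_cast (coprime_negInvMod h)
  have h3 : (negInvMod c (negInvMod c a) : ZMod c) = a := by
    linear_combination (negInvMod c (negInvMod c a) : ZMod c) * h1 - a * h2
  rw [← ZMod.val_natCast_of_lt (negInvMod_lt c (negInvMod c a)), h3, ZMod.val_natCast_of_lt ha]

/-- Reindexing the sum over `k l = r` and `0 ≤ s < l`. -/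
theorem sum_divisorsAntidiagonal_range {r : ℕ} {F G : ℕ → ℕ → ℕ → ℂ}
    (h : ∀ k d c a m : ℕ, k * d * c = r → (c : ℤ) ∣ a * m + 1 →
      F k (d * c) (d * a) = G d (c * k) (k * m)) :
    ∑ p ∈ r.divisorsAntidiagonal, ∑ s ∈ Finset.range p.2, F p.1 p.2 s =
      ∑ p ∈ r.divisorsAntidiagonal, ∑ s ∈ Finset.range p.2, G p.1 p.2 s := by
  rw [Finset.sum_sigma', Finset.sum_sigma']
  let i : (_ : ℕ × ℕ) × ℕ → (_ : ℕ × ℕ) × ℕ := fun x =>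
    ⟨(x.2.gcd x.1.2, x.1.2 / x.2.gcd x.1.2 * x.1.1),
      x.1.1 * negInvMod (x.1.2 / x.2.gcd x.1.2) (x.2 / x.2.gcd x.1.2)⟩
  have hi : ∀ k g c a : ℕ, 0 < g → a.Coprime c →
      i ⟨(k, g * c), g * a⟩ = ⟨(g, c * k), k * negInvMod c a⟩ := by
    intro k g c a hg hac
    have h1 : (g * a).gcd (g * c) = g := by rw [Nat.gcd_mul_left, hac.gcd_eq_one, mul_one]
    simp only [i, h1, Nat.mul_div_cancel_left _ hg]
  -- The value s = 0 is included: then g = l, c = 1 and a = 0.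
  have hrep : ∀ x ∈ r.divisorsAntidiagonal.sigma fun p => Finset.range p.2,
      ∃ k g c a : ℕ, x = ⟨(k, g * c), g * a⟩ ∧ 0 < k ∧ 0 < g ∧ 0 < c ∧ a < c ∧ a.Coprime c ∧
        k * g * c = r ∧ r ≠ 0 := by
    rintro ⟨⟨k, l⟩, s⟩ hx
    simp only [Finset.mem_sigma, Nat.mem_divisorsAntidiagonal, Finset.mem_range] at hx
    obtain ⟨⟨hkl, hr⟩, hs⟩ := hx
    have hl : 0 < l := by omega
    have hg : 0 < s.gcd l := Nat.gcd_pos_of_pos_right s hl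
    refine ⟨k, s.gcd l, l / s.gcd l, s / s.gcd l, ?_, ?_, hg, ?_, ?_, ?_, ?_, hr⟩
    · rw [Nat.mul_div_cancel' (Nat.gcd_dvd_left s l), Nat.mul_div_cancel' (Nat.gcd_dvd_right s l)]
    · rcases Nat.eq_zero_or_pos k with rfl | hk
      · simp at hkl; omega
      · exact hk
    · exact Nat.div_pos (Nat.le_of_dvd hl (Nat.gcd_dvd_right s l)) hg
    · exact Nat.div_lt_div_of_lt_of_dvd (Nat.gcd_dvd_right s l) hs
    · exact Nat.coprime_div_gcd_div_gcd hg
    · rw [mul_assoc, Nat.mul_div_cancel' (Nat.gcd_dvd_right s l), hkl]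
  have hmem : ∀ x ∈ r.divisorsAntidiagonal.sigma fun p => Finset.range p.2,
      i x ∈ r.divisorsAntidiagonal.sigma fun p => Finset.range p.2 := by
    intro x hx
    obtain ⟨k, g, c, a, rfl, hk, hg, hc, hac, hcop, hr, hr0⟩ := hrep x hx
    have : NeZero c := ⟨hc.ne'⟩
    rw [hi k g c a hg hcop]
    simp only [Finset.mem_sigma, Nat.mem_divisorsAntidiagonal, Finset.mem_range]
    refine ⟨⟨by rw [← hr]; ring, hr0⟩, ?_⟩
    rw [mul_comm c k]
    exact Nat.mul_lt_mul_of_pos_left (negInvMod_lt c a) hk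
  have hinv : ∀ x ∈ r.divisorsAntidiagonal.sigma fun p => Finset.range p.2, i (i x) = x := by
    intro x hx
    obtain ⟨k, g, c, a, rfl, hk, hg, hc, hac, hcop, hr, hr0⟩ := hrep x hx
    have : NeZero c := ⟨hc.ne'⟩
    -- The new gcd is k, since negInvMod c a is prime to c. The second application thus swaps k and
    -- g back and inverts modulo c again.
    rw [hi k g c a hg hcop, mul_comm c k, hi g k c _ hk (coprime_negInvMod hcop),
      negInvMod_negInvMod hcop hac, mul_comm c g]
  refine Finset.sum_nbij' i i hmem hmem hinv hinv fun x hx => ?_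
  obtain ⟨k, g, c, a, rfl, hk, hg, hc, hac, hcop, hr, hr0⟩ := hrep x hx
  have : NeZero c := ⟨hc.ne'⟩
  rw [hi k g c a hg hcop]
  exact h k g c a _ hr (dvd_mul_negInvMod hcop)

/-! ### The transformation of the sum over all terms -/

section

variable {V : Type*} [AddCommGroup V] [Module ℚ V] {B : LinearMap.BilinForm ℚ V}
  {L : Submodule ℤ V} [IsEvenLattice B L] {κ κ' : ℤ} {ψ : ℍ → (disc B L → ℂ)}
  {ι : Type*} [Fintype ι] [DecidableEq ι] (b : Module.Basis ι ℤ L)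

/-- The component at `x` of the Hecke operator, up to a power of `n`. -/
noncomputable def heckeSum (ψ : ℍ → (disc B L → ℂ)) (W : ℝ) (n : ℕ) (z : ℂ) (x : V) : ℂ :=
  ∑ p ∈ (n ^ 2).divisorsAntidiagonal, ((1 / (p.2 : ℝ) ^ W : ℝ) : ℂ) *
    ∑ s ∈ Finset.range p.2, heckeTerm b ψ n p.1 p.2 s z x

theorem IsVVModular.heckeSum_add_one (hψ : IsVVModular B L κ κ' ψ) (W : ℝ) {n : ℕ} [NeZero n]
    {z : ℂ} (hz : 0 < z.im) {x : V} (hx : x ∈ B.dualSubmodule L) :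
    heckeSum b ψ W n (z + 1) x = expTwoPiI (B x x / 2) * heckeSum b ψ W n z x := by
  rw [heckeSum, heckeSum, Finset.mul_sum]
  refine Finset.sum_congr rfl fun p hp => ?_
  obtain ⟨hkl, hn⟩ := Nat.mem_divisorsAntidiagonal.1 hp
  have hk : p.1 ≠ 0 := left_ne_zero_of_mul (hkl ▸ hn)
  rw [mul_left_comm]
  congr 1
  rw [Finset.sum_congr rfl fun (s : ℕ) _ => heckeTerm_add_one (ψ := ψ) b n hk p.2 s z hx,
    ← Finset.mul_sum]
  congr 1
  exact sum_range_add_of_periodic (f := fun s => heckeTerm b ψ n p.1 p.2 s z x)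
    (fun s => hψ.heckeTerm_add_right b hkl s hz x) p.1

/-- The factors collected by one term under S turn the weight l^(-W) for l = dc into that for l =
ck. Substituting n = √k √d √c reduces the claim to a comparison of powers. -/
theorem one_div_rpow_mul {n k d c : ℕ} [NeZero n] [NeZero k] [NeZero d] [NeZero c]
    (hn : k * d * c = n ^ 2) (α : ℝ) (N : ℕ) :
    1 / ((d * c : ℕ) : ℝ) ^ (α + N / 2) *
        ((d / k : ℝ) ^ α * Real.sqrt c ^ N * ((n : ℝ) / (c * k : ℕ)) ^ N) =
      1 / ((c * k : ℕ) : ℝ) ^ (α + N / 2) := by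
  have hk : (0 : ℝ) < k := by exact_mod_cast Nat.pos_of_ne_zero (NeZero.ne k)
  have hd : (0 : ℝ) < d := by exact_mod_cast Nat.pos_of_ne_zero (NeZero.ne d)
  have hc : (0 : ℝ) < c := by exact_mod_cast Nat.pos_of_ne_zero (NeZero.ne c)
  have hsqrt : ∀ y : ℝ, 0 < y → y ^ (α + N / 2) = y ^ α * Real.sqrt y ^ N := by
    intro y hy
    rw [Real.rpow_add hy, Real.sqrt_eq_rpow, ← Real.rpow_natCast (y ^ (1 / 2 : ℝ)),
      ← Real.rpow_mul hy.le]
    ring_nf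
  have hnn : (n : ℝ) = Real.sqrt k * Real.sqrt d * Real.sqrt c := by
    rw [← Real.sqrt_mul hk.le, ← Real.sqrt_mul (by positivity)]
    rw [eq_comm, Real.sqrt_eq_iff_mul_self_eq (by positivity) (by positivity)]
    have : (k * d * c : ℝ) = n ^ 2 := by exact_mod_cast hn
    rw [this]
    ring
  push_cast
  rw [hsqrt _ (by positivity), hsqrt _ (by positivity), Real.mul_rpow hd.le hc.le,
    Real.mul_rpow hc.le hk.le, Real.div_rpow hd.le hk.le, Real.sqrt_mul hd.le,
    Real.sqrt_mul hc.le, hnn]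
  have hk' := Real.mul_self_sqrt hk.le
  have hc' := Real.mul_self_sqrt hc.le
  have h1 : Real.sqrt k * Real.sqrt d * Real.sqrt c / (c * k) =
      Real.sqrt d / (Real.sqrt c * Real.sqrt k) := by
    nth_rewrite 2 [← hk', ← hc']
    have := (Real.sqrt_pos.2 hk).ne'
    have := (Real.sqrt_pos.2 hc).ne'
    field_simp
  rw [h1]
  have := (Real.rpow_pos_of_pos hk α).ne'
  have := (Real.rpow_pos_of_pos hd α).ne'
  have := (Real.rpow_pos_of_pos hc α).ne'
  have := (Real.sqrt_pos.2 hk).ne'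
  have := (Real.sqrt_pos.2 hd).ne'
  have := (Real.sqrt_pos.2 hc).ne'
  rw [div_pow, mul_pow, mul_pow]
  field_simp

theorem IsVVModular.heckeSum_neg_inv (hψ : IsVVModular B L κ κ' ψ) {n : ℕ} [NeZero n]
    {z : ℂ} (hz : 0 < z.im) {x : V} (hx : x ∈ B.dualSubmodule L) :
    heckeSum b ψ ((κ + κ' : ℝ) / 2 + Fintype.card ι / 2) n (-1 / z) x =
      autFactor κ κ' z * (weilConst B L * ∑ γ : disc B L,
        expTwoPiI (-B (Quotient.out (γ : V ⧸ L)) x) *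
          heckeSum b ψ ((κ + κ' : ℝ) / 2 + Fintype.card ι / 2) n z (Quotient.out (γ : V ⧸ L))) := by
  set W : ℝ := (κ + κ' : ℝ) / 2 + Fintype.card ι / 2 with hW
  have key := sum_divisorsAntidiagonal_range (r := n ^ 2)
    (F := fun k l s => ((1 / (l : ℝ) ^ W : ℝ) : ℂ) * heckeTerm b ψ n k l s (-1 / z) x)
    (G := fun k l s => autFactor κ κ' z * weilConst B L * (((1 / (l : ℝ) ^ W : ℝ) : ℂ) *
      ∑ γ : disc B L, expTwoPiI (-B (Quotient.out (γ : V ⧸ L)) x) *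
        heckeTerm b ψ n k l s z (Quotient.out (γ : V ⧸ L)))) ?_
  · simp only [heckeSum, Finset.mul_sum] at key ⊢
    rw [key]
    refine Eq.trans ?_ Finset.sum_comm
    refine Finset.sum_congr rfl fun p _ => ?_
    rw [Finset.sum_comm]
    refine Finset.sum_congr rfl fun γ _ => Finset.sum_congr rfl fun s _ => ?_
    ring
  · intro k d c a m hn hdvd
    have h0 : k * d * c ≠ 0 := hn ▸ pow_ne_zero 2 (NeZero.ne n)
    have : NeZero c := ⟨right_ne_zero_of_mul h0⟩
    have : NeZero d := ⟨right_ne_zero_of_mul (left_ne_zero_of_mul h0)⟩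
    have : NeZero k := ⟨left_ne_zero_of_mul (left_ne_zero_of_mul h0)⟩
    have h1 := hψ.heckeTerm_neg_inv b hn hdvd hz hx
    have h2 := one_div_rpow_mul hn ((κ + κ' : ℝ) / 2) (Fintype.card ι)
    rw [← hW] at h2
    have h3 := congrArg (fun r : ℝ => (r : ℂ)) h2
    rw [← h3]
    simp only [Nat.cast_mul] at h1 ⊢
    rw [h1]
    push_cast
    ring

end

/-! ### The Hecke operator -/

section

variable {V : Type*} [AddCommGroup V] [Module ℚ V] {B : LinearMap.BilinForm ℚ V}
  {L : Submodule ℤ V} [IsEvenLattice B L] {κ κ' : ℤ} {ψ : ℍ → (disc B L → ℂ)}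
  {ι : Type*} [Fintype ι] [DecidableEq ι] (b : Module.Basis ι ℤ L)

open scoped Classical in
/-- The classes `γ` with `n γ = lam` are those of `(x + t) / n` for `t` in `L / n L`. -/
theorem sum_filter_nsmul_eq (n : ℕ) [NeZero n] (lam : disc B L) (F : V ⧸ L → ℂ) :
    ∑ γ ∈ Finset.univ.filter
        (fun γ : disc (rescale (n ^ 2) B) L => n • (γ : V ⧸ L) = (lam : V ⧸ L)), F γ =
      (n : ℂ) ^ Fintype.card ι * latMean b n fun t =>
        F (L.mkQ ((n : ℚ)⁻¹ • (Quotient.out (lam : V ⧸ L) + t))) := by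
  have hn : (n : ℂ) ≠ 0 := NeZero.ne _
  have hnq : (n : ℚ) ≠ 0 := NeZero.ne _
  have : NeZero (n ^ 2) := ⟨pow_ne_zero 2 (NeZero.ne n)⟩
  rw [latMean, mul_inv_cancel_left₀ (pow_ne_zero _ hn)]
  set x := Quotient.out (lam : V ⧸ L) with hx
  have hxD : x ∈ B.dualSubmodule L := (isTransversal_out B L (le_dual B L)).mem lam
  have hbox := isTransversal_box b n
  have hmem : ∀ t : ι → Fin n,
      L.mkQ ((n : ℚ)⁻¹ • (x + box b n t)) ∈ disc (rescale (n ^ 2) B) L := by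
    intro t
    rw [mk_mem_disc_iff, mem_dual_rescale_iff, smul_smul,
      show ((n ^ 2 : ℕ) : ℚ) * (n : ℚ)⁻¹ = n by push_cast; field_simp]
    exact natCast_smul_mem _ n (Submodule.add_mem _ hxD (le_dual B L (hbox.mem t)))
  symm
  refine Finset.sum_bij (fun t _ => ⟨L.mkQ ((n : ℚ)⁻¹ • (x + box b n t)), hmem t⟩) ?_ ?_ ?_ ?_
  · intro t _
    simp only [Finset.mem_filter, Finset.mem_univ, true_and]
    rw [← map_nsmul, ← Nat.cast_smul_eq_nsmul ℚ, smul_inv_smul₀ hnq, map_add,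
      (LinearMap.mem_ker.1 (by rw [Submodule.ker_mkQ]; exact hbox.mem t) : L.mkQ (box b n t) = 0),
      add_zero, hx, mkQ_out]
  · intro t _ t' _ htt
    have h1 : (n : ℚ)⁻¹ • (x + box b n t) - (n : ℚ)⁻¹ • (x + box b n t') ∈ L :=
      (Submodule.Quotient.eq L).1 (Subtype.ext_iff.1 htt)
    rw [← smul_sub, add_sub_add_left_eq_sub] at h1
    refine (hbox.existsUnique _ (hbox.mem t)).unique ?_ ?_
    · rw [sub_self]; exact Submodule.zero_mem _
    · exact (mem_scale_iff hnq).2 h1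
  · rintro ⟨γ, hγ⟩ hγn
    simp only [Finset.mem_filter, Finset.mem_univ, true_and] at hγn
    obtain ⟨y, rfl⟩ := L.mkQ_surjective γ
    have h1 : (n : ℚ) • y - x ∈ L := by
      refine (Submodule.Quotient.eq L).1 ?_
      change L.mkQ ((n : ℚ) • y) = L.mkQ x
      rw [hx, mkQ_out, ← hγn, ← map_nsmul, Nat.cast_smul_eq_nsmul]
    obtain ⟨t, ht, -⟩ := hbox.existsUnique _ h1
    refine ⟨t, Finset.mem_univ _, Subtype.ext ((Submodule.Quotient.eq L).2 ?_)⟩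
    have h2 := L.neg_mem ((mem_scale_iff hnq).1 ht)
    rw [sub_sub, smul_sub, inv_smul_smul₀ hnq, neg_sub] at h2
    exact h2
  · intro t _
    rfl

theorem delta_mk {r k l : ℕ} (hkl : k * l = r) (hr : r ≠ 0) (y : V) :
    delta B L r (L.mkQ y) k = 1 ∧ (l : ℚ) • y ∈ B.dualSubmodule L ∨
      delta B L r (L.mkQ y) k = 0 ∧ (l : ℚ) • y ∉ B.dualSubmodule L := by
  have hk : 0 < k := Nat.pos_of_ne_zero (left_ne_zero_of_mul (hkl ▸ hr))
  have : NeZero l := ⟨right_ne_zero_of_mul (hkl ▸ hr)⟩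
  have hl : r / k = l := by rw [← hkl, Nat.mul_div_cancel_left _ hk]
  rw [delta, hl, ← mem_dual_rescale_iff, ← mk_mem_disc_iff]
  by_cases h : L.mkQ y ∈ disc (rescale l B) L
  · exact Or.inl ⟨if_pos h, h⟩
  · exact Or.inr ⟨if_neg h, h⟩

/-- Δ is redundant: it vanishes exactly when (l/n)X is outside L', where the extended component is 0
by convention. Where it is 1, the phase may be computed on the representative X/n, and q_{n²}(X/n) =
q(X). -/
theorem delta_mul_phase_mul_component {n k l : ℕ} [NeZero n] (hkl : k * l = n ^ 2) (s : ℕ) (τ : ℍ)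
    (X : V) :
    delta B L (n ^ 2) (L.mkQ ((n : ℚ)⁻¹ • X)) k *
        expTwoPiI (-((s : ℚ) / k) * quadRep (rescale (n ^ 2) B) L (L.mkQ ((n : ℚ)⁻¹ • X))) *
          component (ψ (heckePoint k l s τ)) (l • L.mkQ ((n : ℚ)⁻¹ • X)) =
      expTwoPiI (-((s : ℤ) / k * (B X X / 2))) *
        extension ψ ((k * (τ : ℂ) + (s : ℤ)) / l) (((l : ℚ) / n) • X) := by
  have hnq : (n : ℚ) ≠ 0 := NeZero.ne _
  have hn2 : n ^ 2 ≠ 0 := pow_ne_zero 2 (NeZero.ne n)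
  have : NeZero l := ⟨right_ne_zero_of_mul (hkl ▸ hn2)⟩
  have h1 : component (ψ (heckePoint k l s τ)) (l • L.mkQ ((n : ℚ)⁻¹ • X)) =
      extension ψ ((k * (τ : ℂ) + (s : ℤ)) / l) (((l : ℚ) / n) • X) := by
    rw [extension, heckePoint, Int.cast_natCast, ← map_nsmul, ← Nat.cast_smul_eq_nsmul ℚ, smul_smul,
      div_eq_mul_inv (l : ℚ)]
  rw [h1]
  rcases delta_mk (B := B) (L := L) hkl hn2 ((n : ℚ)⁻¹ • X) with ⟨h, hX⟩ | ⟨h, hX⟩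
  · rw [h, one_mul, phase_mk B L (n ^ 2) k l s hn2 hkl]
    · congr 2
      simp only [rescale, map_smul, LinearMap.smul_apply, smul_eq_mul]
      push_cast
      field_simp
    · rwa [mk_mem_disc_iff, mem_dual_rescale_iff]
  · rw [smul_smul, ← div_eq_mul_inv] at hX
    rw [extension_eq_zero _ hX, mul_zero, mul_zero]

/-- The n^(dim L) classes γ above lam cancel the normalization of 𝒫. For γ = (x + t)/n the factor
Δ(γ, n) is 1, since nγ is represented by x + t in L'. -/
theorem heckeH_apply (hb : Fintype.card ι = Module.finrank ℚ V) (v v' : ℝ) (n : ℕ) [NeZero n]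
    (τ : ℍ) (lam : disc B L) :
    heckeH B L v v' n ψ τ lam =
      ((((n ^ 2 : ℕ) : ℝ) ^ (v + (bPlus B : ℝ) / 2 + (v' + (bMinus B : ℝ) / 2) - 1) : ℝ) : ℂ) *
        heckeSum b ψ (v + (bPlus B : ℝ) / 2 + (v' + (bMinus B : ℝ) / 2)) n τ
          (Quotient.out (lam : V ⧸ L)) := by
  classical
  have hn : (n : ℂ) ≠ 0 := NeZero.ne _
  have hn2 : n ^ 2 ≠ 0 := pow_ne_zero 2 (NeZero.ne n)
  set W := v + (bPlus B : ℝ) / 2 + (v' + (bMinus B : ℝ) / 2)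
  set C := ((((n ^ 2 : ℕ) : ℝ) ^ (W - 1) : ℝ) : ℂ)
  have h1 := sum_filter_nsmul_eq b n lam fun γ => delta B L (n ^ 2) γ n * (C *
    ∑ p ∈ (n ^ 2).divisorsAntidiagonal, ((1 / (p.2 : ℝ) ^ W : ℝ) : ℂ) *
      ∑ s ∈ Finset.range p.2, delta B L (n ^ 2) γ p.1 *
        expTwoPiI (-((s : ℚ) / (p.1 : ℚ)) * quadRep (rescale (n ^ 2) B) L γ) *
          component (ψ (heckePoint p.1 p.2 s τ)) (p.2 • γ))
  have h2 : heckeH B L v v' n ψ τ lam = 1 / (n : ℂ) ^ Module.finrank ℚ V * _ :=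
    congrArg (1 / (n : ℂ) ^ Module.finrank ℚ V * ·) h1
  rw [h2, ← hb, one_div, inv_mul_cancel_left₀ (pow_ne_zero _ hn), heckeSum,
    latMean_congr b (g := fun t => C * ∑ p ∈ (n ^ 2).divisorsAntidiagonal,
      ((1 / (p.2 : ℝ) ^ W : ℝ) : ℂ) * ∑ s ∈ Finset.range p.2,
        (expTwoPiI (-((s : ℤ) / p.1 * (B (Quotient.out (lam : V ⧸ L) + t)
            (Quotient.out (lam : V ⧸ L) + t) / 2))) *
          extension ψ ((p.1 * (τ : ℂ) + (s : ℤ)) / p.2)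
            (((p.2 : ℚ) / n) • (Quotient.out (lam : V ⧸ L) + t)))),
    latMean_mul_left, latMean_sum]
  · congr 1
    refine Finset.sum_congr rfl fun p _ => ?_
    rw [latMean_mul_left, latMean_sum]
    rfl
  · intro t ht
    have hX : Quotient.out (lam : V ⧸ L) + t ∈ B.dualSubmodule L :=
      Submodule.add_mem _ ((isTransversal_out B L (le_dual B L)).mem lam) (le_dual B L ht)
    rcases delta_mk (B := B) (L := L) (pow_two n).symm hn2
      ((n : ℚ)⁻¹ • (Quotient.out (lam : V ⧸ L) + t)) with ⟨h, -⟩ | ⟨-, h⟩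
    · rw [h, one_mul]
      congr 1
      refine Finset.sum_congr rfl fun p hp => ?_
      congr 1
      exact Finset.sum_congr rfl fun s _ =>
        delta_mul_phase_mul_component (Nat.mem_divisorsAntidiagonal.1 hp).1 s τ _
    · rw [smul_inv_smul₀ (NeZero.ne _)] at h
      exact absurd hX h

theorem IsVVModular.analyticOnNhd_heckeSum (hψ : IsVVModular B L κ κ' ψ) (W : ℝ) (n : ℕ) (x : V) :
    AnalyticOnNhd ℝ (fun z => heckeSum b ψ W n z x) {z : ℂ | 0 < z.im} := by
  intro z hz
  refine Finset.analyticAt_fun_sum _ fun p hp => analyticAt_const.mul ?_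
  obtain ⟨hkl, hn⟩ := Nat.mem_divisorsAntidiagonal.1 hp
  refine Finset.analyticAt_fun_sum _ fun s _ => analyticAt_const.mul ?_
  refine Finset.analyticAt_fun_sum _ fun t _ => analyticAt_const.mul ?_
  set X := ((p.2 : ℚ) / n) • (x + box b n t)
  by_cases hX : X ∈ B.dualSubmodule L
  · simp only [extension_of_mem _ hX]
    refine (hψ.analytic _ _ (affine_im_pos (left_ne_zero_of_mul (hkl ▸ hn))
      (right_ne_zero_of_mul (hkl ▸ hn)) s hz)).fun_comp (f := fun z : ℂ =>
        ((p.1 : ℂ) * z + ((s : ℤ) : ℂ)) / p.2) ?_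
    simp only [div_eq_mul_inv]
    fun_prop
  · simp only [extension_eq_zero _ hX]
    exact analyticAt_const

theorem isVVModular_heckeH {v v' : ℝ} (hv : 2 * v = κ) (hv' : 2 * v' = κ') (n : ℕ) [NeZero n]
    (hψ : IsVVModular B L κ κ' ψ) : IsVVModular B L κ κ' (heckeH B L v v' n ψ) := by
  have := IsEvenLattice.lattice (B := B) (L := L)
  have := finiteDimensional_of_isLattice L
  let b := latticeBasis L
  have hN : (bPlus B : ℝ) + bMinus B = Module.finrank ℚ V := by
    exact_mod_cast bPlus_add_bMinus B L
  -- The exponent w + w' is (κ + κ')/2 + dim/2, exactly the one for which the sum transforms under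
  -- S.
  have hW : v + (bPlus B : ℝ) / 2 + (v' + (bMinus B : ℝ) / 2) =
      (κ + κ' : ℝ) / 2 + Fintype.card (Fin (Module.finrank ℚ V)) / 2 := by
    rw [Fintype.card_fin, ← hN, ← hv, ← hv']
    ring
  have happ : ∀ (τ : ℍ) (lam : disc B L), heckeH B L v v' n ψ τ lam = _ :=
    fun τ lam => heckeH_apply b (Fintype.card_fin _) v v' n τ lam
  rw [hW] at happ
  set W : ℝ := (κ + κ' : ℝ) / 2 + Fintype.card (Fin (Module.finrank ℚ V)) / 2
  set C : ℂ := ((((n ^ 2 : ℕ) : ℝ) ^ (W - 1) : ℝ) : ℂ)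
  have hmem := (isTransversal_out B L (le_dual B L)).mem
  refine isVVModular_of_generators (fun γ => ?_) (fun τ γ => ?_) fun τ γ => ?_
  · have h1 := (analyticOnNhd_const (𝕜 := ℝ) (v := C)).mul
      (hψ.analyticOnNhd_heckeSum b W n (Quotient.out (γ : V ⧸ L)))
    refine h1.congr (isOpen_lt continuous_const Complex.continuous_im) fun z hz => ?_
    simp only [happ, ofComplex_apply_of_im_pos hz]
  · rw [happ, happ, mul_left_comm, UpperHalfPlane.modular_T_smul]
    congr 1
    have h1 := hψ.heckeSum_add_one b W (n := n) τ.im_pos (hmem γ)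
    refine Eq.trans ?_ h1
    congr 1
    simp [add_comm]
  · have h1 := hψ.heckeSum_neg_inv b (n := n) τ.im_pos (hmem γ)
    have h2 : ((ModularGroup.S • τ : ℍ) : ℂ) = -1 / (τ : ℂ) := by
      rw [UpperHalfPlane.modular_S_smul]
      simp [neg_div, inv_neg]
    simp only [happ]
    rw [h2, h1]
    simp only [Finset.mul_sum]
    refine Finset.sum_congr rfl fun δ _ => ?_
    rw [bilinRep]
    ring

theorem one_div_pow_mul_rpow {n : ℕ} [NeZero n] (α : ℝ) (N : ℕ) :
    1 / (n : ℝ) ^ N * ((n ^ 2 : ℕ) : ℝ) ^ (α + N / 2 - 1) = (n : ℝ) ^ (2 * (α - 1)) := by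
  have hn : (0 : ℝ) < n := by exact_mod_cast Nat.pos_of_ne_zero (NeZero.ne n)
  rw [Nat.cast_pow, ← Real.rpow_natCast (n : ℝ) 2, ← Real.rpow_mul hn.le,
    ← Real.rpow_natCast (n : ℝ) N, one_div, ← Real.rpow_neg hn.le, ← Real.rpow_add hn]
  congr 1
  push_cast
  ring

end

/-! ### Modularity and the explicit formula -/

open scoped Classical in
theorem propositionp {V : Type*} [AddCommGroup V] [Module ℚ V]
    (B : LinearMap.BilinForm ℚ V) (L : Submodule ℤ V) [IsEvenLattice B L]
    (v v' : ℝ) (κ κ' : ℤ) (hv : 2 * v = κ) (hv' : 2 * v' = κ') (n : ℕ) [NeZero n]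
    (ψ : ℍ → (disc B L → ℂ)) (hψ : IsVVModular B L κ κ' ψ) :
    IsVVModular B L κ κ' (heckeH B L v v' n ψ) ∧
      ∀ (τ : ℍ) (lam : disc B L),
        heckeH B L v v' n ψ τ lam =
          (((n : ℝ) ^ (2 * (v + v' - 1)) : ℝ) : ℂ) *
            ∑ γ ∈ Finset.univ.filter
                (fun γ : disc (rescale (n ^ 2) B) L => n • (γ : V ⧸ L) = (lam : V ⧸ L)),
              ∑ p ∈ (n ^ 2).divisorsAntidiagonal,
                ((1 / (p.2 : ℝ) ^ (v + v' + (Module.finrank ℚ V : ℝ) / 2) : ℝ) : ℂ) *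
                  ∑ s ∈ Finset.range p.2,
                    delta B L (n ^ 2) γ n * delta B L (n ^ 2) γ p.1 *
                      expTwoPiI (-((s : ℚ) / (p.1 : ℚ)) * quadRep (rescale (n ^ 2) B) L γ) *
                        component (ψ (heckePoint p.1 p.2 s τ)) (p.2 • (γ : V ⧸ L)) := by
  refine ⟨isVVModular_heckeH hv hv' n hψ, fun τ lam => ?_⟩
  have hN : (bPlus B : ℝ) + bMinus B = Module.finrank ℚ V := by
    exact_mod_cast bPlus_add_bMinus B L
  have hW : v + (bPlus B : ℝ) / 2 + (v' + (bMinus B : ℝ) / 2) =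
      v + v' + (Module.finrank ℚ V : ℝ) / 2 := by
    rw [← hN]
    ring
  have hC := congrArg (fun r : ℝ => (r : ℂ))
    (one_div_pow_mul_rpow (n := n) (v + v') (Module.finrank ℚ V))
  simp only [heckeH, heckeP, heckeT, hW]
  rw [← hC]
  simp only [Finset.mul_sum]
  refine Finset.sum_congr rfl fun γ _ => Finset.sum_congr rfl fun p _ =>
    Finset.sum_congr rfl fun s _ => ?_
  push_cast
  ring
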